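/- Let $n\ge 1$. A Lévy process is a process $(X_t)_{t\ge0}$ with $X_0=0$ a.s., stationary independent increments, and $\lim_{t\searrow0}\mathbb P(|X_t|>\varepsilon)=0$ for every $\varepsilon>0$. Let $T=(T_t)_{t\ge 0}$ be a subordinator (a one-dimensional Lévy process with a.s. nondecreasing paths), let $B=(B_t)_{t\ge0}$ be a Brownian motion on $\mathbb R^n$ run at twice the usual speed (a Lévy process with a.s. continuous paths and $\mathbb E e^{i\xi\cdot B_t}=e^{-t|\xi|^2}$), independent of $T$, and let $X_t=B_{T_t}$. Let $\Phi(\lambda)=-\log\mathbb E e^{-\lambda T_1}$, $\lambda\ge0$, be the Laplace exponent of $T$. Suppose that * there are $\delta>0$ and $c>0$ with $\Phi(\lambda)\ge c\lambda^\delta$ for all sufficiently large $\lambda$, and * $T_1$ has a density $\eta$ on $(0,\infty)$, and there are constants $C$ and $\gamma>0$ with $\eta(s)\le C s^{-1-\gamma/2}$ for all $s>0$. Then $X_1$ has a $C^\infty$ density $\phi$ on $\mathbb R^n$, and the following holds. For $y>0$ put $\phi_y(x)=y^{-n}\phi(x/y)$ and $\nabla=(\partial_{x_1},\dots,\partial_{x_n},\partial_y)$.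 Let $A(x,y)=(a^{i,j}(x,y))$ be any measurable (real or complex) $(n+1)\times(n+1)$ matrix-valued function on $\mathbb R^n\times(0,\infty)$ with $\big\|\sup_{|v|\le1}|A(x,y)v|\big\|_{L^\infty}<\infty$ and such that $a^{i,j}(x,y)=a^{i,j}(y)$ does not depend on $x$ whenever $i=n+1$ or $j=n+1$. Then the integral $$K_A(x,\tilde x)=\int_0^\infty\int_{\mathbb R^n}2y\,A(\bar x,y)\nabla\phi_y(\bar x-\tilde x)\cdot\nabla\phi_y(\bar x-x)\,d\bar x\,dy$$ converges absolutely for $x\ne\tilde x$. For Schwartz $f$ and every $x\in\mathbb R^n$, the singular integral $T_Af(x)=\int K_A(x,\tilde x)f(\tilde x)\,d\tilde x$, understood as $$T_Af(x)=\int_0^\infty\Big(\int_{\mathbb R^n}\Big(\int_{\mathbb R^n}2y\,A(\bar x,y)\nabla\phi_y(\bar x-\tilde x)\cdot\nabla\phi_y(\bar x-x)\,d\bar x\Big)f(\tilde x)\,d\tilde x\Big)dy ,$$ has an absolutely convergent $y$-integral, and $T_A$ is a Calderón–Zygmund operator with kernel $K_A$. That is: $T_A$ extends to a bounded linear operator on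 $L^2(\mathbb R^n)$; for a.e. $x\notin\operatorname{supp}f$ one has $T_Af(x)=\int K_A(x,\tilde x)f(\tilde x)\,d\tilde x$ with absolute convergence; and, for some $\kappa$, the kernel is differentiable in each variable off the diagonal and satisfies $$|K_A(x,\tilde x)|\le\frac{\kappa}{|x-\tilde x|^{n}},\qquad |\nabla_xK_A(x,\tilde x)|\le\frac{\kappa}{|x-\tilde x|^{n+1}},\qquad |\nabla_{\tilde x}K_A(x,\tilde x)|\le\frac{\kappa}{|x-\tilde x|^{n+1}}\qquad(x\neq\tilde x).$$ Moreover, the truncations $T^\varepsilon f(x)=\int_{|x-\tilde x|>\varepsilon}K_A(x,\tilde x)f(\tilde x)\,d\tilde x$ are bounded on $L^2$ uniformly in $\varepsilon>0$. There are functions $b_\varepsilon$, bounded uniformly in $\varepsilon>0$ and not depending on $f$, with $T_Af(x)=\lim_{\varepsilon\to0}\big(T^\varepsilon f(x)+b_\varepsilon(x)f(x)\big)$ for every Schwartz $f$ and every $x$. If the principal value $\lim_{\varepsilon\to0}T^\varepsilon f(x)$ exists for every Schwartz $f$ at a.e. $x$, then the operator it defines is also a Calderón–Zygmund operator with kernel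 $K_A$. Relativistic $\alpha$-stable processes are an example: let $0<\alpha<2$ and $m\ge0$, and suppose that $\Phi(\lambda)=(\lambda+m^{2/\alpha})^{\alpha/2}-m$ for $\lambda\ge0$. Then $\mathbb E e^{i\xi\cdot X_t}=\exp\!\big(-t\big((|\xi|^2+m^{2/\alpha})^{\alpha/2}-m\big)\big)$ for all $t\ge0$ and $\xi\in\mathbb R^n$, both hypotheses above are satisfied, and hence all the conclusions hold. -/

import Mathlib

open MeasureTheory ProbabilityTheory Filter Topology Set Asymptotics
open scoped NNReal ENNReal SchwartzMap Matrix

noncomputable section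

/-- The Euclidean space `ℝⁿ`. -/
abbrev E (n : ℕ) : Type := EuclideanSpace ℝ (Fin n)

section Processes

variable {Ω : Type*} [MeasurableSpace Ω]

/-- Lévy processes: `X₀ = 0` a.s., independent and stationary increments, stochastic continuity. -/
structure IsLevyProcess {V : Type*} [NormedAddCommGroup V] [MeasurableSpace V]
    (X : ℝ≥0 → Ω → V) (P : Measure Ω) : Prop where
  measurable : ∀ t, Measurable (X t)
  zero : ∀ᵐ ω ∂P, X 0 ω = 0
  indep_increments : HasIndepIncrements X P
  stationary_increments : ∀ s t, P.map (fun ω => X (s + t) ω - X s ω) = P.map (X t)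
  stochastically_continuous :
    ∀ ε : ℝ, 0 < ε → Tendsto (fun t => P {ω | ε < ‖X t ω‖}) (𝓝[>] 0) (𝓝 0)

/-- A subordinator: a one-dimensional Lévy process with a.s. nondecreasing paths. -/
structure IsSubordinator (T : ℝ≥0 → Ω → ℝ) (P : Measure Ω) : Prop extends IsLevyProcess T P where
  monotone_paths : ∀ᵐ ω ∂P, Monotone (fun t => T t ω)

/-- Brownian motion on `ℝⁿ` run at twice the usual speed: the Lévy process with a.s. continuous
paths and `𝔼 exp (i ξ · B_t) = exp (-t |ξ|²)`. -/
structure IsDoubleSpeedBrownianMotion {n : ℕ} (B : ℝ≥0 → Ω → E n) (P : Measure Ω) : Prop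
    extends IsLevyProcess B P where
  charFun_eq : ∀ (t : ℝ≥0) (ξ : E n),
    charFun (P.map (B t)) ξ = Complex.exp (-((t : ℝ) * ‖ξ‖ ^ 2 : ℝ))
  continuous_paths : ∀ᵐ ω ∂P, Continuous (fun t => B t ω)

/-- The subordinate process `X_t = B_{T_t}`. (A subordinator is a.s. nonnegative, so the
conversion to a nonnegative real only affects a null set.) -/
def subordinate {n : ℕ} (B : ℝ≥0 → Ω → E n) (T : ℝ≥0 → Ω → ℝ) (t : ℝ≥0) (ω : Ω) : E n :=
  B (T t ω).toNNReal ω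

/-- The Laplace exponent `Φ` of a subordinator, determined by `𝔼 exp (-l T₁) = exp (-Φ l)`. -/
def laplaceExponent (T : ℝ≥0 → Ω → ℝ) (P : Measure Ω) (l : ℝ) : ℝ :=
  -Real.log (∫ ω, Real.exp (-l * T 1 ω) ∂P)

/-- `Φ(l) ≥ c l ^ δ` for all large `l`, for some `c, δ > 0`. -/
def LaplaceExponentGrowth (T : ℝ≥0 → Ω → ℝ) (P : Measure Ω) : Prop :=
  ∃ δ : ℝ, 0 < δ ∧ (fun l : ℝ => l ^ δ) =O[atTop] laplaceExponent T P

/-- `T₁` has a density `η` on `(0, ∞)` with `η(s) ≤ C s ^ (-1 - γ/2)` for all `s > 0`, for some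
`C` and some `γ > 0`. -/
def DensityTailBound (T : ℝ≥0 → Ω → ℝ) (P : Measure Ω) : Prop :=
  ∃ (C γ : ℝ) (η : ℝ → ℝ), 0 < γ ∧ Measurable η ∧
    P.map (T 1) = (volume.restrict (Ioi 0)).withDensity (fun s => ENNReal.ofReal (η s)) ∧
    ∀ s : ℝ, 0 < s → 0 ≤ η s ∧ η s ≤ C * s ^ (-1 - γ / 2)

/-- `φ` is the smooth version of the density of the random vector `X` (such a version is unique). -/
def IsSmoothDensity {n : ℕ} (φ : E n → ℝ) (X : Ω → E n) (P : Measure Ω) : Prop :=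
  ContDiff ℝ (⊤ : ℕ∞) φ ∧ (∀ x, 0 ≤ φ x) ∧
    P.map X = (volume : Measure (E n)).withDensity (fun x => ENNReal.ofReal (φ x))

end Processes

section CalderonZygmund

/-- `φ_y(x) = y⁻ⁿ φ(x / y)`. -/
def dilate {n : ℕ} (φ : E n → ℝ) (y : ℝ) (x : E n) : ℝ :=
  (y ^ n)⁻¹ * φ (y⁻¹ • x)

/-- The full gradient `∇ φ_y (x) = (∂_{x₁}, …, ∂_{xₙ}, ∂_y) φ_y (x)`; the last entry is the
derivative in the dilation parameter. -/
def fullGrad {n : ℕ} (φ : E n → ℝ) (y : ℝ) (x : E n) : Fin (n + 1) → ℝ :=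
  Fin.snoc (α := fun _ => ℝ)
    (fun i : Fin n => fderiv ℝ (dilate φ y) x (EuclideanSpace.single i 1))
    (deriv (fun s => dilate φ s x) y)

variable {𝕜 : Type*} [RCLike 𝕜] {n : ℕ}

/-- Lebesgue measure on the half-space `ℝⁿ × (0, ∞)`. -/
def halfSpace (n : ℕ) : Measure (E n × ℝ) :=
  (volume : Measure (E n)).prod (volume.restrict (Ioi (0 : ℝ)))

/-- The admissible coefficient matrices: measurable, `‖ sup_{|v| ≤ 1} |A(x,y) v| ‖_∞ < ∞`, and
entries in the last row or column independent of `x`. -/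
structure IsAdmissible (A : E n → ℝ → Matrix (Fin (n + 1)) (Fin (n + 1)) 𝕜) : Prop where
  measurable : ∀ i j, AEMeasurable (fun p : E n × ℝ => A p.1 p.2 i j) (halfSpace n)
  bounded : ∃ M : ℝ, ∀ᵐ p ∂(halfSpace n), ∀ v : EuclideanSpace 𝕜 (Fin (n + 1)),
    ‖v‖ ≤ 1 → ‖Matrix.toEuclideanLin (A p.1 p.2) v‖ ≤ M
  indep_of_x : ∀ i j, i = Fin.last n ∨ j = Fin.last n →
    ∀ (x x' : E n) (y : ℝ), 0 < y → A x y i j = A x' y i j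

/-- `2 y A(z, y) ∇φ_y(z - x') · ∇φ_y(z - x)`. -/
def kernelIntegrand (φ : E n → ℝ) (A : E n → ℝ → Matrix (Fin (n + 1)) (Fin (n + 1)) 𝕜)
    (x x' z : E n) (y : ℝ) : 𝕜 :=
  ((2 * y : ℝ) : 𝕜) *
    ((A z y *ᵥ fun i => (fullGrad φ y (z - x') i : 𝕜)) ⬝ᵥ
      fun i => (fullGrad φ y (z - x) i : 𝕜))

/-- The kernel `K_A(x, x') = ∫₀^∞ ∫ 2 y A(z, y) ∇φ_y(z - x') · ∇φ_y(z - x) dz dy`. -/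
def kernelA (φ : E n → ℝ) (A : E n → ℝ → Matrix (Fin (n + 1)) (Fin (n + 1)) 𝕜)
    (x x' : E n) : 𝕜 :=
  ∫ y in Ioi (0 : ℝ), ∫ z : E n, kernelIntegrand φ A x x' z y

/-- At a fixed level `y`, the integral `∫ (∫ 2 y A(z, y) ∇φ_y(z - x') · ∇φ_y(z - x) dz) f(x') dx'`;
no singularity is present here. -/
def levelOperator (φ : E n → ℝ) (A : E n → ℝ → Matrix (Fin (n + 1)) (Fin (n + 1)) 𝕜)
    (f : E n → 𝕜) (x : E n) (y : ℝ) : 𝕜 :=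
  ∫ x' : E n, (∫ z : E n, kernelIntegrand φ A x x' z y) * f x'

/-- The operator `T_A f(x) = ∫ K_A(x, x') f(x') dx'`. The kernel is singular on the diagonal; the
singular integral is regularized by cutting off the level `y`, that is,
`T_A f(x) = lim_{ε → 0} ∫ K_A^ε(x, x') f(x') dx'`, where `K_A^ε` is `K_A` with `y > ε` only. -/
def operatorA (φ : E n → ℝ) (A : E n → ℝ → Matrix (Fin (n + 1)) (Fin (n + 1)) 𝕜)
    (f : 𝓢(E n, 𝕜)) (x : E n) : 𝕜 :=
  ∫ y in Ioi (0 : ℝ), levelOperator φ A f x y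

/-- The truncated integral `∫_{|x - x'| > ε} K(x, x') f(x') dx'`. -/
def truncated (K : E n → E n → 𝕜) (ε : ℝ) (f : 𝓢(E n, 𝕜)) (x : E n) : 𝕜 :=
  ∫ x' in {x' : E n | ε < ‖x - x'‖}, K x x' * f x'

/-- Size and smoothness conditions off the diagonal. -/
def IsCZKernel (K : E n → E n → 𝕜) : Prop :=
  ∃ κ : ℝ, ∀ x x' : E n, x ≠ x' →
    ‖K x x'‖ ≤ κ / ‖x - x'‖ ^ n ∧
    (DifferentiableAt ℝ (fun w => K w x') x ∧
      ‖fderiv ℝ (fun w => K w x') x‖ ≤ κ / ‖x - x'‖ ^ (n + 1)) ∧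
    (DifferentiableAt ℝ (fun w => K x w) x' ∧
      ‖fderiv ℝ (fun w => K x w) x'‖ ≤ κ / ‖x - x'‖ ^ (n + 1))

/-- `T`, acting on Schwartz functions, is a Calderón–Zygmund operator with kernel `K`: it has a
bounded linear extension to `L²`, it is given by integration against `K` off the support of the
function, and `K` satisfies the size and smoothness conditions. -/
structure IsCZOperator (T : 𝓢(E n, 𝕜) → E n → 𝕜) (K : E n → E n → 𝕜) : Prop where
  l2_bounded : ∃ L : Lp 𝕜 2 (volume : Measure (E n)) →L[𝕜] Lp 𝕜 2 (volume : Measure (E n)),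
    ∀ f : 𝓢(E n, 𝕜), T f =ᵐ[volume] L (f.toLp 2)
  kernel : IsCZKernel K
  repr : ∀ f : 𝓢(E n, 𝕜), ∀ᵐ x : E n, x ∉ tsupport f →
    Integrable (fun x' => K x x' * f x') ∧ T f x = ∫ x', K x x' * f x'

/-- The operator `T_A` built from `φ` and `A` is a Calderón–Zygmund operator with kernel `K_A`. -/
structure GeneratesCZ (φ : E n → ℝ)
    (A : E n → ℝ → Matrix (Fin (n + 1)) (Fin (n + 1)) 𝕜) : Prop where
  /-- The integral defining `K_A` converges absolutely off the diagonal. -/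
  kernel_integrable : ∀ x x' : E n, x ≠ x' →
    Integrable (fun p : E n × ℝ => kernelIntegrand φ A x x' p.1 p.2) (halfSpace n)
  /-- The integral defining `T_A f` converges at every point. -/
  operator_integrable : ∀ (f : 𝓢(E n, 𝕜)) (x : E n),
    IntegrableOn (fun y => levelOperator φ A f x y) (Ioi 0)
  /-- `T_A` is a Calderón–Zygmund operator with kernel `K_A`. -/
  isCZOperator : IsCZOperator (operatorA φ A) (kernelA φ A)
  /-- `T_A` as a principal value, up to multiplication by a bounded function. -/
  principal_value : ∃ (C : ℝ) (b : ℝ → E n → 𝕜), (∀ ε : ℝ, 0 < ε → ∀ x, ‖b ε x‖ ≤ C) ∧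
    ∀ (f : 𝓢(E n, 𝕜)) (x : E n),
      Tendsto (fun ε => truncated (kernelA φ A) ε f x + b ε x * f x) (𝓝[>] 0)
        (𝓝 (operatorA φ A f x))
  /-- The truncated operators are bounded on `L²` uniformly in the truncation. -/
  truncated_bounded : ∃ C : ℝ≥0, ∀ ε : ℝ, 0 < ε → ∀ f : 𝓢(E n, 𝕜),
    eLpNorm (truncated (kernelA φ A) ε f) 2 volume ≤ C * eLpNorm f 2 volume
  /-- If the principal value of `∫ K_A(x, x') f(x') dx'` exists a.e. for all `f`, then it too is a
  Calderón–Zygmund operator. -/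
  principal_value_isCZ : ∀ S : 𝓢(E n, 𝕜) → E n → 𝕜,
    (∀ f : 𝓢(E n, 𝕜), ∀ᵐ x : E n,
      Tendsto (fun ε => truncated (kernelA φ A) ε f x) (𝓝[>] 0) (𝓝 (S f x))) →
    IsCZOperator S (kernelA φ A)

end CalderonZygmund

end

/-! Conditioning on `T 1` shows that `X_1` has characteristic function `𝔼 exp (-|ξ|² T_1)`, so its
density is the Gaussian mixture `φ(x) = ∫ (4πs)^(-n/2) exp (-|x|²/4s) μ(ds)`, with `μ` the law of `T
1`. Growth of the Laplace exponent makes the Laplace transform of `μ` decay rapidly, so `μ` has all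
negative moments and `φ` is smooth. The bound on the density of `T 1` makes `φ` and its derivatives
decay like functions of homogeneity `-n-γ`, `-n-γ-1`, and so on (`IsMixing.abs_mixture_le`).

The kernel is a superposition over levels `y` of `k_y(x,x') = 2y ∫ A ∇φ_y(z-x') · ∇φ_y(z-x) dz`. All
size estimates reduce to the weight `y^(γ-1)/(y+r)^(N+γ)`: two such weights convolve to a multiple
of a third one, and the integral over all levels is a multiple of `r^(-N)`. The case `N = n` bounds
the kernel and `N = n+1` bounds its gradient. For tangential entries of `A` the gradient estimate
comes from the extra decay of the spatial derivatives of `φ`. The `y`-derivative lacks this decay,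
but there the coefficient does not depend on `x`, so `k_y` is a pure correlation and an integration
by parts recovers the missing order (`HasWeightBound.norm_gradient_correlation_le`).

The `L²` bound is a square function argument. By Fubini, pairing `k_y` with `f` and `g` gives the
integral of `A` against two convolutions with components of `∇φ_y`. Cauchy–Schwarz and Plancherel
reduce the bound to `∫ y |(Ψ_y)^(ξ)|² dy ≤ C` uniformly in `ξ`. Scaling in `y` eliminates `ξ` and
leaves a moment of `μ` (`IsMixing.lintegral_level_exp_le`). The mean zero of `∇φ_y` makes small
levels act weakly on Hölder functions, so `T_A f` converges pointwise. Cutting in space and cutting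
in the level differ by an approximate identity at scale `ε`
(`IsLevelKernel.norm_truncationError_le`); this gives the truncated bounds and the functions `b_ε`.

For relativistic processes the issue is the density bound. Differentiating the Laplace transform
shows that `s μ(ds)` is the convolution of `μ` with `u ν(du)`, where `ν` is the Lévy measure
(`IsRelativisticLaw.lintegral_ofReal_mul`). Iterating this identity on fractional integrals of `μ`
gives `s μ(ds) ≤ D s^(-α/2) ds`. -/

/-! ### The weight `y ^ (γ - 1) / (y + r) ^ (N + γ)` -/

section Weight

/-- The weight controlling, at level `y` and distance `r`, all kernels of homogeneity `-N`. -/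
noncomputable def levelWeight (γ N y r : ℝ) : ℝ := y ^ (γ - 1) / (y + r) ^ (N + γ)

variable {γ N y r : ℝ}

lemma levelWeight_pos (hy : 0 < y) (hr : 0 ≤ r) : 0 < levelWeight γ N y r := by
  unfold levelWeight; positivity

lemma levelWeight_nonneg (hy : 0 < y) (hr : 0 ≤ r) : 0 ≤ levelWeight γ N y r :=
  (levelWeight_pos hy hr).le

lemma levelWeight_anti (hN : 0 ≤ N + γ) (hy : 0 < y) (hr : 0 ≤ r) {r' : ℝ} (h : r ≤ r') :
    levelWeight γ N y r' ≤ levelWeight γ N y r := by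
  unfold levelWeight
  gcongr

lemma levelWeight_le_of_half (hN : 0 ≤ N + γ) (hy : 0 < y) (hr : 0 ≤ r) {r' : ℝ}
    (h : (y + r) / 2 ≤ y + r') :
    levelWeight γ N y r' ≤ 2 ^ (N + γ) * levelWeight γ N y r := by
  unfold levelWeight
  have h1 : ((y + r) / 2) ^ (N + γ) ≤ (y + r') ^ (N + γ) := by gcongr
  calc y ^ (γ - 1) / (y + r') ^ (N + γ) ≤ y ^ (γ - 1) / ((y + r) / 2) ^ (N + γ) := by
        gcongr
    _ = _ := by
        rw [Real.div_rpow (by positivity) (by norm_num)]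
        field_simp

lemma levelWeight_le_rpow_level (hN : 0 ≤ N + γ) (hy : 0 < y) (hr : 0 ≤ r) :
    levelWeight γ N y r ≤ y ^ (-N - 1) := by
  refine (levelWeight_anti hN hy le_rfl hr).trans (le_of_eq ?_)
  unfold levelWeight
  rw [add_zero, ← Real.rpow_sub hy]
  ring_nf

lemma levelWeight_le_rpow_dist (hN : 0 ≤ N + γ) (hy : 0 < y) (hr : 0 < r) :
    levelWeight γ N y r ≤ y ^ (γ - 1) * r ^ (-(N + γ)) := by
  unfold levelWeight
  rw [Real.rpow_neg hr.le, ← div_eq_mul_inv]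
  gcongr
  linarith

lemma levelWeight_add_one_mul (hy : 0 < y) (hr : 0 ≤ r) :
    (y + r) * levelWeight γ (N + 1) y r = levelWeight γ N y r := by
  unfold levelWeight
  rw [show N + 1 + γ = (N + γ) + 1 by ring, Real.rpow_add_one (by positivity)]
  field_simp

lemma mul_levelWeight_add_one_le (hy : 0 < y) (hr : 0 ≤ r) :
    y * levelWeight γ (N + 1) y r ≤ levelWeight γ N y r := by
  rw [← levelWeight_add_one_mul (N := N) hy hr]
  exact mul_le_mul_of_nonneg_right (by linarith) (levelWeight_nonneg hy hr)

lemma dist_mul_levelWeight_add_one_le (hy : 0 < y) (hr : 0 ≤ r) :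
    r * levelWeight γ (N + 1) y r ≤ levelWeight γ N y r := by
  rw [← levelWeight_add_one_mul (N := N) hy hr]
  exact mul_le_mul_of_nonneg_right (by linarith) (levelWeight_nonneg hy hr)

/-- Factoring `y` out of `y + r` exhibits the weight as a dilation of `(1 + |x|)^(-(N+γ))`, the form
in which profile bounds at level `1` are transported to level `y`. -/
lemma levelWeight_eq (hy : 0 < y) (hr : 0 ≤ r) :
    levelWeight γ N y r = y ^ (-N - 1) * (1 + r / y) ^ (-(N + γ)) := by
  unfold levelWeight
  have : y + r = y * (1 + r / y) := by field_simp
  rw [this, Real.mul_rpow hy.le (by positivity), Real.rpow_neg (by positivity)]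
  have h2 : y ^ (-N - 1) = y ^ (γ - 1) / y ^ (N + γ) := by
    rw [← Real.rpow_sub hy]; ring_nf
  rw [h2]
  field_simp

lemma measurable_levelWeight {α : Type*} [MeasurableSpace α] {f g : α → ℝ} (hf : Measurable f)
    (hg : Measurable g) : Measurable fun a => levelWeight γ N (f a) (g a) := by
  unfold levelWeight
  exact (hf.pow_const _).div ((hf.add hg).pow_const _)

/-- The total mass of the weight at level `1`. -/
noncomputable def weightMass (n : ℕ) (a : ℝ) : ℝ := ∫ x : E n, (1 + ‖x‖) ^ (-a)

lemma weightMass_nonneg (n : ℕ) (a : ℝ) : 0 ≤ weightMass n a :=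
  integral_nonneg fun x => by positivity

variable {n : ℕ}

lemma integrable_levelWeight (hN : (n : ℝ) < N + γ) (hy : 0 < y) (x : E n) :
    Integrable (fun z : E n => levelWeight γ N y ‖z - x‖) := by
  have h := integrable_one_add_norm (E := E n) (μ := volume) (r := N + γ) (by simpa using hN)
  have h2 := (h.comp_smul (R := y⁻¹) (by positivity)).const_mul (y ^ (-N - 1))
  refine Integrable.comp_sub_right (f := fun z : E n => levelWeight γ N y ‖z‖) (h2.congr
    (ae_of_all _ fun z => ?_)) x
  simp only [levelWeight_eq hy (norm_nonneg z), norm_smul, norm_inv, Real.norm_eq_abs,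
    abs_of_pos hy]
  ring_nf

lemma integral_levelWeight (hy : 0 < y) (x : E n) :
    ∫ z : E n, levelWeight γ N y ‖z - x‖ = weightMass n (N + γ) * y ^ ((n : ℝ) - N - 1) := by
  rw [integral_sub_right_eq_self (fun z : E n => levelWeight γ N y ‖z‖) x]
  have h : ∀ z : E n, levelWeight γ N y ‖z‖ =
      y ^ (-N - 1) * (1 + ‖y⁻¹ • z‖) ^ (-(N + γ)) := fun z => by
    simp only [levelWeight_eq hy (norm_nonneg z), norm_smul, norm_inv, Real.norm_eq_abs,
      abs_of_pos hy]
    ring_nf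
  simp_rw [h]
  rw [integral_const_mul, Measure.integral_comp_inv_smul_of_nonneg volume
    (fun z : E n => (1 + ‖z‖) ^ (-(N + γ))) hy.le]
  simp only [finrank_euclideanSpace, Fintype.card_fin, smul_eq_mul]
  rw [show (n : ℝ) - N - 1 = (-N - 1) + n by ring, Real.rpow_add hy, Real.rpow_natCast]
  unfold weightMass
  ring

lemma dist_split (y : ℝ) (hy : 0 < y) (x x' z : E n) :
    (y + ‖x - x'‖) / 2 ≤ y + ‖z - x‖ ∨ (y + ‖x - x'‖) / 2 ≤ y + ‖z - x'‖ := by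
  by_contra! h
  have := norm_sub_le (z - x') (z - x)
  rw [show z - x' - (z - x) = x - x' by abel] at this
  linarith [h.1, h.2]

/-- By `dist_split` one of the two factors sits at a distance comparable to `y + ‖x - x'‖` and can
be frozen there at the cost of `2^(N+γ)`. The sum of both factors covers either alternative. -/
lemma levelWeight_mul_le (hN : 0 ≤ N + γ) (hy : 0 < y) (x x' z : E n) :
    levelWeight γ N y ‖z - x‖ * levelWeight γ N y ‖z - x'‖ ≤
      2 ^ (N + γ) * levelWeight γ N y ‖x - x'‖ *
        (levelWeight γ N y ‖z - x‖ + levelWeight γ N y ‖z - x'‖) := by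
  have p1 := levelWeight_nonneg (γ := γ) (N := N) hy (norm_nonneg (z - x))
  have p2 := levelWeight_nonneg (γ := γ) (N := N) hy (norm_nonneg (z - x'))
  have p3 := levelWeight_nonneg (γ := γ) (N := N) hy (norm_nonneg (x - x'))
  have p4 : (0 : ℝ) ≤ 2 ^ (N + γ) * levelWeight γ N y ‖x - x'‖ := by positivity
  rcases dist_split y hy x x' z with h | h
  · have := levelWeight_le_of_half hN hy (norm_nonneg _) h
    nlinarith [mul_le_mul_of_nonneg_right this p2, mul_nonneg p4 p1]
  · have := levelWeight_le_of_half hN hy (norm_nonneg _) h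
    nlinarith [mul_le_mul_of_nonneg_left this p1, mul_nonneg p4 p2]

lemma integrable_levelWeight_mul (hγ : 0 < γ) (hN : (n : ℝ) ≤ N) (hy : 0 < y) (x x' : E n) :
    Integrable (fun z : E n => levelWeight γ N y ‖z - x‖ * levelWeight γ N y ‖z - x'‖) := by
  have hN' : (n : ℝ) < N + γ := by linarith
  have hN0 : 0 ≤ N + γ := (Nat.cast_nonneg n).trans hN'.le
  refine Integrable.mono' (((integrable_levelWeight hN' hy x).add
    (integrable_levelWeight hN' hy x')).const_mul (2 ^ (N + γ) * levelWeight γ N y ‖x - x'‖))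
    ?_ (ae_of_all _ fun z => ?_)
  · exact ((measurable_levelWeight (by fun_prop) (by fun_prop)).mul
      (measurable_levelWeight (by fun_prop) (by fun_prop))).aestronglyMeasurable
  · rw [Real.norm_eq_abs, abs_of_nonneg (mul_nonneg (levelWeight_nonneg hy (norm_nonneg _))
      (levelWeight_nonneg hy (norm_nonneg _)))]
    exact levelWeight_mul_le hN0 hy x x' z

/-- The constant in the convolution estimate for the weights. -/
noncomputable def convConst (n : ℕ) (a : ℝ) : ℝ := 2 ^ a * (2 * weightMass n a)

lemma convConst_nonneg (n : ℕ) (a : ℝ) : 0 ≤ convConst n a := by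
  have := weightMass_nonneg n a
  unfold convConst; positivity

/-- For `N = n` the power of `y` is `-1`, which the factor `2y` of the kernels cancels exactly. For
`N = n + 1` it is `-2`, and tangential decay must supply the second factor `y`. -/
lemma integral_levelWeight_mul_le (hγ : 0 < γ) (hN : (n : ℝ) ≤ N) (hy : 0 < y) (x x' : E n) :
    ∫ z : E n, levelWeight γ N y ‖z - x‖ * levelWeight γ N y ‖z - x'‖ ≤
      convConst n (N + γ) * y ^ ((n : ℝ) - N - 1) * levelWeight γ N y ‖x - x'‖ := by
  have hN' : (n : ℝ) < N + γ := by linarith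
  have hN0 : 0 ≤ N + γ := (Nat.cast_nonneg n).trans hN'.le
  refine (integral_mono (integrable_levelWeight_mul hγ hN hy x x')
    (((integrable_levelWeight hN' hy x).add
    (integrable_levelWeight hN' hy x')).const_mul (2 ^ (N + γ) * levelWeight γ N y ‖x - x'‖))
    fun z => levelWeight_mul_le hN0 hy x x' z).trans (le_of_eq ?_)
  rw [integral_const_mul]
  simp only [Pi.add_apply]
  rw [integral_add (integrable_levelWeight hN' hy x)
    (integrable_levelWeight hN' hy x'), integral_levelWeight hy, integral_levelWeight hy]
  unfold convConst
  ring

lemma integrableOn_rpow_Ioc (hγ : 0 < γ) (hr : 0 ≤ r) :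
    IntegrableOn (fun y : ℝ => y ^ (γ - 1)) (Ioc 0 r) := by
  rw [← intervalIntegrable_iff_integrableOn_Ioc_of_le hr]
  exact intervalIntegral.intervalIntegrable_rpow' (by linarith)

lemma integral_rpow_Ioc (hγ : 0 < γ) (hr : 0 ≤ r) :
    ∫ y in Ioc 0 r, y ^ (γ - 1) = r ^ γ / γ := by
  rw [← intervalIntegral.integral_of_le hr, integral_rpow (Or.inl (by linarith))]
  simp [Real.zero_rpow hγ.ne']

lemma integrableOn_rpow_Ioi (hN : 0 < N) (hr : 0 < r) :
    IntegrableOn (fun y : ℝ => y ^ (-N - 1)) (Ioi r) :=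
  integrableOn_Ioi_rpow_of_lt (by linarith) hr

lemma integral_rpow_Ioi (hN : 0 < N) (hr : 0 < r) :
    ∫ y in Ioi r, y ^ (-N - 1) = r ^ (-N) / N := by
  rw [integral_Ioi_rpow_of_lt (by linarith) hr, sub_add_cancel, neg_div_neg_eq]

lemma integrableOn_levelWeight_Ioc (hγ : 0 < γ) (hN : 0 < N) (hr : 0 < r) {a : ℝ} (ha : 0 ≤ a) :
    IntegrableOn (fun y => levelWeight γ N y r) (Ioc 0 a) := by
  refine Integrable.mono' ((integrableOn_rpow_Ioc hγ ha).mul_const (r ^ (-(N + γ))))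
    (measurable_levelWeight (by fun_prop) (by fun_prop)).aestronglyMeasurable ?_
  filter_upwards [ae_restrict_mem measurableSet_Ioc] with y hy
  rw [Real.norm_eq_abs, abs_of_nonneg (levelWeight_nonneg hy.1 hr.le)]
  exact levelWeight_le_rpow_dist (by positivity) hy.1 hr

lemma integrableOn_levelWeight_Ioi (hγ : 0 < γ) (hN : 0 < N) (hr : 0 ≤ r) {a : ℝ} (ha : 0 < a) :
    IntegrableOn (fun y => levelWeight γ N y r) (Ioi a) := by
  refine Integrable.mono' (integrableOn_rpow_Ioi hN ha)
    (measurable_levelWeight (by fun_prop) (by fun_prop)).aestronglyMeasurable ?_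
  filter_upwards [ae_restrict_mem measurableSet_Ioi] with y hy
  have hy0 : 0 < y := ha.trans hy
  rw [Real.norm_eq_abs, abs_of_nonneg (levelWeight_nonneg hy0 hr)]
  exact levelWeight_le_rpow_level (by positivity) hy0 hr

lemma integrableOn_levelWeight (hγ : 0 < γ) (hN : 0 < N) (hr : 0 < r) :
    IntegrableOn (fun y => levelWeight γ N y r) (Ioi 0) := by
  rw [← Ioc_union_Ioi_eq_Ioi (zero_le_one (α := ℝ))]
  exact (integrableOn_levelWeight_Ioc hγ hN hr zero_le_one).union
    (integrableOn_levelWeight_Ioi hγ hN hr.le one_pos)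

lemma integral_levelWeight_Ioc_le (hγ : 0 < γ) (hN : 0 < N) (hr : 0 < r) {a : ℝ} (ha : 0 ≤ a) :
    ∫ y in Ioc 0 a, levelWeight γ N y r ≤ a ^ γ / γ * r ^ (-(N + γ)) := by
  rw [← integral_rpow_Ioc hγ ha, ← integral_mul_const]
  refine setIntegral_mono_on (integrableOn_levelWeight_Ioc hγ hN hr ha)
    ((integrableOn_rpow_Ioc hγ ha).mul_const _) measurableSet_Ioc fun y hy => ?_
  exact levelWeight_le_rpow_dist (by positivity) hy.1 hr

lemma integral_levelWeight_Ioi_le (hγ : 0 < γ) (hN : 0 < N) (hr : 0 ≤ r) {a : ℝ} (ha : 0 < a) :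
    ∫ y in Ioi a, levelWeight γ N y r ≤ a ^ (-N) / N := by
  rw [← integral_rpow_Ioi hN ha]
  refine setIntegral_mono_on (integrableOn_levelWeight_Ioi hγ hN hr ha)
    (integrableOn_rpow_Ioi hN ha) measurableSet_Ioi fun y hy => ?_
  exact levelWeight_le_rpow_level (by positivity) (ha.trans hy) hr

/-- Splitting at the natural scale `y = r`: below it `y^(γ-1)` is integrable because `γ > 0`, above
it `y^(-N-1)` is integrable because `N > 0`, and both parts are multiples of `r^(-N)`. -/
lemma integral_levelWeight_level_le (hγ : 0 < γ) (hN : 0 < N) (hr : 0 < r) :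
    ∫ y in Ioi 0, levelWeight γ N y r ≤ (1 / γ + 1 / N) * r ^ (-N) := by
  rw [← Ioc_union_Ioi_eq_Ioi hr.le, setIntegral_union (Ioc_disjoint_Ioi le_rfl) measurableSet_Ioi
    (integrableOn_levelWeight_Ioc hγ hN hr hr.le) (integrableOn_levelWeight_Ioi hγ hN hr.le hr)]
  have h1 := integral_levelWeight_Ioc_le hγ hN hr hr.le
  have h2 := integral_levelWeight_Ioi_le hγ hN hr.le hr
  have h3 : r ^ γ / γ * r ^ (-(N + γ)) = 1 / γ * r ^ (-N) := by
    rw [div_mul_eq_mul_div, ← Real.rpow_add hr]; ring_nf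
  rw [h3] at h1
  calc _ ≤ _ := add_le_add h1 h2
    _ = _ := by ring

end Weight

/-! ### Tools for `L²` bounds -/

section LTwo

lemma lintegral_mul_sq_le {α : Type*} [MeasurableSpace α] {μ : Measure α} {f g : α → ℝ≥0∞}
    (hf : AEMeasurable f μ) (hg : AEMeasurable g μ) :
    (∫⁻ a, f a * g a ∂μ) ^ 2 ≤ (∫⁻ a, f a ^ 2 ∂μ) * ∫⁻ a, g a ^ 2 ∂μ := by
  have h := ENNReal.lintegral_mul_le_Lp_mul_Lq μ Real.HolderConjugate.two_two hf hg
  simp only [Pi.mul_apply, ENNReal.rpow_two] at h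
  calc _ ≤ _ := pow_le_pow_left₀ zero_le h 2
    _ = _ := by
      rw [mul_pow, ← ENNReal.rpow_two, ← ENNReal.rpow_two, ← ENNReal.rpow_mul, ← ENNReal.rpow_mul]
      norm_num

lemma eLpNorm_two_sq {α F : Type*} [MeasurableSpace α] {μ : Measure α} [NormedAddCommGroup F]
    (f : α → F) : eLpNorm f 2 μ ^ 2 = ∫⁻ a, ‖f a‖ₑ ^ 2 ∂μ := by
  rw [eLpNorm_eq_lintegral_rpow_enorm_toReal (by norm_num) (by norm_num), ← ENNReal.rpow_two,
    ← ENNReal.rpow_mul]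
  norm_num

lemma ENNReal.le_of_sq_le_sq {a b : ℝ≥0∞} (h : a ^ 2 ≤ b ^ 2) : a ≤ b :=
  le_of_not_gt fun hlt => absurd h (not_le.2 (ENNReal.pow_lt_pow_left two_ne_zero hlt))

variable {𝕜 : Type*} [RCLike 𝕜] {n : ℕ}

/-- A bounded function which pairs boundedly with `L²` is in `L²`. -/
lemma eLpNorm_two_le_of_pairing {h : E n → 𝕜} (hm : Measurable h) {M : ℝ} (hM : ∀ x, ‖h x‖ ≤ M)
    {C : ℝ≥0∞}
    (hC : ∀ g : E n → 𝕜, Measurable g → Integrable g → MemLp g 2 →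
      ‖∫ x, h x * g x‖ₑ ≤ C * eLpNorm g 2 volume) :
    eLpNorm h 2 volume ≤ C := by
  have key : ∀ R : ℝ, ∫⁻ x in Metric.ball (0 : E n) R, ‖h x‖ₑ ^ 2 ≤ C ^ 2 := by
    intro R
    -- Testing against the conjugate of `h` on a ball turns the pairing into `‖g‖²`. Boundedness of
    -- `h` makes `‖g‖` finite, so one factor can be cancelled.
    set g : E n → 𝕜 := (Metric.ball (0 : E n) R).indicator fun x => (starRingEnd 𝕜) (h x) with hg
    have hgm : Measurable g :=
      (RCLike.continuous_conj.measurable.comp hm).indicator measurableSet_ball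
    have hgb : ∀ p : ℝ≥0∞, MemLp g p := by
      intro p
      rw [hg, memLp_indicator_iff_restrict measurableSet_ball]
      have : IsFiniteMeasure ((volume : Measure (E n)).restrict (Metric.ball (0 : E n) R)) :=
        ⟨by simpa using measure_ball_lt_top⟩
      exact MemLp.of_bound (RCLike.continuous_conj.measurable.comp hm).aestronglyMeasurable M
        (ae_of_all _ fun x => by simpa using hM x)
    have hgi : Integrable g := memLp_one_iff_integrable.1 (hgb 1)
    have hA : eLpNorm g 2 volume ^ 2 = ∫⁻ x in Metric.ball (0 : E n) R, ‖h x‖ₑ ^ 2 := by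
      rw [eLpNorm_two_sq, ← lintegral_indicator measurableSet_ball]
      congr 1
      ext x
      by_cases hx : x ∈ Metric.ball (0 : E n) R
      · have e0 : ‖(starRingEnd 𝕜) (h x)‖ₑ = ‖h x‖ₑ := by
          rw [← ofReal_norm, RCLike.norm_conj, ofReal_norm]
        simp only [hg, indicator_of_mem hx, e0]
      · simp [hg, hx]
    have hB : ‖∫ x, h x * g x‖ₑ = eLpNorm g 2 volume ^ 2 := by
      have e1 : ∀ x, h x * g x = ((‖g x‖ ^ 2 : ℝ) : 𝕜) := by
        intro x
        by_cases hx : x ∈ Metric.ball (0 : E n) R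
        · simp [hg, hx, RCLike.mul_conj]
        · simp [hg, hx]
      simp_rw [e1]
      rw [integral_ofReal, ← ofReal_norm, RCLike.norm_ofReal,
        abs_of_nonneg (integral_nonneg fun x => by positivity),
        ofReal_integral_eq_lintegral_ofReal ?_ (ae_of_all _ fun x => by positivity), eLpNorm_two_sq]
      · congr 1
        ext x
        rw [ENNReal.ofReal_pow (norm_nonneg _), ofReal_norm]
      · exact (hgb 2).integrable_norm_pow two_ne_zero
    have hfin : eLpNorm g 2 volume ≠ ⊤ := (hgb 2).2.ne
    have h1 := hC g hgm hgi (hgb 2)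
    rw [hB] at h1
    have h2 : eLpNorm g 2 volume ≤ C := by
      rcases eq_or_ne (eLpNorm g 2 volume) 0 with h0 | h0
      · rw [h0]; exact zero_le
      · rw [sq] at h1
        exact (ENNReal.mul_le_mul_iff_left h0 hfin).1 h1
    rw [← hA]
    exact pow_le_pow_left₀ zero_le h2 2
  refine ENNReal.le_of_sq_le_sq ?_
  rw [eLpNorm_two_sq]
  refine le_of_tendsto ((aecover_ball (μ := (volume : Measure (E n))) (x := (0 : E n))
    (tendsto_natCast_atTop_atTop (R := ℝ))).lintegral_tendsto_of_countably_generated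
    (hm.enorm.pow_const 2).aemeasurable) (Eventually.of_forall fun i => key i)

/-- Young's inequality for the convolution of an integrable and a square integrable function. -/
lemma eLpNorm_two_le_of_conv {F : E n → 𝕜} {f : E n → 𝕜} (hf : Measurable f) {W : E n → ℝ≥0∞}
    (hW : Measurable W) (hF : ∀ x, ‖F x‖ₑ ≤ ∫⁻ x', W (x' - x) * ‖f x'‖ₑ) :
    eLpNorm F 2 volume ≤ (∫⁻ z, W z) * eLpNorm f 2 volume := by
  refine ENNReal.le_of_sq_le_sq ?_
  rw [mul_pow, eLpNorm_two_sq, eLpNorm_two_sq]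
  have h1 : ∀ x, ‖F x‖ₑ ^ 2 ≤ (∫⁻ z, W z) * ∫⁻ x', W (x' - x) * ‖f x'‖ₑ ^ 2 := by
    intro x
    have hWx : Measurable fun x' => W (x' - x) := hW.comp (measurable_id.sub_const x)
    -- Cauchy–Schwarz with `W |f| = W^(1/2) · (W^(1/2) |f|)`, so that only one power of `W` remains
    -- next to `|f|²`.
    have := lintegral_mul_sq_le (μ := (volume : Measure (E n)))
      (f := fun x' => W (x' - x) ^ (1 / 2 : ℝ))
      (g := fun x' => W (x' - x) ^ (1 / 2 : ℝ) * ‖f x'‖ₑ)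
      (hWx.pow_const _).aemeasurable ((hWx.pow_const _).mul hf.enorm).aemeasurable
    have e : ∀ a : ℝ≥0∞, a ^ (1 / 2 : ℝ) * a ^ (1 / 2 : ℝ) = a := fun a => by
      rw [← ENNReal.rpow_add_of_nonneg _ _ (by norm_num) (by norm_num)]; norm_num
    simp_rw [mul_pow, sq (_ ^ (1 / 2 : ℝ)), e, ← mul_assoc, e] at this
    rw [lintegral_sub_right_eq_self W x] at this
    exact (pow_le_pow_left₀ zero_le (hF x) 2).trans this
  calc ∫⁻ x, ‖F x‖ₑ ^ 2 ≤ ∫⁻ x, (∫⁻ z, W z) * ∫⁻ x', W (x' - x) * ‖f x'‖ₑ ^ 2 := lintegral_mono h1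
    _ = (∫⁻ z, W z) * ∫⁻ x, ∫⁻ x', W (x' - x) * ‖f x'‖ₑ ^ 2 := by
      rw [lintegral_const_mul]
      exact Measurable.lintegral_prod_right'
        (f := fun p : E n × E n => W (p.2 - p.1) * ‖f p.2‖ₑ ^ 2)
        ((hW.comp (measurable_snd.sub measurable_fst)).mul
          ((hf.comp measurable_snd).enorm.pow_const 2))
    _ = (∫⁻ z, W z) * ∫⁻ x', ∫⁻ x, W (x' - x) * ‖f x'‖ₑ ^ 2 := by
      rw [lintegral_lintegral_swap]
      exact ((hW.comp (measurable_snd.sub measurable_fst)).mul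
          ((hf.comp measurable_snd).enorm.pow_const 2)).aemeasurable
    _ = (∫⁻ z, W z) * ∫⁻ x', (∫⁻ z, W z) * ‖f x'‖ₑ ^ 2 := by
      congr 1
      refine lintegral_congr fun x' => ?_
      rw [lintegral_mul_const _ (by fun_prop),
        lintegral_sub_left_eq_self W x']
    _ = _ := by
      rw [lintegral_const_mul _ (hf.enorm.pow_const 2), ← mul_assoc, sq]

/-- Extension of an operator on Schwartz functions to `L²`. -/
lemma exists_extension {S : 𝓢(E n, 𝕜) → E n → 𝕜} (hm : ∀ f, AEStronglyMeasurable (S f) volume)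
    (hadd : ∀ f g, S (f + g) =ᵐ[volume] S f + S g)
    (hsmul : ∀ (c : 𝕜) f, S (c • f) =ᵐ[volume] c • S f) {C : ℝ≥0}
    (hC : ∀ f, eLpNorm (S f) 2 volume ≤ C * eLpNorm f 2 volume) :
    ∃ L : Lp 𝕜 2 (volume : Measure (E n)) →L[𝕜] Lp 𝕜 2 (volume : Measure (E n)),
      ∀ f : 𝓢(E n, 𝕜), S f =ᵐ[volume] L (f.toLp 2) := by
  have hmem : ∀ f, MemLp (S f) 2 volume := fun f =>
    ⟨hm f, (hC f).trans_lt (ENNReal.mul_lt_top ENNReal.coe_lt_top (f.memLp 2 volume).2)⟩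
  let S₀ : 𝓢(E n, 𝕜) →ₗ[𝕜] Lp 𝕜 2 (volume : Measure (E n)) :=
    { toFun := fun f => (hmem f).toLp
      map_add' := fun f g => by
        rw [← MemLp.toLp_add]
        exact (MemLp.toLp_eq_toLp_iff _ _).2 (hadd f g)
      map_smul' := fun c f => by
        rw [RingHom.id_apply, ← MemLp.toLp_const_smul]
        exact (MemLp.toLp_eq_toLp_iff _ _).2 (hsmul c f) }
  let e : 𝓢(E n, 𝕜) →ₗ[𝕜] Lp 𝕜 2 (volume : Measure (E n)) :=
    (SchwartzMap.toLpCLM 𝕜 𝕜 2 volume).toLinearMap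
  have hd : DenseRange e := SchwartzMap.denseRange_toLpCLM (F := 𝕜) (p := 2) (by norm_num)
  have hb : ∃ C : ℝ, ∀ f, ‖S₀ f‖ ≤ C * ‖e f‖ := by
    refine ⟨C, fun f => ?_⟩
    have e1 : ‖S₀ f‖ = (eLpNorm (S f) 2 volume).toReal := Lp.norm_toLp _ (hmem f)
    have e2 : ‖e f‖ = (eLpNorm f 2 volume).toReal := Lp.norm_toLp _ (f.memLp 2 volume)
    rw [e1, e2]
    have := ENNReal.toReal_mono (ENNReal.mul_lt_top ENNReal.coe_lt_top (f.memLp 2 volume).2).ne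
      (hC f)
    simpa using this
  refine ⟨S₀.extendOfNorm e, fun f => ?_⟩
  have : (S₀.extendOfNorm e) (f.toLp 2) = S₀ f := LinearMap.extendOfNorm_eq hd hb f
  rw [this]
  exact (hmem f).coeFn_toLp.symm

end LTwo

/-! ### Singular integrals given as superpositions of level kernels -/

section LevelKernel

variable {𝕜 : Type*} [RCLike 𝕜] {n : ℕ}

/-- Families `k_y(x, x')`, `y > 0`, of kernels whose superposition `∫₀^∞ k_y dy` is a
Calderón–Zygmund kernel. -/
structure IsLevelKernel (γ : ℝ) (k : ℝ → E n → E n → 𝕜) : Prop where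
  measurable : Measurable fun p : ℝ × E n × E n => k p.1 p.2.1 p.2.2
  bound : ∃ C, 0 ≤ C ∧ ∀ y, 0 < y → ∀ x x', ‖k y x x'‖ ≤ C * levelWeight γ n y ‖x - x'‖
  diff_left : ∃ C, 0 ≤ C ∧ ∀ y, 0 < y → ∀ x x', DifferentiableAt ℝ (fun w => k y w x') x ∧
    ‖fderiv ℝ (fun w => k y w x') x‖ ≤ C * levelWeight γ (n + 1) y ‖x - x'‖
  diff_right : ∃ C, 0 ≤ C ∧ ∀ y, 0 < y → ∀ x x', DifferentiableAt ℝ (fun w => k y x w) x' ∧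
    ‖fderiv ℝ (fun w => k y x w) x'‖ ≤ C * levelWeight γ (n + 1) y ‖x - x'‖
  cancel : ∀ y, 0 < y → ∀ x, ∫ x', k y x x' = 0
  pairing : ∃ C : ℝ≥0, ∀ (f : 𝓢(E n, 𝕜)) (g : E n → 𝕜), Measurable g → Integrable g → MemLp g 2 →
    ∫⁻ y in Ioi (0 : ℝ), ‖∫ x, (∫ x', k y x x' * f x') * g x‖ₑ ≤
      C * eLpNorm f 2 volume * eLpNorm g 2 volume

/-- The superposition of the levels. -/
noncomputable def superpose (k : ℝ → E n → E n → 𝕜) (x w : E n) : 𝕜 :=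
  ∫ y in Ioi (0 : ℝ), k y x w

/-- The operator with kernel `k_y`. -/
noncomputable def levelOp (k : ℝ → E n → E n → 𝕜) (f : E n → 𝕜) (x : E n) (y : ℝ) : 𝕜 :=
  ∫ w, k y x w * f w

/-- The superposition of the operators with kernels `k_y` for `y > ε`. -/
noncomputable def cutOp (k : ℝ → E n → E n → 𝕜) (ε : ℝ) (f : E n → 𝕜) (x : E n) : 𝕜 :=
  ∫ y in Ioi ε, levelOp k f x y

/-- At distances below one the Lipschitz bound implies every Hölder bound, and beyond one the
supremum suffices. Hence one constant serves all exponents in `[0, 1]`. -/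
lemma SchwartzMap.exists_holder_bound (f : 𝓢(E n, 𝕜)) :
    ∃ M, 0 ≤ M ∧ (∀ x, ‖f x‖ ≤ M) ∧
      ∀ a : ℝ, 0 ≤ a → a ≤ 1 → ∀ x x', ‖f x' - f x‖ ≤ M * ‖x - x'‖ ^ a := by
  set M₀ := SchwartzMap.seminorm ℝ 0 0 f
  set M₁ := SchwartzMap.seminorm ℝ 0 1 f
  have h0 : ∀ x, ‖f x‖ ≤ M₀ := fun x => SchwartzMap.norm_le_seminorm ℝ f x
  have h1 : ∀ x, ‖fderiv ℝ f x‖ ≤ M₁ := fun x => by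
    have := SchwartzMap.norm_iteratedFDeriv_le_seminorm ℝ f 1 x
    rwa [norm_iteratedFDeriv_one] at this
  have p0 : 0 ≤ M₀ := (norm_nonneg _).trans (h0 0)
  have p1 : 0 ≤ M₁ := (norm_nonneg _).trans (h1 0)
  refine ⟨2 * M₀ + M₁, by positivity, fun x => (h0 x).trans (by linarith), ?_⟩
  intro a ha ha1 x x'
  rcases le_total ‖x - x'‖ 1 with hr | hr
  · have h2 : ‖f x' - f x‖ ≤ M₁ * ‖x' - x‖ :=
      Convex.norm_image_sub_le_of_norm_fderiv_le (𝕜 := ℝ) (fun z _ => f.differentiableAt)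
        (fun z _ => h1 z) convex_univ (mem_univ x) (mem_univ x')
    rw [norm_sub_rev x' x] at h2
    have h3 : ‖x - x'‖ ≤ ‖x - x'‖ ^ a := by
      rcases eq_or_lt_of_le (norm_nonneg (x - x')) with h | h
      · rw [← h]; positivity
      · calc ‖x - x'‖ = ‖x - x'‖ ^ (1 : ℝ) := (Real.rpow_one _).symm
          _ ≤ _ := Real.rpow_le_rpow_of_exponent_ge h hr ha1
    calc _ ≤ M₁ * ‖x - x'‖ := h2
      _ ≤ (2 * M₀ + M₁) * ‖x - x'‖ ^ a := by gcongr; linarith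
  · have h2 : ‖f x' - f x‖ ≤ 2 * M₀ := by
      linarith [norm_sub_le (f x') (f x), h0 x, h0 x']
    have h3 : 1 ≤ ‖x - x'‖ ^ a := Real.one_le_rpow hr ha
    calc _ ≤ (2 * M₀ + M₁) * 1 := by linarith
      _ ≤ _ := by gcongr

/-- Half of the decay exponent pays for `r^(γ/2) ≤ (y + r)^(γ/2)`. The gain `y^(γ/2)` is what makes
the small levels summable, while the remaining weight stays integrable in space. -/
lemma levelWeight_mul_rpow_le {γ N y r : ℝ} (hγ : 0 < γ) (hy : 0 < y) (hr : 0 ≤ r) :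
    levelWeight γ N y r * r ^ (γ / 2) ≤ y ^ (γ / 2) * levelWeight (γ / 2) N y r := by
  unfold levelWeight
  have h1 : (y + r) ^ (N + γ) = (y + r) ^ (N + γ / 2) * (y + r) ^ (γ / 2) := by
    rw [← Real.rpow_add (by positivity)]; ring_nf
  have h2 : y ^ (γ - 1) = y ^ (γ / 2) * y ^ (γ / 2 - 1) := by
    rw [← Real.rpow_add hy]; ring_nf
  have h3 : r ^ (γ / 2) ≤ (y + r) ^ (γ / 2) := by gcongr; linarith
  have h4 : 0 < (y + r) ^ (γ / 2) := by positivity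
  rw [h1, h2]
  calc _ ≤ y ^ (γ / 2) * y ^ (γ / 2 - 1) / ((y + r) ^ (N + γ / 2) * (y + r) ^ (γ / 2)) *
        (y + r) ^ (γ / 2) := by gcongr
    _ = _ := by field_simp

namespace IsLevelKernel

variable {γ : ℝ} {k : ℝ → E n → E n → 𝕜}

lemma measurable_right (h : IsLevelKernel γ k) (y : ℝ) (x : E n) :
    Measurable fun x' => k y x x' :=
  h.measurable.comp (measurable_const.prodMk (measurable_const.prodMk measurable_id))

lemma measurable_level (h : IsLevelKernel γ k) (x x' : E n) : Measurable fun y => k y x x' :=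
  h.measurable.comp (measurable_id.prodMk (measurable_const.prodMk measurable_const))

lemma integrable_right (h : IsLevelKernel γ k) (hγ : 0 < γ) {y : ℝ} (hy : 0 < y) (x : E n) :
    Integrable fun x' => k y x x' := by
  obtain ⟨C, hC, hb⟩ := h.bound
  refine Integrable.mono' ((integrable_levelWeight (n := n) (N := n) (γ := γ) (by linarith) hy
    x).const_mul C) (h.measurable_right y x).aestronglyMeasurable (ae_of_all _ fun x' => ?_)
  rw [norm_sub_rev]
  exact hb y hy x x'

lemma integrable_right_mul (h : IsLevelKernel γ k) (hγ : 0 < γ) {y : ℝ} (hy : 0 < y) (x : E n)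
    {f : E n → 𝕜} (hf : Measurable f) {M : ℝ} (hM : ∀ x, ‖f x‖ ≤ M) :
    Integrable fun x' => k y x x' * f x' :=
  (h.integrable_right hγ hy x).mul_bdd hf.aestronglyMeasurable (ae_of_all _ hM)

lemma measurable_levelOp (h : IsLevelKernel γ k) {f : E n → 𝕜} (hf : Measurable f) :
    Measurable fun p : E n × ℝ => levelOp k f p.1 p.2 := by
  have : StronglyMeasurable fun p : (E n × ℝ) × E n => k p.1.2 p.1.1 p.2 * f p.2 := by
    refine Measurable.stronglyMeasurable (Measurable.mul ?_ (hf.comp measurable_snd))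
    exact h.measurable.comp ((measurable_snd.comp measurable_fst).prodMk
      ((measurable_fst.comp measurable_fst).prodMk measurable_snd))
  exact this.integral_prod_right'.measurable

/-- Cancellation makes the operators at small levels small, uniformly in space. -/
lemma exists_dominating (h : IsLevelKernel γ k) (hγ : 0 < γ) (hγ1 : γ ≤ 1) (hn : 1 ≤ n)
    (f : 𝓢(E n, 𝕜)) :
    ∃ G : ℝ → ℝ, IntegrableOn G (Ioi 0) ∧ ∀ y, 0 < y → ∀ x, ‖levelOp k f x y‖ ≤ G y := by
  obtain ⟨C, hC, hb⟩ := h.bound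
  obtain ⟨M, hM, hfM, hfH⟩ := f.exists_holder_bound
  have hn' : (0 : ℝ) < n := by exact_mod_cast hn
  set A := C * ∫ x, ‖f x‖
  set B := C * M * weightMass n (n + γ / 2)
  -- Since the level kernel has integral zero, `f x'` may be replaced by `f x' - f x`. The Hölder
  -- bound of order `γ/2` then yields a power of `y` that is integrable at zero.
  have small : ∀ y, 0 < y → ∀ x, ‖levelOp k f x y‖ ≤ B * y ^ (γ / 2 - 1) := by
    intro y hy x
    have e : levelOp k f x y = ∫ x', k y x x' * (f x' - f x) := by
      simp_rw [mul_sub]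
      rw [integral_sub (h.integrable_right_mul hγ hy x f.continuous.measurable hfM)
        ((h.integrable_right hγ hy x).mul_const _), integral_mul_const, h.cancel y hy x, zero_mul,
        sub_zero]
      rfl
    rw [e]
    have hi := (integrable_levelWeight (n := n) (N := n) (γ := γ / 2) (by linarith) hy
      x).const_mul (C * M * y ^ (γ / 2))
    refine (norm_integral_le_of_norm_le hi (ae_of_all _ fun x' => ?_)).trans (le_of_eq ?_)
    · rw [norm_mul]
      have h1 := hb y hy x x'
      have h2 := hfH (γ / 2) (by linarith) (by linarith) x x'
      have h3 := levelWeight_mul_rpow_le (N := n) hγ hy (norm_nonneg (x - x'))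
      have h4 := levelWeight_nonneg (γ := γ) (N := n) hy (norm_nonneg (x - x'))
      rw [norm_sub_rev x' x]
      calc _ ≤ (C * levelWeight γ n y ‖x - x'‖) * (M * ‖x - x'‖ ^ (γ / 2)) := by gcongr
        _ = C * M * (levelWeight γ n y ‖x - x'‖ * ‖x - x'‖ ^ (γ / 2)) := by ring
        _ ≤ C * M * (y ^ (γ / 2) * levelWeight (γ / 2) n y ‖x - x'‖) := by gcongr
        _ = _ := by ring
    · rw [integral_const_mul, integral_levelWeight hy]
      have : y ^ (γ / 2) * y ^ ((n : ℝ) - n - 1) = y ^ (γ / 2 - 1) := by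
        rw [← Real.rpow_add hy]; ring_nf
      rw [← this]
      ring
  -- No cancellation is needed here: the supremum of the kernel against the `L¹` norm of `f` is
  -- integrable at infinity.
  have large : ∀ y, 0 < y → ∀ x, ‖levelOp k f x y‖ ≤ A * y ^ (-(n : ℝ) - 1) := by
    intro y hy x
    refine (norm_integral_le_of_norm_le ((f.integrable.norm).const_mul (C * y ^ (-(n : ℝ) - 1)))
      (ae_of_all _ fun x' => ?_)).trans (le_of_eq ?_)
    · rw [norm_mul]
      have h1 := hb y hy x x'
      have h2 := levelWeight_le_rpow_level (γ := γ) (N := n) (by positivity) hy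
        (norm_nonneg (x - x'))
      gcongr
      exact h1.trans (by gcongr)
    · rw [integral_const_mul]; ring
  refine ⟨fun y => if y ≤ 1 then B * y ^ (γ / 2 - 1) else A * y ^ (-(n : ℝ) - 1), ?_, ?_⟩
  · rw [← Ioc_union_Ioi_eq_Ioi (zero_le_one (α := ℝ))]
    refine IntegrableOn.union ?_ ?_
    · refine IntegrableOn.congr_fun ((integrableOn_rpow_Ioc (γ := γ / 2) (by linarith)
        zero_le_one).const_mul B) (fun y hy => ?_) measurableSet_Ioc
      simp [hy.2]
    · refine IntegrableOn.congr_fun ((integrableOn_rpow_Ioi hn' one_pos).const_mul A)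
        (fun y hy => ?_) measurableSet_Ioi
      simp [not_le.2 (mem_Ioi.1 hy)]
  · intro y hy x
    dsimp only
    split_ifs
    · exact small y hy x
    · exact large y hy x

lemma integrableOn_levelOp (h : IsLevelKernel γ k) (hγ : 0 < γ) (hγ1 : γ ≤ 1) (hn : 1 ≤ n)
    (f : 𝓢(E n, 𝕜)) (x : E n) : IntegrableOn (fun y => levelOp k f x y) (Ioi 0) := by
  obtain ⟨G, hG, hb⟩ := h.exists_dominating hγ hγ1 hn f
  refine Integrable.mono' hG ((h.measurable_levelOp f.continuous.measurable).comp
    measurable_prodMk_left).aestronglyMeasurable ?_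
  filter_upwards [ae_restrict_mem measurableSet_Ioi] with y hy using hb y hy x

lemma measurable_cutOp (h : IsLevelKernel γ k) {f : E n → 𝕜} (hf : Measurable f) (ε : ℝ) :
    Measurable (cutOp k ε f) :=
  ((h.measurable_levelOp hf).stronglyMeasurable.integral_prod_right'
    (ν := volume.restrict (Ioi ε))).measurable

/-- The operators cut off at level `ε` are uniformly bounded on `L²`. -/
lemma eLpNorm_cutOp_le (h : IsLevelKernel γ k) (hγ : 0 < γ) (hγ1 : γ ≤ 1) (hn : 1 ≤ n) :
    ∃ C : ℝ≥0, ∀ ε : ℝ, 0 ≤ ε → ∀ f : 𝓢(E n, 𝕜),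
      eLpNorm (cutOp k ε f) 2 volume ≤ C * eLpNorm f 2 volume := by
  obtain ⟨C, hC⟩ := h.pairing
  refine ⟨C, fun ε hε f => ?_⟩
  obtain ⟨G, hG, hb⟩ := h.exists_dominating hγ hγ1 hn f
  have hsub : Ioi ε ⊆ Ioi 0 := Ioi_subset_Ioi hε
  have hGε : IntegrableOn G (Ioi ε) := hG.mono_set hsub
  refine eLpNorm_two_le_of_pairing (h.measurable_cutOp f.continuous.measurable ε)
    (M := ∫ y in Ioi ε, G y) (fun x => ?_) fun g hg hgi hg2 => ?_
  · refine norm_integral_le_of_norm_le hGε ?_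
    filter_upwards [ae_restrict_mem measurableSet_Ioi] with y hy using hb y (hsub hy) x
  · have e1 : ∫ x, cutOp k ε f x * g x = ∫ x, ∫ y in Ioi ε, levelOp k f x y * g x := by
      refine integral_congr_ae (ae_of_all _ fun x => ?_)
      exact (integral_mul_const _ _).symm
    have e2 : ∫ x, ∫ y in Ioi ε, levelOp k f x y * g x =
        ∫ y in Ioi ε, ∫ x, levelOp k f x y * g x := by
      refine integral_integral_swap ?_
      refine Integrable.mono' (g := fun p : E n × ℝ => ‖g p.1‖ * G p.2) (hgi.norm.mul_prod hGε)
        ?_ ?_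
      · exact ((h.measurable_levelOp f.continuous.measurable).mul
          (hg.comp measurable_fst)).aestronglyMeasurable
      · have : ∀ᵐ p : E n × ℝ ∂(volume.prod (volume.restrict (Ioi ε))), p.2 ∈ Ioi ε :=
          Measure.quasiMeasurePreserving_snd.ae (ae_restrict_mem measurableSet_Ioi)
        filter_upwards [this] with p hp
        rw [Function.uncurry_apply_pair, norm_mul, mul_comm]
        gcongr
        exact hb p.2 (hsub hp) p.1
    rw [e1, e2]
    -- The pairing bound has the absolute value inside the integral over levels, so discarding
    -- levels can only decrease it. This is the source of uniformity in `ε`.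
    calc _ ≤ ∫⁻ y in Ioi ε, ‖∫ x, levelOp k f x y * g x‖ₑ := enorm_integral_le_lintegral_enorm _
      _ ≤ ∫⁻ y in Ioi 0, ‖∫ x, levelOp k f x y * g x‖ₑ := lintegral_mono_set hsub
      _ ≤ _ := hC f g hg hgi hg2

end IsLevelKernel

end LevelKernel

/-! ### Calderón–Zygmund properties of a superposition of level kernels -/

section LevelKernelCZ

variable {𝕜 : Type*} [RCLike 𝕜] {n : ℕ} {γ : ℝ} {k : ℝ → E n → E n → 𝕜}

/-- Directional derivatives are limits of measurable difference quotients, and the full derivative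
is recovered from its values on the standard basis. -/
lemma aestronglyMeasurable_fderiv_of_param {F : ℝ → E n → 𝕜} (hm : ∀ x, Measurable fun y => F y x)
    (x : E n) (hd : ∀ y, 0 < y → DifferentiableAt ℝ (F y) x) :
    AEStronglyMeasurable (fun y => fderiv ℝ (F y) x) (volume.restrict (Ioi 0)) := by
  have h1 : ∀ v : E n, AEStronglyMeasurable (fun y => fderiv ℝ (F y) x v)
      (volume.restrict (Ioi 0)) := by
    intro v
    refine aestronglyMeasurable_of_tendsto_ae atTop
      (f := fun (j : ℕ) y => (j : ℝ) • (F y (x + (j : ℝ)⁻¹ • v) - F y x)) (fun j => ?_) ?_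
    · exact (((hm _).sub (hm _)).const_smul _).aestronglyMeasurable
    · filter_upwards [ae_restrict_mem measurableSet_Ioi] with y hy
      refine (hd y hy).hasFDerivAt.lim v ?_
      simpa using tendsto_natCast_atTop_atTop (R := ℝ)
  have h2 : (fun y => fderiv ℝ (F y) x) = fun y => ∑ i : Fin n,
      (EuclideanSpace.proj i : E n →L[ℝ] ℝ).smulRight
        (fderiv ℝ (F y) x (EuclideanSpace.single i 1)) := by
    funext y
    ext v
    simp only [FunLike.coe_sum, Finset.sum_apply, ContinuousLinearMap.smulRight_apply,
      PiLp.proj_apply, ← map_smul, ← map_sum]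
    congr 1
    ext j
    simp [Finset.sum_apply, Pi.single_apply]
  rw [h2]
  refine Finset.aestronglyMeasurable_fun_sum _ fun i _ => ?_
  exact (ContinuousLinearMap.smulRightL ℝ (E n) 𝕜 (EuclideanSpace.proj i : E n →L[ℝ] ℝ)
    ).continuous.comp_aestronglyMeasurable (h1 _)

/-- On the ball of radius `‖x - p‖ / 2` the weight at half the distance dominates the derivatives,
which justifies differentiating under the integral. The half distance serves only for domination:
the final bound integrates the weight at `x` itself. -/
lemma differentiableAt_integral_level {F : ℝ → E n → 𝕜} (hm : ∀ x, Measurable fun y => F y x)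
    (hγ : 0 < γ) (hn : 1 ≤ n) {p x : E n} (hx : x ≠ p) {C₀ C₁ : ℝ} (hC₁ : 0 ≤ C₁)
    (hb : ∀ y, 0 < y → ∀ w, ‖F y w‖ ≤ C₀ * levelWeight γ n y ‖w - p‖)
    (hd : ∀ y, 0 < y → ∀ w, DifferentiableAt ℝ (F y) w ∧
      ‖fderiv ℝ (F y) w‖ ≤ C₁ * levelWeight γ (n + 1) y ‖w - p‖) :
    DifferentiableAt ℝ (fun w => ∫ y in Ioi (0 : ℝ), F y w) x ∧
      ‖fderiv ℝ (fun w => ∫ y in Ioi (0 : ℝ), F y w) x‖ ≤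
        C₁ * (1 / γ + 1 / (n + 1)) / ‖x - p‖ ^ (n + 1) := by
  have hn' : (0 : ℝ) < n := by exact_mod_cast hn
  have hr : 0 < ‖x - p‖ := norm_pos_iff.2 (sub_ne_zero.2 hx)
  have key := hasFDerivAt_integral_of_dominated_of_fderiv_le (𝕜 := ℝ)
    (μ := volume.restrict (Ioi (0 : ℝ)))
    (F := fun w y => F y w) (F' := fun w y => fderiv ℝ (F y) w) (x₀ := x)
    (s := Metric.ball x (‖x - p‖ / 2))
    (bound := fun y => C₁ * levelWeight γ (n + 1) y (‖x - p‖ / 2))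
    (Metric.ball_mem_nhds x (by positivity))
    (Eventually.of_forall fun w => (hm w).aestronglyMeasurable)
    (Integrable.mono' ((integrableOn_levelWeight hγ hn' hr).const_mul C₀)
      (hm x).aestronglyMeasurable (by
        filter_upwards [ae_restrict_mem measurableSet_Ioi] with y hy using hb y hy x))
    (aestronglyMeasurable_fderiv_of_param hm x fun y hy => (hd y hy x).1)
    (by
      filter_upwards [ae_restrict_mem measurableSet_Ioi] with y hy w hw
      refine (hd y hy w).2.trans ?_
      gcongr
      refine levelWeight_anti (by positivity) hy (by positivity) ?_
      rw [Metric.mem_ball, dist_eq_norm] at hw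
      have := norm_sub_le (w - p) (w - x)
      rw [show w - p - (w - x) = x - p by abel] at this
      linarith)
    ((integrableOn_levelWeight hγ (by positivity) (by positivity)).const_mul C₁)
    (by
      filter_upwards [ae_restrict_mem measurableSet_Ioi] with y hy w _
      exact (hd y hy w).1.hasFDerivAt)
  refine ⟨key.differentiableAt, ?_⟩
  rw [key.fderiv]
  have h1 := norm_integral_le_of_norm_le ((integrableOn_levelWeight hγ
    (N := n + 1) (by positivity) hr).const_mul C₁) (f := fun y => fderiv ℝ (F y) x) (by
      filter_upwards [ae_restrict_mem measurableSet_Ioi] with y hy using (hd y hy x).2)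
  refine h1.trans ?_
  rw [integral_const_mul]
  have h2 := integral_levelWeight_level_le (γ := γ) (N := n + 1) hγ (by positivity) hr
  rw [Real.rpow_neg hr.le, show ((n : ℝ) + 1) = ((n + 1 : ℕ) : ℝ) by push_cast; ring,
    Real.rpow_natCast] at h2
  push_cast at h2 ⊢
  calc _ ≤ C₁ * ((1 / γ + 1 / (n + 1)) * (‖x - p‖ ^ (n + 1))⁻¹) := by gcongr
    _ = _ := by ring

namespace IsLevelKernel

lemma norm_superpose_le (h : IsLevelKernel γ k) (hγ : 0 < γ) (hn : 1 ≤ n) :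
    ∃ C, 0 ≤ C ∧ ∀ x x', x ≠ x' → ‖superpose k x x'‖ ≤ C / ‖x - x'‖ ^ n := by
  obtain ⟨C, hC, hb⟩ := h.bound
  have hn' : (0 : ℝ) < n := by exact_mod_cast hn
  refine ⟨C * (1 / γ + 1 / n), by positivity, fun x x' hx => ?_⟩
  have hr : 0 < ‖x - x'‖ := norm_pos_iff.2 (sub_ne_zero.2 hx)
  refine (norm_integral_le_of_norm_le ((integrableOn_levelWeight hγ hn' hr).const_mul C)
    (by filter_upwards [ae_restrict_mem measurableSet_Ioi] with y hy using hb y hy x x')).trans ?_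
  rw [integral_const_mul]
  have h2 := integral_levelWeight_level_le (γ := γ) (N := n) hγ hn' hr
  rw [Real.rpow_neg hr.le, Real.rpow_natCast] at h2
  calc _ ≤ C * ((1 / γ + 1 / n) * (‖x - x'‖ ^ n)⁻¹) := by gcongr
    _ = _ := by ring

lemma isCZKernel (h : IsLevelKernel γ k) (hγ : 0 < γ) (hn : 1 ≤ n) :
    IsCZKernel (superpose k) := by
  obtain ⟨C₀, hC₀, hb⟩ := h.bound
  obtain ⟨C₁, hC₁, hl⟩ := h.diff_left
  obtain ⟨C₂, hC₂, hr⟩ := h.diff_right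
  obtain ⟨C₃, hC₃, hs⟩ := h.norm_superpose_le hγ hn
  have q1 : 0 ≤ C₁ * (1 / γ + 1 / (n + 1)) := by positivity
  have q2 : 0 ≤ C₂ * (1 / γ + 1 / (n + 1)) := by positivity
  refine ⟨C₃ + C₁ * (1 / γ + 1 / (n + 1)) + C₂ * (1 / γ + 1 / (n + 1)), fun x x' hx => ?_⟩
  have hL := differentiableAt_integral_level (F := fun y w => k y w x')
    (fun w => h.measurable_level w x') hγ hn hx hC₁ (fun y hy w => hb y hy w x')
    (fun y hy w => hl y hy w x')
  have hR := differentiableAt_integral_level (F := fun y w => k y x w)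
    (fun w => h.measurable_level x w) hγ hn hx.symm hC₂
    (fun y hy w => by rw [norm_sub_rev]; exact hb y hy x w)
    (fun y hy w => by rw [norm_sub_rev w x]; exact hr y hy x w)
  rw [norm_sub_rev x' x] at hR
  refine ⟨(hs x x' hx).trans ?_, ⟨hL.1, hL.2.trans ?_⟩, ⟨hR.1, hR.2.trans ?_⟩⟩ <;>
  · gcongr
    linarith

lemma measurable_integral_level (h : IsLevelKernel γ k) (S : Set ℝ) :
    Measurable fun p : E n × E n => ∫ y in S, k y p.1 p.2 := by
  have : StronglyMeasurable fun q : (E n × E n) × ℝ => k q.2 q.1.1 q.1.2 :=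
    (h.measurable.comp (measurable_snd.prodMk measurable_fst)).stronglyMeasurable
  exact (this.integral_prod_right' (ν := volume.restrict S)).measurable

lemma measurable_superpose (h : IsLevelKernel γ k) :
    Measurable fun p : E n × E n => superpose k p.1 p.2 :=
  h.measurable_integral_level _

end IsLevelKernel

/-- The difference between the kernel truncated in space and the kernel truncated in the level. -/
noncomputable def truncationError (k : ℝ → E n → E n → 𝕜) (ε : ℝ) (x x' : E n) : 𝕜 :=
  {z : E n | ε < ‖x - z‖}.indicator (superpose k x) x' - ∫ y in Ioi ε, k y x x'

lemma measurableSet_far (ε : ℝ) (x : E n) : MeasurableSet {z : E n | ε < ‖x - z‖} :=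
  measurableSet_lt measurable_const (measurable_const.sub measurable_id).norm

namespace IsLevelKernel

lemma integrableOn_level (h : IsLevelKernel γ k) (hγ : 0 < γ) (hn : 1 ≤ n) {x x' : E n}
    (hx : x ≠ x') : IntegrableOn (fun y => k y x x') (Ioi 0) := by
  obtain ⟨C, hC, hb⟩ := h.bound
  have hn' : (0 : ℝ) < n := by exact_mod_cast hn
  have hr : 0 < ‖x - x'‖ := norm_pos_iff.2 (sub_ne_zero.2 hx)
  refine Integrable.mono' ((integrableOn_levelWeight hγ hn' hr).const_mul C)
    (h.measurable_level x x').aestronglyMeasurable ?_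
  filter_upwards [ae_restrict_mem measurableSet_Ioi] with y hy using hb y hy x x'

lemma measurable_truncationError (h : IsLevelKernel γ k) (ε : ℝ) :
    Measurable fun p : E n × E n => truncationError k ε p.1 p.2 := by
  refine Measurable.sub ?_ (h.measurable_integral_level _)
  have : (fun p : E n × E n => {z : E n | ε < ‖p.1 - z‖}.indicator (superpose k p.1) p.2) =
      {p : E n × E n | ε < ‖p.1 - p.2‖}.indicator fun p => superpose k p.1 p.2 := by
    ext p
    simp [indicator_apply]
  rw [this]
  exact h.measurable_superpose.indicator
    (measurableSet_lt measurable_const (measurable_fst.sub measurable_snd).norm)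

/-- Away from the diagonal the error consists of the levels below `ε`, near it of minus the levels
above `ε`. The bounding function is an approximate identity at scale `ε`: its integral in `x'` does
not depend on `ε`. -/
lemma norm_truncationError_le (h : IsLevelKernel γ k) (hγ : 0 < γ) (hn : 1 ≤ n) :
    ∃ C, 0 ≤ C ∧ ∀ ε, 0 < ε → ∀ x x',
      ‖truncationError k ε x x'‖ ≤ C * (ε * levelWeight γ n ε ‖x' - x‖) := by
  obtain ⟨C, hC, hb⟩ := h.bound
  have hn' : (0 : ℝ) < n := by exact_mod_cast hn
  refine ⟨C * (1 / γ + 1 / n) * 2 ^ (n + γ), by positivity, fun ε hε x x' => ?_⟩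
  rw [norm_sub_rev]
  set r := ‖x - x'‖ with hr
  have hr0 : 0 ≤ r := norm_nonneg _
  have hε' : ε * levelWeight γ n ε r = ε ^ γ / (ε + r) ^ (n + γ) := by
    unfold levelWeight
    rw [mul_div_assoc', mul_comm, ← Real.rpow_add_one hε.ne', sub_add_cancel]
  -- Applied with `s` the larger of `ε` and `r`, so that `s` is comparable with `ε + r`.
  have main : ∀ s, 0 < s → (ε + r) ≤ 2 * s →
      ε ^ γ * s ^ (-(n + γ)) ≤ 2 ^ (n + γ) * (ε * levelWeight γ n ε r) := by
    intro s hs hle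
    rw [hε', Real.rpow_neg hs.le, ← div_eq_mul_inv, mul_div_assoc']
    rw [div_le_div_iff₀ (by positivity) (by positivity)]
    calc ε ^ γ * (ε + r) ^ (n + γ) ≤ ε ^ γ * (2 * s) ^ (n + γ) := by gcongr
      _ = _ := by rw [Real.mul_rpow (by norm_num) hs.le]; ring
  by_cases hlt : ε < r
  · have hx : x ≠ x' := by
      rintro rfl
      simp [hr] at hlt
      linarith
    have hi := h.integrableOn_level hγ hn hx
    have e : truncationError k ε x x' = ∫ y in Ioc 0 ε, k y x x' := by
      unfold truncationError
      rw [indicator_of_mem (by exact hlt)]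
      unfold superpose
      rw [← Ioc_union_Ioi_eq_Ioi hε.le, setIntegral_union (Ioc_disjoint_Ioi le_rfl)
        measurableSet_Ioi (hi.mono_set Ioc_subset_Ioi_self)
        (hi.mono_set (Ioi_subset_Ioi hε.le))]
      simp
    have hrpos : 0 < r := hε.trans hlt
    rw [e]
    refine (norm_integral_le_of_norm_le ((integrableOn_levelWeight_Ioc hγ hn' hrpos
      hε.le).const_mul C) (by
        filter_upwards [ae_restrict_mem measurableSet_Ioc] with y hy using hb y hy.1 x x')).trans ?_
    rw [integral_const_mul]
    have h1 := integral_levelWeight_Ioc_le hγ hn' hrpos hε.le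
    have h2 := main r hrpos (by linarith)
    calc _ ≤ C * (ε ^ γ / γ * r ^ (-(n + γ))) := by gcongr
      _ = C * (1 / γ) * (ε ^ γ * r ^ (-(n + γ))) := by ring
      _ ≤ C * (1 / γ) * (2 ^ (n + γ) * (ε * levelWeight γ n ε r)) := by gcongr
      _ ≤ C * (1 / γ + 1 / n) * (2 ^ (n + γ) * (ε * levelWeight γ n ε r)) := by
          have := levelWeight_nonneg (γ := γ) (N := n) hε hr0
          gcongr
          simp
      _ = _ := by ring
  · have e : truncationError k ε x x' = - ∫ y in Ioi ε, k y x x' := by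
      unfold truncationError
      rw [indicator_of_notMem (by exact hlt), zero_sub]
    rw [e, norm_neg]
    refine (norm_integral_le_of_norm_le ((integrableOn_levelWeight_Ioi hγ hn' hr0
      hε).const_mul C) (by
        filter_upwards [ae_restrict_mem measurableSet_Ioi] with y hy
          using hb y (hε.trans hy) x x')).trans ?_
    rw [integral_const_mul]
    have h1 := integral_levelWeight_Ioi_le hγ hn' hr0 hε
    have h2 := main ε hε (by linarith)
    rw [← Real.rpow_add hε, show γ + -(n + γ) = -(n : ℝ) by ring] at h2
    calc _ ≤ C * (ε ^ (-(n : ℝ)) / n) := by gcongr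
      _ = C * (1 / n) * ε ^ (-(n : ℝ)) := by ring
      _ ≤ C * (1 / n) * (2 ^ (n + γ) * (ε * levelWeight γ n ε r)) := by gcongr
      _ ≤ C * (1 / γ + 1 / n) * (2 ^ (n + γ) * (ε * levelWeight γ n ε r)) := by
          have := levelWeight_nonneg (γ := γ) (N := n) hε hr0
          gcongr
          simp [hγ.le]
      _ = _ := by ring

lemma integrable_truncationError (h : IsLevelKernel γ k) (hγ : 0 < γ) (hn : 1 ≤ n) {ε : ℝ}
    (hε : 0 < ε) (x : E n) : Integrable (truncationError k ε x) := by
  obtain ⟨C, hC, hb⟩ := h.norm_truncationError_le hγ hn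
  refine Integrable.mono' (((integrable_levelWeight (n := n) (N := n) (γ := γ) (by linarith) hε
    x).const_mul ε).const_mul C) ?_ (ae_of_all _ fun x' => hb ε hε x x')
  exact ((h.measurable_truncationError ε).comp measurable_prodMk_left).aestronglyMeasurable

lemma integrable_integral_level_mul (h : IsLevelKernel γ k) (hγ : 0 < γ) (hn : 1 ≤ n) {ε : ℝ}
    (hε : 0 < ε) (f : 𝓢(E n, 𝕜)) (x : E n) :
    Integrable (fun x' => (∫ y in Ioi ε, k y x x') * f x') ∧
      cutOp k ε f x = ∫ x', (∫ y in Ioi ε, k y x x') * f x' := by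
  obtain ⟨C, hC, hb⟩ := h.bound
  have hn' : (0 : ℝ) < n := by exact_mod_cast hn
  have hi : Integrable (Function.uncurry fun (x' : E n) (y : ℝ) => k y x x' * f x')
      (volume.prod (volume.restrict (Ioi ε))) := by
    refine Integrable.mono' (g := fun p : E n × ℝ => ‖f p.1‖ * (C * p.2 ^ (-(n : ℝ) - 1)))
      (f.integrable.norm.mul_prod ((integrableOn_rpow_Ioi hn' hε).const_mul C)) ?_ ?_
    · refine Measurable.aestronglyMeasurable (Measurable.mul ?_
        (f.continuous.measurable.comp measurable_fst))
      exact h.measurable.comp (measurable_snd.prodMk (measurable_const.prodMk measurable_fst))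
    · have : ∀ᵐ p : E n × ℝ ∂(volume.prod (volume.restrict (Ioi ε))), p.2 ∈ Ioi ε :=
        Measure.quasiMeasurePreserving_snd.ae (ae_restrict_mem measurableSet_Ioi)
      filter_upwards [this] with p hp
      have hp0 : 0 < p.2 := hε.trans hp
      rw [Function.uncurry_apply_pair, norm_mul, mul_comm]
      gcongr
      refine (hb p.2 hp0 x p.1).trans ?_
      gcongr
      exact levelWeight_le_rpow_level (by positivity) hp0 (norm_nonneg _)
  have e : (fun x' => (∫ y in Ioi ε, k y x x') * f x') =
      fun x' => ∫ y in Ioi ε, k y x x' * f x' := by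
    ext x'
    exact (integral_mul_const _ _).symm
  rw [e]
  refine ⟨hi.integral_prod_left, ?_⟩
  exact (integral_integral_swap hi).symm

/-- Truncations in space and in the level differ by an operator with integrable kernel. -/
lemma truncated_eq (h : IsLevelKernel γ k) (hγ : 0 < γ) (hn : 1 ≤ n) {ε : ℝ}
    (hε : 0 < ε) (f : 𝓢(E n, 𝕜)) (x : E n) :
    truncated (superpose k) ε f x = cutOp k ε f x + ∫ x', truncationError k ε x x' * f x' := by
  obtain ⟨M, hM, hfM, -⟩ := f.exists_holder_bound
  obtain ⟨hi, he⟩ := h.integrable_integral_level_mul hγ hn hε f x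
  rw [he, ← integral_add hi ((h.integrable_truncationError hγ hn hε x).mul_bdd
    f.continuous.aestronglyMeasurable (ae_of_all _ hfM))]
  unfold truncated
  rw [← integral_indicator (measurableSet_far ε x)]
  congr 1
  ext x'
  unfold truncationError
  by_cases hx : x' ∈ {z : E n | ε < ‖x - z‖}
  · rw [indicator_of_mem hx, indicator_of_mem hx]; ring
  · rw [indicator_of_notMem hx, indicator_of_notMem hx]; ring

lemma measurable_truncated (h : IsLevelKernel γ k) (ε : ℝ) (f : 𝓢(E n, 𝕜)) :
    Measurable (truncated (superpose k) ε f) := by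
  have : truncated (superpose k) ε f = fun x => ∫ x',
      {p : E n × E n | ε < ‖p.1 - p.2‖}.indicator (fun p => superpose k p.1 p.2 * f p.2)
        (x, x') := by
    ext x
    unfold truncated
    rw [← integral_indicator (measurableSet_far ε x)]
    rfl
  rw [this]
  refine (StronglyMeasurable.integral_prod_right' ?_).measurable
  refine Measurable.stronglyMeasurable (Measurable.indicator ?_
    (measurableSet_lt measurable_const (measurable_fst.sub measurable_snd).norm))
  exact h.measurable_superpose.mul (f.continuous.measurable.comp measurable_snd)

/-- The operator cut in the level is controlled by the pairing bound, and the error by Young's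
inequality, its dominating kernel having an `L¹` norm independent of `ε`. -/
lemma eLpNorm_truncated_le (h : IsLevelKernel γ k) (hγ : 0 < γ) (hγ1 : γ ≤ 1) (hn : 1 ≤ n) :
    ∃ C : ℝ≥0, ∀ ε : ℝ, 0 < ε → ∀ f : 𝓢(E n, 𝕜),
      eLpNorm (truncated (superpose k) ε f) 2 volume ≤ C * eLpNorm f 2 volume := by
  obtain ⟨C₁, hC₁⟩ := h.eLpNorm_cutOp_le hγ hγ1 hn
  obtain ⟨C₂, hC₂, hb⟩ := h.norm_truncationError_le hγ hn
  refine ⟨C₁ + Real.toNNReal (C₂ * weightMass n (n + γ)), fun ε hε f => ?_⟩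
  have e : truncated (superpose k) ε f =
      cutOp k ε f + fun x => ∫ x', truncationError k ε x x' * f x' := by
    ext x
    exact h.truncated_eq hγ hn hε f x
  have hm : Measurable fun x => ∫ x', truncationError k ε x x' * f x' :=
    (StronglyMeasurable.integral_prod_right' (f := fun p : E n × E n =>
      truncationError k ε p.1 p.2 * f p.2) ((h.measurable_truncationError ε).mul
        (f.continuous.measurable.comp measurable_snd)).stronglyMeasurable).measurable
  rw [e]
  refine (eLpNorm_add_le (h.measurable_cutOp f.continuous.measurable ε).aestronglyMeasurable
    hm.aestronglyMeasurable (by norm_num)).trans ?_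
  rw [ENNReal.coe_add, add_mul]
  gcongr
  · exact hC₁ ε hε.le f
  · have hW : Measurable fun z : E n => ENNReal.ofReal (C₂ * (ε * levelWeight γ n ε ‖z‖)) :=
      (((measurable_levelWeight measurable_const measurable_norm).const_mul ε).const_mul
        C₂).ennreal_ofReal
    refine (eLpNorm_two_le_of_conv f.continuous.measurable hW fun x => ?_).trans (le_of_eq ?_)
    · refine (enorm_integral_le_lintegral_enorm _).trans (lintegral_mono fun x' => ?_)
      rw [enorm_mul]
      gcongr
      rw [← ofReal_norm]
      exact ENNReal.ofReal_le_ofReal (hb ε hε x x')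
    · congr 1
      have hi := ((integrable_levelWeight (n := n) (N := n) (γ := γ) (by linarith) hε
        0).const_mul ε).const_mul C₂
      have h2 := integral_levelWeight (n := n) (N := n) (γ := γ) hε 0
      simp only [sub_zero] at hi h2
      rw [← ofReal_integral_eq_lintegral_ofReal hi (ae_of_all _ fun z =>
        mul_nonneg hC₂ (mul_nonneg hε.le (levelWeight_nonneg hε (norm_nonneg z)))),
        integral_const_mul, integral_const_mul, h2]
      have : ε * (weightMass n (n + γ) * ε ^ ((n : ℝ) - n - 1)) = weightMass n (n + γ) := by
        rw [sub_self, zero_sub, Real.rpow_neg_one]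
        field_simp
      rw [this]
      rfl

/-- `b ε x` is minus the integral of the error kernel in `x'`. Adding `b ε x * f x` replaces `f x'`
by `f x' - f x` in the error term, which is then of order `ε^(γ/2)` by Hölder continuity. -/
lemma exists_principal_value (h : IsLevelKernel γ k) (hγ : 0 < γ) (hγ1 : γ ≤ 1) (hn : 1 ≤ n) :
    ∃ (C : ℝ) (b : ℝ → E n → 𝕜), (∀ ε : ℝ, 0 < ε → ∀ x, ‖b ε x‖ ≤ C) ∧
      ∀ (f : 𝓢(E n, 𝕜)) (x : E n),
        Tendsto (fun ε => truncated (superpose k) ε f x + b ε x * f x) (𝓝[>] 0)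
          (𝓝 (cutOp k 0 f x)) := by
  obtain ⟨C₂, hC₂, hb⟩ := h.norm_truncationError_le hγ hn
  refine ⟨C₂ * weightMass n (n + γ), fun ε x => - ∫ x', truncationError k ε x x',
    fun ε hε x => ?_, fun f x => ?_⟩
  · rw [norm_neg]
    refine (norm_integral_le_of_norm_le (((integrable_levelWeight (n := n) (N := n) (γ := γ)
      (by linarith) hε x).const_mul ε).const_mul C₂) (ae_of_all _ fun x' => hb ε hε x x')).trans
      (le_of_eq ?_)
    rw [integral_const_mul, integral_const_mul, integral_levelWeight hε, sub_self, zero_sub,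
      Real.rpow_neg_one]
    field_simp
  · obtain ⟨M, hM, hfM, hfH⟩ := f.exists_holder_bound
    have t1 : Tendsto (fun ε => cutOp k ε f x) (𝓝[>] 0) (𝓝 (cutOp k 0 f x)) := by
      have hc := (aecover_Ioi_of_Ioi (μ := volume) (l := 𝓝[>] (0 : ℝ)) (a := fun ε : ℝ => ε)
        (A := 0) (tendsto_id.mono_left nhdsWithin_le_nhds)).integral_tendsto_of_countably_generated
        (h.integrableOn_levelOp hγ hγ1 hn f x)
      refine hc.congr' ?_
      filter_upwards [self_mem_nhdsWithin] with ε hε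
      rw [Measure.restrict_restrict measurableSet_Ioi, Ioi_inter_Ioi, sup_of_le_left (le_of_lt hε)]
      rfl
    have t2 : Tendsto (fun ε => ∫ x', truncationError k ε x x' * (f x' - f x)) (𝓝[>] 0) (𝓝 0) := by
      have t3 : Tendsto (fun ε : ℝ => C₂ * M * weightMass n (n + γ / 2) * ε ^ (γ / 2)) (𝓝[>] 0)
          (𝓝 0) := by
        have : Tendsto (fun ε : ℝ => ε ^ (γ / 2)) (𝓝[>] 0) (𝓝 0) := by
          have := (Real.continuousAt_rpow_const 0 (γ / 2) (Or.inr (by positivity))).tendsto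
          rw [Real.zero_rpow (by positivity)] at this
          exact this.mono_left nhdsWithin_le_nhds
        simpa using this.const_mul (C₂ * M * weightMass n (n + γ / 2))
      refine squeeze_zero_norm' ?_ t3
      filter_upwards [self_mem_nhdsWithin] with ε hε
      have hε : 0 < ε := hε
      refine (norm_integral_le_of_norm_le ((integrable_levelWeight (n := n) (N := n)
        (γ := γ / 2) (by linarith) hε x).const_mul (C₂ * M * (ε * ε ^ (γ / 2))))
        (ae_of_all _ fun x' => ?_)).trans (le_of_eq ?_)
      · rw [norm_mul]
        have h1 := hb ε hε x x'
        have h2 := hfH (γ / 2) (by linarith) (by linarith) x x'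
        have h3 := levelWeight_mul_rpow_le (N := n) hγ hε (norm_nonneg (x' - x))
        have h4 := levelWeight_nonneg (γ := γ) (N := n) hε (norm_nonneg (x' - x))
        rw [norm_sub_rev x x'] at h2
        calc _ ≤ (C₂ * (ε * levelWeight γ n ε ‖x' - x‖)) * (M * ‖x' - x‖ ^ (γ / 2)) := by gcongr
          _ = C₂ * M * ε * (levelWeight γ n ε ‖x' - x‖ * ‖x' - x‖ ^ (γ / 2)) := by ring
          _ ≤ C₂ * M * ε * (ε ^ (γ / 2) * levelWeight (γ / 2) n ε ‖x' - x‖) := by gcongr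
          _ = _ := by ring
      · rw [integral_const_mul, integral_levelWeight hε, sub_self, zero_sub, Real.rpow_neg_one]
        field_simp
    have t4 := t1.add t2
    rw [add_zero] at t4
    refine t4.congr' ?_
    filter_upwards [self_mem_nhdsWithin] with ε hε
    have hi := h.integrable_truncationError hγ hn hε x
    rw [h.truncated_eq hγ hn hε f x]
    simp_rw [mul_sub]
    rw [integral_sub (hi.mul_bdd f.continuous.aestronglyMeasurable (ae_of_all _ hfM))
      (hi.mul_const _), integral_mul_const]
    ring

/-- Since `f` vanishes on a ball of some radius `ρ` around `x`, the kernel is bounded where it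
matters, and truncating at a radius below `ρ` removes nothing. -/
lemma integrable_superpose_mul (h : IsLevelKernel γ k) (hγ : 0 < γ) (hn : 1 ≤ n)
    (f : 𝓢(E n, 𝕜)) {x : E n} (hx : x ∉ tsupport f) :
    Integrable (fun x' => superpose k x x' * f x') ∧
      ∀ᶠ ε in 𝓝[>] (0 : ℝ), truncated (superpose k) ε f x = ∫ x', superpose k x x' * f x' := by
  obtain ⟨C, hC, hb⟩ := h.norm_superpose_le hγ hn
  obtain ⟨ρ, hρ, hball⟩ := Metric.isOpen_iff.1 (isClosed_tsupport (f : E n → 𝕜)).isOpen_compl x hx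
  have hz : ∀ x', ‖x - x'‖ < ρ → f x' = 0 := by
    intro x' hx'
    refine image_eq_zero_of_notMem_tsupport (hball ?_)
    rwa [Metric.mem_ball, dist_eq_norm, norm_sub_rev]
  constructor
  · refine Integrable.mono' (f.integrable.norm.const_mul (C / ρ ^ n)) ?_ (ae_of_all _ fun x' => ?_)
    · exact ((h.measurable_superpose.comp measurable_prodMk_left).mul
        f.continuous.measurable).aestronglyMeasurable
    · by_cases hlt : ‖x - x'‖ < ρ
      · simp [hz x' hlt]
      · rw [norm_mul]
        have hne : x ≠ x' := by
          rintro rfl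
          simp at hlt
          linarith
        gcongr
        refine (hb x x' hne).trans ?_
        gcongr
        exact not_lt.1 hlt
  · filter_upwards [Ioo_mem_nhdsGT hρ] with ε hε
    refine setIntegral_eq_integral_of_forall_compl_eq_zero fun x' hx' => ?_
    rw [hz x' ((not_lt.1 hx').trans_lt hε.2), mul_zero]

lemma isCZOperator_cutOp (h : IsLevelKernel γ k) (hγ : 0 < γ) (hγ1 : γ ≤ 1) (hn : 1 ≤ n) :
    IsCZOperator (fun f : 𝓢(E n, 𝕜) => cutOp k 0 f) (superpose k) where
  l2_bounded := by
    obtain ⟨C, hC⟩ := h.eLpNorm_cutOp_le hγ hγ1 hn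
    have hb : ∀ f : 𝓢(E n, 𝕜), ∃ M, ∀ x, ‖f x‖ ≤ M := fun f =>
      let ⟨M, _, hM, _⟩ := f.exists_holder_bound
      ⟨M, hM⟩
    refine exists_extension
      (fun f => (h.measurable_cutOp f.continuous.measurable 0).aestronglyMeasurable)
      (fun f g => ae_of_all _ fun x => ?_) (fun c f => ae_of_all _ fun x => ?_)
      (fun f => hC 0 le_rfl f)
    · obtain ⟨M, hM⟩ := hb f
      obtain ⟨M', hM'⟩ := hb g
      simp only [Pi.add_apply]
      unfold cutOp
      rw [← integral_add (h.integrableOn_levelOp hγ hγ1 hn f x)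
        (h.integrableOn_levelOp hγ hγ1 hn g x)]
      refine setIntegral_congr_fun measurableSet_Ioi fun y hy => ?_
      unfold levelOp
      simp only [add_apply, mul_add]
      rw [integral_add (h.integrable_right_mul hγ hy x f.continuous.measurable hM)
        (h.integrable_right_mul hγ hy x g.continuous.measurable hM')]
    · simp only [Pi.smul_apply, smul_eq_mul]
      unfold cutOp
      rw [← integral_const_mul]
      refine integral_congr_ae (ae_of_all _ fun y => ?_)
      unfold levelOp
      simp only [smul_apply, smul_eq_mul]
      rw [← integral_const_mul]
      refine integral_congr_ae (ae_of_all _ fun x' => ?_)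
      ring
  kernel := h.isCZKernel hγ hn
  repr f := ae_of_all _ fun x hx => by
    obtain ⟨hi, he⟩ := h.integrable_superpose_mul hγ hn f hx
    refine ⟨hi, ?_⟩
    obtain ⟨_, b, _, hb⟩ := h.exists_principal_value hγ hγ1 hn
    -- Off the support `f x = 0`, so the correction by `b` disappears and the truncations are
    -- eventually constant.
    refine tendsto_nhds_unique (hb f x) (tendsto_const_nhds.congr' ?_)
    filter_upwards [he] with ε hε
    rw [hε, image_eq_zero_of_notMem_tsupport hx, mul_zero, add_zero]

/-- The uniform `L²` bound for truncations passes to the almost everywhere limit by Fatou's lemma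
along `ε = 1/(j+1)`. Linearity and the representation off the support pass to the limit pointwise.
-/
lemma isCZOperator_of_tendsto (h : IsLevelKernel γ k) (hγ : 0 < γ) (hγ1 : γ ≤ 1) (hn : 1 ≤ n)
    {S : 𝓢(E n, 𝕜) → E n → 𝕜}
    (hS : ∀ f : 𝓢(E n, 𝕜), ∀ᵐ x : E n,
      Tendsto (fun ε => truncated (superpose k) ε f x) (𝓝[>] 0) (𝓝 (S f x))) :
    IsCZOperator S (superpose k) where
  l2_bounded := by
    obtain ⟨C, hC⟩ := h.eLpNorm_truncated_le hγ hγ1 hn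
    have hseq : Tendsto (fun j : ℕ => 1 / ((j : ℝ) + 1)) atTop (𝓝[>] 0) :=
      tendsto_nhdsWithin_iff.2 ⟨tendsto_one_div_add_atTop_nhds_zero_nat,
        Eventually.of_forall fun j => by simp only [mem_Ioi]; positivity⟩
    have hS' : ∀ f : 𝓢(E n, 𝕜), ∀ᵐ x : E n,
        Tendsto (fun j : ℕ => truncated (superpose k) (1 / ((j : ℝ) + 1)) f x) atTop
          (𝓝 (S f x)) := fun f => by
      filter_upwards [hS f] with x hx using hx.comp hseq
    have hti : ∀ (f : 𝓢(E n, 𝕜)) (x : E n) (ε : ℝ), 0 < ε →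
        IntegrableOn (fun x' => superpose k x x' * f x') {x' : E n | ε < ‖x - x'‖} := by
      intro f x ε hε
      obtain ⟨C, hC, hb⟩ := h.norm_superpose_le hγ hn
      refine Integrable.mono' (f.integrable.norm.const_mul (C / ε ^ n)).integrableOn
        ((h.measurable_superpose.comp measurable_prodMk_left).mul
          f.continuous.measurable).aestronglyMeasurable ?_
      filter_upwards [ae_restrict_mem (measurableSet_far ε x)] with x' hx'
      have hx' : ε < ‖x - x'‖ := hx'
      have hne : x ≠ x' := by
        rintro rfl
        simp at hx'
        linarith
      rw [norm_mul]
      gcongr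
      refine (hb x x' hne).trans ?_
      gcongr
    refine exists_extension (C := C) (fun f => ?_) (fun f g => ?_) (fun c f => ?_) fun f => ?_
    · exact aestronglyMeasurable_of_tendsto_ae atTop
        (fun j => (h.measurable_truncated _ f).aestronglyMeasurable) (hS' f)
    · filter_upwards [hS f, hS g, hS (f + g)] with x h1 h2 h3
      refine tendsto_nhds_unique h3 ((h1.add h2).congr' ?_)
      filter_upwards [self_mem_nhdsWithin] with ε hε
      unfold truncated
      rw [← integral_add (hti f x ε hε) (hti g x ε hε)]
      simp only [add_apply, mul_add]
    · filter_upwards [hS f, hS (c • f)] with x h1 h3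
      refine tendsto_nhds_unique h3 ((h1.const_mul c).congr fun ε => ?_)
      unfold truncated
      rw [← integral_const_mul]
      refine integral_congr_ae (ae_of_all _ fun x' => ?_)
      simp only [smul_apply, smul_eq_mul]
      ring
    · refine (Lp.eLpNorm_lim_le_liminf_eLpNorm
        (fun j => (h.measurable_truncated _ f).aestronglyMeasurable) (S f) (hS' f)).trans ?_
      refine liminf_le_of_le (by isBoundedDefault) fun b hb => ?_
      obtain ⟨j, hj⟩ := hb.exists
      exact hj.trans (hC _ (by positivity) f)
  kernel := h.isCZKernel hγ hn
  repr f := by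
    filter_upwards [hS f] with x hx hxf
    obtain ⟨hi, he⟩ := h.integrable_superpose_mul hγ hn f hxf
    exact ⟨hi, tendsto_nhds_unique hx (tendsto_const_nhds.congr' (he.mono fun ε hε => hε.symm))⟩

end IsLevelKernel

end LevelKernelCZ

/-! ### Finite sums of level kernels -/

section LevelKernelSum

variable {𝕜 : Type*} [RCLike 𝕜] {n : ℕ} {γ : ℝ}

namespace IsLevelKernel

lemma zero : IsLevelKernel γ (fun (_ : ℝ) (_ _ : E n) => (0 : 𝕜)) where
  measurable := measurable_const
  bound := ⟨0, le_rfl, by simp⟩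
  diff_left := ⟨0, le_rfl, by simp⟩
  diff_right := ⟨0, le_rfl, by simp⟩
  cancel := by simp
  pairing := ⟨0, by simp⟩

/-- The parameter restrictions enter through `exists_dominating`: it makes the level operators
bounded functions, so that their pairings with an integrable `g` converge separately. -/
lemma add {k₁ k₂ : ℝ → E n → E n → 𝕜} (h₁ : IsLevelKernel γ k₁) (h₂ : IsLevelKernel γ k₂)
    (hγ : 0 < γ) (hγ1 : γ ≤ 1) (hn : 1 ≤ n) :
    IsLevelKernel γ (fun y x x' => k₁ y x x' + k₂ y x x') where
  measurable := h₁.measurable.add h₂.measurable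
  bound := by
    obtain ⟨C₁, p₁, b₁⟩ := h₁.bound
    obtain ⟨C₂, p₂, b₂⟩ := h₂.bound
    refine ⟨C₁ + C₂, by positivity, fun y hy x x' => (norm_add_le _ _).trans ?_⟩
    rw [add_mul]
    exact add_le_add (b₁ y hy x x') (b₂ y hy x x')
  diff_left := by
    obtain ⟨C₁, p₁, b₁⟩ := h₁.diff_left
    obtain ⟨C₂, p₂, b₂⟩ := h₂.diff_left
    refine ⟨C₁ + C₂, by positivity, fun y hy x x' =>
      ⟨(b₁ y hy x x').1.add (b₂ y hy x x').1, ?_⟩⟩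
    rw [fderiv_fun_add (b₁ y hy x x').1 (b₂ y hy x x').1, add_mul]
    exact (norm_add_le _ _).trans (add_le_add (b₁ y hy x x').2 (b₂ y hy x x').2)
  diff_right := by
    obtain ⟨C₁, p₁, b₁⟩ := h₁.diff_right
    obtain ⟨C₂, p₂, b₂⟩ := h₂.diff_right
    refine ⟨C₁ + C₂, by positivity, fun y hy x x' =>
      ⟨(b₁ y hy x x').1.add (b₂ y hy x x').1, ?_⟩⟩
    rw [fderiv_fun_add (b₁ y hy x x').1 (b₂ y hy x x').1, add_mul]
    exact (norm_add_le _ _).trans (add_le_add (b₁ y hy x x').2 (b₂ y hy x x').2)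
  cancel y hy x := by
    rw [integral_add (h₁.integrable_right hγ hy x) (h₂.integrable_right hγ hy x),
      h₁.cancel y hy x, h₂.cancel y hy x, add_zero]
  pairing := by
    obtain ⟨C₁, b₁⟩ := h₁.pairing
    obtain ⟨C₂, b₂⟩ := h₂.pairing
    refine ⟨C₁ + C₂, fun f g hg hgi hg2 => ?_⟩
    obtain ⟨M, -, hM, -⟩ := f.exists_holder_bound
    obtain ⟨G₁, -, d₁⟩ := h₁.exists_dominating hγ hγ1 hn f
    obtain ⟨G₂, -, d₂⟩ := h₂.exists_dominating hγ hγ1 hn f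
    have hi₁ : ∀ y, 0 < y → Integrable fun x => levelOp k₁ f x y * g x := fun y hy =>
      hgi.bdd_mul ((h₁.measurable_levelOp f.continuous.measurable).comp
        measurable_prodMk_right).aestronglyMeasurable (ae_of_all _ (d₁ y hy))
    have hi₂ : ∀ y, 0 < y → Integrable fun x => levelOp k₂ f x y * g x := fun y hy =>
      hgi.bdd_mul ((h₂.measurable_levelOp f.continuous.measurable).comp
        measurable_prodMk_right).aestronglyMeasurable (ae_of_all _ (d₂ y hy))
    have hle : ∀ y ∈ Ioi (0 : ℝ), ‖∫ x, (∫ x', (k₁ y x x' + k₂ y x x') * f x') * g x‖ₑ ≤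
        ‖∫ x, levelOp k₁ f x y * g x‖ₑ + ‖∫ x, levelOp k₂ f x y * g x‖ₑ := by
      intro y hy
      have e : ∫ x, (∫ x', (k₁ y x x' + k₂ y x x') * f x') * g x =
          (∫ x, levelOp k₁ f x y * g x) + ∫ x, levelOp k₂ f x y * g x := by
        rw [← integral_add (hi₁ y hy) (hi₂ y hy)]
        refine integral_congr_ae (ae_of_all _ fun x => ?_)
        dsimp only
        rw [← add_mul]
        congr 1
        simp_rw [add_mul]
        exact integral_add (h₁.integrable_right_mul hγ hy x f.continuous.measurable hM)
          (h₂.integrable_right_mul hγ hy x f.continuous.measurable hM)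
      rw [e]
      exact enorm_add_le _ _
    refine (setLIntegral_mono' measurableSet_Ioi hle).trans ?_
    rw [lintegral_add_left]
    · rw [ENNReal.coe_add, add_mul, add_mul]
      exact add_le_add (b₁ f g hg hgi hg2) (b₂ f g hg hgi hg2)
    · refine Measurable.enorm (StronglyMeasurable.measurable
        (StronglyMeasurable.integral_prod_right' (f := fun p : ℝ × E n =>
          levelOp k₁ f p.2 p.1 * g p.2) ?_))
      exact (((h₁.measurable_levelOp f.continuous.measurable).comp measurable_swap).mul
        (hg.comp measurable_snd)).stronglyMeasurable

lemma sum {ι : Type*} (s : Finset ι) {k : ι → ℝ → E n → E n → 𝕜}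
    (h : ∀ i ∈ s, IsLevelKernel γ (k i)) (hγ : 0 < γ) (hγ1 : γ ≤ 1) (hn : 1 ≤ n) :
    IsLevelKernel γ (fun y x x' => ∑ i ∈ s, k i y x x') := by
  classical
  induction s using Finset.induction_on with
  | empty => simpa using zero
  | insert a s ha ih =>
    simp_rw [Finset.sum_insert ha]
    exact (h a (Finset.mem_insert_self a s)).add
      (ih fun i hi => h i (Finset.mem_insert_of_mem hi)) hγ hγ1 hn

end IsLevelKernel

end LevelKernelSum

/-! ### Kernels built from a pair of profiles -/

section Profiles

variable {n : ℕ}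

/-- A family `Ψ_y`, `y > 0`, of functions of mean zero with the decay and smoothness of
`∇ φ_y`, whose square function is bounded on `L²`. -/
structure IsProfile (γ : ℝ) (Ψ : ℝ → E n → ℝ) : Prop where
  measurable : Measurable fun p : ℝ × E n => Ψ p.1 p.2
  contDiff : ∀ y, 0 < y → ContDiff ℝ 1 (Ψ y)
  bound : ∃ C, 0 ≤ C ∧ ∀ y, 0 < y → ∀ x, |Ψ y x| ≤ C * levelWeight γ n y ‖x‖ ∧
    ‖fderiv ℝ (Ψ y) x‖ ≤ C * levelWeight γ (n + 1) y ‖x‖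
  mean_zero : ∀ y, 0 < y → ∫ x, Ψ y x = 0
  square_function : ∃ C : ℝ≥0, ∀ f : E n → ℝ, Measurable f → Integrable f → MemLp f 2 →
    ∫⁻ y in Ioi (0 : ℝ), ∫⁻ z, ENNReal.ofReal y * ‖∫ x, Ψ y (z - x) * f x‖ₑ ^ 2 ≤
      C * ∫⁻ x, ‖f x‖ₑ ^ 2

/-- The better decay of derivatives in the tangential directions. -/
def IsTangential (γ : ℝ) (Ψ : ℝ → E n → ℝ) : Prop :=
  ∃ C, 0 ≤ C ∧ ∀ y, 0 < y → ∀ x, |Ψ y x| ≤ C * (y * levelWeight γ (n + 1) y ‖x‖)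

variable {𝕜 : Type*} [RCLike 𝕜] {γ : ℝ} {p q : E n → ℝ} {y C : ℝ}

/-- `p` is bounded by the weight at level `y`, and so is its derivative. -/
structure HasWeightBound (γ y C : ℝ) (p : E n → ℝ) : Prop where
  contDiff : ContDiff ℝ 1 p
  nonneg : 0 ≤ C
  bound : ∀ x, |p x| ≤ C * levelWeight γ n y ‖x‖
  fderiv_bound : ∀ x, ‖fderiv ℝ p x‖ ≤ C * levelWeight γ (n + 1) y ‖x‖

namespace HasWeightBound

lemma integrable (hp : HasWeightBound γ y C p) (hγ : 0 < γ) (hy : 0 < y) : Integrable p := by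
  have := (integrable_levelWeight (n := n) (N := n) (γ := γ) (by linarith) hy 0).const_mul C
  refine Integrable.mono' this hp.contDiff.continuous.aestronglyMeasurable
    (ae_of_all _ fun x => ?_)
  simpa using hp.bound x

lemma abs_le (hp : HasWeightBound γ y C p) (hγ : 0 < γ) (hy : 0 < y) (x : E n) :
    |p x| ≤ C * y ^ (-(n : ℝ) - 1) :=
  (hp.bound x).trans (mul_le_mul_of_nonneg_left
    (levelWeight_le_rpow_level (by positivity) hy (norm_nonneg _)) hp.nonneg)

lemma fderiv_le (hp : HasWeightBound γ y C p) (hγ : 0 < γ) (hy : 0 < y) (x : E n) :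
    ‖fderiv ℝ p x‖ ≤ C * y ^ (-((n : ℝ) + 1) - 1) :=
  (hp.fderiv_bound x).trans (mul_le_mul_of_nonneg_left
    (levelWeight_le_rpow_level (by positivity) hy (norm_nonneg _)) hp.nonneg)

lemma integrable_mul (hp : HasWeightBound γ y C p) (hq : HasWeightBound γ y C q) (hγ : 0 < γ)
    (hy : 0 < y) (x x' : E n) : Integrable fun z => p (z - x) * q (z - x') :=
  ((hq.integrable hγ hy).comp_sub_right x').bdd_mul
    (hp.contDiff.continuous.comp (by fun_prop)).aestronglyMeasurable
    (ae_of_all _ fun z => hp.abs_le hγ hy (z - x))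

/-- At a fixed level the derivative of `p` is bounded and `q` is integrable, so the domination is
uniform in `w` and no neighbourhood has to be chosen. -/
lemma hasFDerivAt (hp : HasWeightBound γ y C p) (hq : HasWeightBound γ y C q) (hγ : 0 < γ)
    (hy : 0 < y) {a : E n → 𝕜} (ha : Measurable a) {M : ℝ} (hM : ∀ z, ‖a z‖ ≤ M) (x x' : E n) :
    HasFDerivAt (fun w => ∫ z, a z * ((p (z - w) : ℝ) : 𝕜) * ((q (z - x') : ℝ) : 𝕜))
      (∫ z, (a z * ((q (z - x') : ℝ) : 𝕜)) •
        (-((RCLike.ofRealCLM (K := 𝕜)).comp (fderiv ℝ p (z - x))))) x := by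
  have hM0 : 0 ≤ M := (norm_nonneg _).trans (hM 0)
  have hqi := (hq.integrable hγ hy).comp_sub_right x'
  have hqm : Measurable q := hq.contDiff.continuous.measurable
  have hpm : Measurable p := hp.contDiff.continuous.measurable
  have hdp : Continuous (fderiv ℝ p) := hp.contDiff.continuous_fderiv one_ne_zero
  have hofr : Measurable (RCLike.ofReal : ℝ → 𝕜) := RCLike.continuous_ofReal.measurable
  refine hasFDerivAt_integral_of_dominated_of_fderiv_le (𝕜 := ℝ)
    (F := fun w z => a z * ((p (z - w) : ℝ) : 𝕜) * ((q (z - x') : ℝ) : 𝕜))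
    (F' := fun w z => (a z * ((q (z - x') : ℝ) : 𝕜)) •
        (-((RCLike.ofRealCLM (K := 𝕜)).comp (fderiv ℝ p (z - w)))))
    (s := univ) (bound := fun z => M * (C * y ^ (-((n : ℝ) + 1) - 1)) * |q (z - x')|)
    univ_mem (Eventually.of_forall fun w => ?_) ?_ ?_ (ae_of_all _ fun z w _ => ?_)
    (hqi.abs.const_mul _) (ae_of_all _ fun z w _ => ?_)
  · exact ((ha.mul (hofr.comp (hpm.comp (measurable_id.sub_const w)))).mul
      (hofr.comp (hqm.comp (measurable_id.sub_const x')))).aestronglyMeasurable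
  · refine Integrable.mono' ((hp.integrable_mul hq hγ hy x x').norm.const_mul M) ?_
      (ae_of_all _ fun z => ?_)
    · exact ((ha.mul (hofr.comp (hpm.comp (measurable_id.sub_const x)))).mul
        (hofr.comp (hqm.comp (measurable_id.sub_const x')))).aestronglyMeasurable
    · simp only [norm_mul, RCLike.norm_ofReal, Real.norm_eq_abs, mul_assoc]
      gcongr
      exact hM z
  · refine AEStronglyMeasurable.smul (ha.mul (hofr.comp
      (hqm.comp (measurable_id.sub_const x')))).aestronglyMeasurable ?_
    refine Continuous.aestronglyMeasurable ?_
    exact (continuous_const.clm_comp (hdp.comp (continuous_id.sub continuous_const))).neg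
  · rw [norm_smul, norm_neg, norm_mul, RCLike.norm_ofReal]
    have h1 : ‖(RCLike.ofRealCLM (K := 𝕜)).comp (fderiv ℝ p (z - w))‖ ≤
        C * y ^ (-((n : ℝ) + 1) - 1) := by
      refine (ContinuousLinearMap.opNorm_comp_le _ _).trans ?_
      rw [RCLike.ofRealCLM_norm, one_mul]
      exact hp.fderiv_le hγ hy _
    calc _ ≤ M * |q (z - x')| * (C * y ^ (-((n : ℝ) + 1) - 1)) := by
          gcongr
          exact hM z
      _ = _ := by ring
  · have h1 : HasFDerivAt (fun w => p (z - w)) (-(fderiv ℝ p (z - w))) w := by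
      have hd : DifferentiableAt ℝ p (z - w) :=
        (hp.contDiff.differentiable one_ne_zero).differentiableAt
      have := hd.hasFDerivAt.comp w ((hasFDerivAt_const z w).sub (hasFDerivAt_id w))
      refine this.congr_fderiv ?_
      ext v
      simp
    have h2 := ((RCLike.ofRealCLM (K := 𝕜)).hasFDerivAt.comp w h1).const_mul
      (a z * ((q (z - x') : ℝ) : 𝕜))
    refine (h2.congr_fderiv ?_).congr_of_eventuallyEq (Eventually.of_forall fun w' => ?_)
    · ext v
      simp
    · simp only [Function.comp, RCLike.ofRealCLM_apply]
      ring

end HasWeightBound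

end Profiles

/-! ### Gradient estimates for integrals of two profiles -/

section ProfileGradient

variable {n : ℕ} {𝕜 : Type*} [RCLike 𝕜] {γ : ℝ} {p q : E n → ℝ} {y C : ℝ}

lemma norm_integral_le_of_weights {F : Type*} [NormedAddCommGroup F] [NormedSpace ℝ F]
    (hγ : 0 < γ) (hy : 0 < y) {C' : ℝ} {u : E n → F} {x x' : E n} {N : ℝ} (hN : (n : ℝ) ≤ N)
    (hu : ∀ z, ‖u z‖ ≤ C' * (levelWeight γ N y ‖z - x‖ * levelWeight γ N y ‖z - x'‖))
    (hC' : 0 ≤ C') :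
    ‖∫ z, u z‖ ≤ C' * (convConst n (N + γ) * y ^ ((n : ℝ) - N - 1) *
      levelWeight γ N y ‖x - x'‖) := by
  refine (norm_integral_le_of_norm_le ((integrable_levelWeight_mul hγ hN hy x x').const_mul C')
    (ae_of_all _ hu)).trans ?_
  rw [integral_const_mul]
  exact mul_le_mul_of_nonneg_left (integral_levelWeight_mul_le hγ hN hy x x') hC'

namespace HasWeightBound

lemma norm_fderiv_comp_ofReal_le (hp : HasWeightBound γ y C p) (z : E n) :
    ‖(RCLike.ofRealCLM (K := 𝕜)).comp (fderiv ℝ p z)‖ ≤ C * levelWeight γ (n + 1) y ‖z‖ := by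
  refine (ContinuousLinearMap.opNorm_comp_le _ _).trans ?_
  rw [RCLike.ofRealCLM_norm, one_mul]
  exact hp.fderiv_bound z

/-- The gradient estimate for a kernel with tangential profiles. -/
lemma norm_gradient_le_of_tangential (hp : HasWeightBound γ y C p) (hγ : 0 < γ) (hy : 0 < y)
    {a : E n → 𝕜} {M : ℝ} (hM : ∀ z, ‖a z‖ ≤ M) {C₁ : ℝ} (hC₁ : 0 ≤ C₁)
    (hq : ∀ z, |q z| ≤ C₁ * (y * levelWeight γ (n + 1) y ‖z‖)) (x x' : E n) :
    (2 * y) * ‖∫ z, (a z * ((q (z - x') : ℝ) : 𝕜)) •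
        (-((RCLike.ofRealCLM (K := 𝕜)).comp (fderiv ℝ p (z - x))))‖ ≤
      2 * M * C * C₁ * convConst n (n + 1 + γ) * levelWeight γ (n + 1) y ‖x - x'‖ := by
  have hM0 : 0 ≤ M := (norm_nonneg _).trans (hM 0)
  have hC := hp.nonneg
  have h1 := norm_integral_le_of_weights (n := n) (N := n + 1) hγ hy (x := x) (x' := x')
    (C' := M * C * C₁ * y)
    (u := fun z => (a z * ((q (z - x') : ℝ) : 𝕜)) •
        (-((RCLike.ofRealCLM (K := 𝕜)).comp (fderiv ℝ p (z - x))))) (by linarith) (fun z => ?_)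
    (by positivity)
  -- The factor `y` from the tangential bound and the factor `2y` of the kernel together cancel this
  -- `y^(-2)`.
  · have e : y ^ ((n : ℝ) - (n + 1) - 1) = (y ^ 2)⁻¹ := by
      rw [show ((n : ℝ) - (n + 1) - 1) = -((2 : ℕ) : ℝ) by push_cast; ring,
        Real.rpow_neg hy.le, Real.rpow_natCast]
    rw [e] at h1
    calc _ ≤ (2 * y) * _ := mul_le_mul_of_nonneg_left h1 (by positivity)
      _ = _ := by field_simp
  · rw [norm_smul, norm_neg, norm_mul, RCLike.norm_ofReal]
    have h2 := levelWeight_nonneg (γ := γ) (N := n + 1) hy (norm_nonneg (z - x))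
    have h3 := levelWeight_nonneg (γ := γ) (N := n + 1) hy (norm_nonneg (z - x'))
    calc _ ≤ (M * (C₁ * (y * levelWeight γ (n + 1) y ‖z - x'‖))) *
          (C * levelWeight γ (n + 1) y ‖z - x‖) := by
          gcongr
          · exact hM z
          · exact hq _
          · exact hp.norm_fderiv_comp_ofReal_le _
      _ = _ := by ring

/-- The derivative of the correlation `x ↦ ∫ p (z - x) q (z - x') dz` decays like a derivative:
the identity `x' - x = (z - x) - (z - x')` and an integration by parts move it to either factor. -/
lemma norm_gradient_correlation_le (hp : HasWeightBound γ y C p) (hq : HasWeightBound γ y C q)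
    (hγ : 0 < γ) (hn : 1 ≤ n) (hy : 0 < y) (x x' : E n) (h : E n) :
    (y + ‖x - x'‖) * |∫ z, fderiv ℝ p (z - x) h * q (z - x')| ≤
      4 * C ^ 2 * ‖h‖ * (convConst n (n + γ) * y⁻¹ * levelWeight γ n y ‖x - x'‖) := by
  have hC := hp.nonneg
  have hpd : Differentiable ℝ p := hp.contDiff.differentiable one_ne_zero
  have hqd : Differentiable ℝ q := hq.contDiff.differentiable one_ne_zero
  have hdp : Continuous (fderiv ℝ p) := hp.contDiff.continuous_fderiv one_ne_zero
  have hdq : Continuous (fderiv ℝ q) := hq.contDiff.continuous_fderiv one_ne_zero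
  have hpc := hp.contDiff.continuous
  have hqc := hq.contDiff.continuous
  have wn : ∀ (N : ℝ) (v : E n), 0 ≤ levelWeight γ N y ‖v‖ := fun N v =>
    levelWeight_nonneg hy (norm_nonneg v)
  have ey : y ^ ((n : ℝ) - n - 1) = y⁻¹ := by rw [sub_self, zero_sub, Real.rpow_neg_one]
  have hW := integrable_levelWeight_mul (n := n) (N := n) hγ le_rfl hy x x'
  set I := convConst n (n + γ) * y⁻¹ * levelWeight γ n y ‖x - x'‖ with hI
  have est : ∀ {F : Type _} [NormedAddCommGroup F] [NormedSpace ℝ F] {u : E n → F} {C' : ℝ},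
      0 ≤ C' → (∀ z, ‖u z‖ ≤ C' * (levelWeight γ n y ‖z - x‖ * levelWeight γ n y ‖z - x'‖)) →
      ‖∫ z, u z‖ ≤ C' * I := by
    intro F _ _ u C' hC' hu
    have := norm_integral_le_of_weights (n := n) (N := n) hγ hy le_rfl hu hC'
    rwa [ey] at this
  have hdp' : ∀ z, ‖fderiv ℝ p (z - x) h‖ ≤ C * levelWeight γ (n + 1) y ‖z - x‖ * ‖h‖ := fun z =>
    ((fderiv ℝ p (z - x)).le_opNorm h).trans
      (mul_le_mul_of_nonneg_right (hp.fderiv_bound _) (norm_nonneg h))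
  set D := ∫ z, fderiv ℝ p (z - x) h * q (z - x') with hD
  -- the bound by the level
  have b1 : y * |D| ≤ C ^ 2 * ‖h‖ * I := by
    have : ‖∫ z, y * (fderiv ℝ p (z - x) h * q (z - x'))‖ ≤ C ^ 2 * ‖h‖ * I := by
      refine est (by positivity) fun z => ?_
      rw [norm_mul, norm_mul, Real.norm_of_nonneg hy.le]
      have h1 := mul_levelWeight_add_one_le (γ := γ) (N := n) hy (norm_nonneg (z - x))
      have := wn n (z - x')
      have := wn (n + 1) (z - x)
      calc y * (‖fderiv ℝ p (z - x) h‖ * ‖q (z - x')‖)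
          ≤ y * ((C * levelWeight γ (n + 1) y ‖z - x‖ * ‖h‖) * (C * levelWeight γ n y ‖z - x'‖)) := by
            gcongr
            · exact hdp' z
            · exact hq.bound _
        _ = C ^ 2 * ‖h‖ * ((y * levelWeight γ (n + 1) y ‖z - x‖) * levelWeight γ n y ‖z - x'‖) := by
            ring
        _ ≤ _ := by gcongr
    rwa [integral_const_mul, Real.norm_eq_abs, abs_mul, abs_of_pos hy] at this
  -- the bound by the distance
  set G : E n → E n := fun z => q (z - x') • (z - x') with hG
  have hGd : ∀ z, HasFDerivAt G (q (z - x') • ContinuousLinearMap.id ℝ (E n) +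
      (fderiv ℝ q (z - x')).smulRight (z - x')) z := by
    intro z
    have h1 : HasFDerivAt (fun z => q (z - x')) (fderiv ℝ q (z - x')) z := by
      have := (hqd (z - x')).hasFDerivAt.comp z ((hasFDerivAt_id z).sub_const x')
      simpa [Function.comp_def] using this
    exact h1.smul ((hasFDerivAt_id z).sub_const x')
  have hP : ∀ z, HasFDerivAt (fun z => p (z - x)) (fderiv ℝ p (z - x)) z := by
    intro z
    have := (hpd (z - x)).hasFDerivAt.comp z ((hasFDerivAt_id z).sub_const x)
    simpa [Function.comp_def] using this
  have hGb : ∀ z, ‖fderiv ℝ G z h‖ ≤ 2 * C * ‖h‖ * levelWeight γ n y ‖z - x'‖ := by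
    intro z
    rw [(hGd z).fderiv]
    simp only [add_apply, FunLike.coe_smul, Pi.smul_apply,
      ContinuousLinearMap.id_apply, ContinuousLinearMap.smulRight_apply]
    refine (norm_add_le _ _).trans ?_
    rw [norm_smul, norm_smul]
    have h1 := dist_mul_levelWeight_add_one_le (γ := γ) (N := n) hy (norm_nonneg (z - x'))
    have h2 : ‖fderiv ℝ q (z - x') h‖ ≤ C * levelWeight γ (n + 1) y ‖z - x'‖ * ‖h‖ :=
      ((fderiv ℝ q (z - x')).le_opNorm h).trans
        (mul_le_mul_of_nonneg_right (hq.fderiv_bound _) (norm_nonneg h))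
    have h3 := hq.bound (z - x')
    calc ‖q (z - x')‖ * ‖h‖ + ‖fderiv ℝ q (z - x') h‖ * ‖z - x'‖
        ≤ (C * levelWeight γ n y ‖z - x'‖) * ‖h‖ +
          (C * levelWeight γ (n + 1) y ‖z - x'‖ * ‖h‖) * ‖z - x'‖ := by gcongr; exact h3
      _ = C * ‖h‖ * (levelWeight γ n y ‖z - x'‖ +
          ‖z - x'‖ * levelWeight γ (n + 1) y ‖z - x'‖) := by ring
      _ ≤ C * ‖h‖ * (levelWeight γ n y ‖z - x'‖ + levelWeight γ n y ‖z - x'‖) := by gcongr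
      _ = _ := by ring
  have hGc : Continuous G := continuous_iff_continuousAt.2 fun z => (hGd z).continuousAt
  have hGdm : Continuous fun z => fderiv ℝ G z h := by
    have : (fun z => fderiv ℝ G z h) = fun z => q (z - x') • h +
        (fderiv ℝ q (z - x') h) • (z - x') := by
      ext1 z
      rw [(hGd z).fderiv]
      simp
    rw [this]
    have c1 : Continuous fun z => fderiv ℝ q (z - x') h :=
      (hdq.comp (continuous_id.sub continuous_const)).clm_apply continuous_const
    fun_prop
  have hsub : Continuous fun z : E n => z - x := continuous_id.sub continuous_const
  have cdp : Continuous fun z => fderiv ℝ p (z - x) h := (hdp.comp hsub).clm_apply continuous_const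
  have cp : Continuous fun z => p (z - x) := hpc.comp hsub
  have cq : Continuous fun z => q (z - x') := hqc.comp (continuous_id.sub continuous_const)
  have iGp : ∀ z, ‖p (z - x) • fderiv ℝ G z h‖ ≤
      2 * C ^ 2 * ‖h‖ * (levelWeight γ n y ‖z - x‖ * levelWeight γ n y ‖z - x'‖) := by
    intro z
    rw [norm_smul]
    have := wn n (z - x)
    calc _ ≤ (C * levelWeight γ n y ‖z - x‖) * (2 * C * ‖h‖ * levelWeight γ n y ‖z - x'‖) := by
          gcongr
          · exact hp.bound _
          · exact hGb z
      _ = _ := by ring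
  have bdp : ∀ z, |fderiv ℝ p (z - x) h| ≤ C * y ^ (-((n : ℝ) + 1) - 1) * ‖h‖ := fun z =>
    ((fderiv ℝ p (z - x)).le_opNorm h).trans
      (mul_le_mul_of_nonneg_right (hp.fderiv_le hγ hy _) (norm_nonneg h))
  -- integrability of `q (z - x') • (z - x')` against `p'`: split `z - x' = (z - x) + (x - x')`
  have i1 : Integrable fun z => (fderiv ℝ p (z - x) h * q (z - x')) • (z - x) := by
    refine Integrable.mono' (hW.const_mul (C ^ 2 * ‖h‖))
      ((cdp.mul cq).smul hsub).aestronglyMeasurable (ae_of_all _ fun z => ?_)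
    rw [norm_smul, norm_mul]
    have h1 := dist_mul_levelWeight_add_one_le (γ := γ) (N := n) hy (norm_nonneg (z - x))
    have := wn n (z - x')
    have := wn (n + 1) (z - x)
    calc _ ≤ (C * levelWeight γ (n + 1) y ‖z - x‖ * ‖h‖) * (C * levelWeight γ n y ‖z - x'‖) *
          ‖z - x‖ := by
          gcongr
          · exact hdp' z
          · exact hq.bound _
      _ = C ^ 2 * ‖h‖ * ((‖z - x‖ * levelWeight γ (n + 1) y ‖z - x‖) *
          levelWeight γ n y ‖z - x'‖) := by ring
      _ ≤ _ := by gcongr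
  have i0 : Integrable fun z => fderiv ℝ p (z - x) h * q (z - x') :=
    ((hq.integrable hγ hy).comp_sub_right x').bdd_mul cdp.aestronglyMeasurable
      (ae_of_all _ bdp)
  have i2 : Integrable fun z => fderiv ℝ p (z - x) h • G z := by
    have : (fun z => fderiv ℝ p (z - x) h • G z) = fun z =>
        (fderiv ℝ p (z - x) h * q (z - x')) • (z - x) +
        (fderiv ℝ p (z - x) h * q (z - x')) • (x - x') := by
      ext1 z
      rw [← smul_add, sub_add_sub_cancel, mul_smul]
    rw [this]
    exact i1.add (i0.smul_const _)
  have i3 : Integrable fun z => p (z - x) • fderiv ℝ G z h :=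
    Integrable.mono' (hW.const_mul _) (cp.smul hGdm).aestronglyMeasurable (ae_of_all _ iGp)
  -- No derivative is available here to absorb the factor `z - x`. It costs one order of decay of
  -- `p`, leaving the weight of order `n - 1`, which is bounded because `1 ≤ n`.
  have i4 : Integrable fun z => p (z - x) • G z := by
    have : (fun z => p (z - x) • G z) = fun z =>
        (q (z - x') * p (z - x)) • (z - x) + (p (z - x) * q (z - x')) • (x - x') := by
      ext1 z
      rw [mul_comm (q _), ← smul_add, sub_add_sub_cancel, mul_smul]
    rw [this]
    refine Integrable.add ?_ ((hp.integrable_mul hq hγ hy x x').smul_const _)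
    have hn' : (1 : ℝ) ≤ n := by exact_mod_cast hn
    have hbd : ∀ z, ‖p (z - x) • (z - x)‖ ≤ C * y ^ (-((n : ℝ) - 1) - 1) := by
      intro z
      rw [norm_smul]
      have h1 := dist_mul_levelWeight_add_one_le (γ := γ) (N := n - 1) hy (norm_nonneg (z - x))
      rw [sub_add_cancel] at h1
      calc _ ≤ (C * levelWeight γ n y ‖z - x‖) * ‖z - x‖ := by
            gcongr
            exact hp.bound _
        _ = C * (‖z - x‖ * levelWeight γ n y ‖z - x‖) := by ring
        _ ≤ C * y ^ (-((n : ℝ) - 1) - 1) := by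
            gcongr
            exact h1.trans (levelWeight_le_rpow_level (by linarith) hy (norm_nonneg _))
    refine Integrable.mono' (((hq.integrable hγ hy).comp_sub_right x').norm.mul_const
      (C * y ^ (-((n : ℝ) - 1) - 1))) ((cq.mul cp).smul hsub).aestronglyMeasurable
      (ae_of_all _ fun z => ?_)
    rw [mul_smul, norm_smul]
    gcongr
    exact hbd z
  have parts := integral_smul_fderiv_eq_neg_fderiv_smul_of_integrable (𝕜 := ℝ)
    (μ := (volume : Measure (E n))) (f := fun z => p (z - x)) (g := G) (v := h)
    (by simpa only [(hP _).fderiv] using i2) i3 i4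
    (fun z _ => (hP z).differentiableAt) (fun z _ => (hGd z).differentiableAt)
  simp only [(hP _).fderiv] at parts
  have b2 : ‖x - x'‖ * |D| ≤ 3 * C ^ 2 * ‖h‖ * I := by
    have e : D • (x' - x) = (∫ z, (fderiv ℝ p (z - x) h * q (z - x')) • (z - x)) +
        ∫ z, p (z - x) • fderiv ℝ G z h := by
      rw [parts, ← sub_eq_add_neg, ← integral_sub i1 i2, hD, ← integral_smul_const]
      refine integral_congr_ae (ae_of_all _ fun z => ?_)
      simp only [hG]
      rw [smul_smul, ← smul_sub]
      congr 1
      abel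
    have n1 : ‖∫ z, (fderiv ℝ p (z - x) h * q (z - x')) • (z - x)‖ ≤ C ^ 2 * ‖h‖ * I := by
      refine est (by positivity) fun z => ?_
      rw [norm_smul, norm_mul]
      have h1 := dist_mul_levelWeight_add_one_le (γ := γ) (N := n) hy (norm_nonneg (z - x))
      have := wn n (z - x')
      have := wn (n + 1) (z - x)
      calc _ ≤ (C * levelWeight γ (n + 1) y ‖z - x‖ * ‖h‖) * (C * levelWeight γ n y ‖z - x'‖) *
            ‖z - x‖ := by
            gcongr
            · exact hdp' z
            · exact hq.bound _
        _ = C ^ 2 * ‖h‖ * ((‖z - x‖ * levelWeight γ (n + 1) y ‖z - x‖) *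
            levelWeight γ n y ‖z - x'‖) := by ring
        _ ≤ _ := by gcongr
    have n2 : ‖∫ z, p (z - x) • fderiv ℝ G z h‖ ≤ 2 * C ^ 2 * ‖h‖ * I :=
      est (by positivity) iGp
    have n3 : ‖D • (x' - x)‖ ≤ C ^ 2 * ‖h‖ * I + 2 * C ^ 2 * ‖h‖ * I := by
      rw [e]
      exact (norm_add_le _ _).trans (add_le_add n1 n2)
    rw [norm_smul, norm_sub_rev, Real.norm_eq_abs] at n3
    linarith
  calc (y + ‖x - x'‖) * |D| = y * |D| + ‖x - x'‖ * |D| := by ring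
    _ ≤ C ^ 2 * ‖h‖ * I + 3 * C ^ 2 * ‖h‖ * I := add_le_add b1 b2
    _ = _ := by ring

end HasWeightBound

end ProfileGradient

/-! ### The level kernel of a pair of profiles: gradients and square functions -/

section PairKernel

variable {n : ℕ} {𝕜 : Type*} [RCLike 𝕜] {γ : ℝ}

/-- The level kernel `2 y ∫ a(z, y) Ψ₁_y(z - x) Ψ₂_y(z - x') dz`. -/
noncomputable def pairKernel (a : E n → ℝ → 𝕜) (Ψ₁ Ψ₂ : ℝ → E n → ℝ) (y : ℝ) (x x' : E n) : 𝕜 :=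
  ((2 * y : ℝ) : 𝕜) * ∫ z, a z y * ((Ψ₁ y (z - x) : ℝ) : 𝕜) * ((Ψ₂ y (z - x') : ℝ) : 𝕜)

lemma pairKernel_swap (a : E n → ℝ → 𝕜) (Ψ₁ Ψ₂ : ℝ → E n → ℝ) (y : ℝ) (x x' : E n) :
    pairKernel a Ψ₁ Ψ₂ y x x' = pairKernel a Ψ₂ Ψ₁ y x' x := by
  unfold pairKernel
  congr 2
  ext z
  ring

lemma HasWeightBound.integrable_gradient {p q : E n → ℝ} {y C : ℝ} (hp : HasWeightBound γ y C p)
    (hq : HasWeightBound γ y C q) (hγ : 0 < γ)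
    (hy : 0 < y) {a : E n → 𝕜} (ha : Measurable a) {M : ℝ} (hM : ∀ z, ‖a z‖ ≤ M) (x x' : E n) :
    Integrable fun z => (a z * ((q (z - x') : ℝ) : 𝕜)) •
        (-((RCLike.ofRealCLM (K := 𝕜)).comp (fderiv ℝ p (z - x)))) := by
  have hM0 : 0 ≤ M := (norm_nonneg _).trans (hM 0)
  have hqm : Measurable q := hq.contDiff.continuous.measurable
  have hdp : Continuous (fderiv ℝ p) := hp.contDiff.continuous_fderiv one_ne_zero
  have hofr : Measurable (RCLike.ofReal : ℝ → 𝕜) := RCLike.continuous_ofReal.measurable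
  refine Integrable.mono' (((hq.integrable hγ hy).comp_sub_right x').abs.const_mul
    (M * (C * y ^ (-((n : ℝ) + 1) - 1)))) ?_ (ae_of_all _ fun z => ?_)
  · refine AEStronglyMeasurable.smul (ha.mul (hofr.comp
      (hqm.comp (measurable_id.sub_const x')))).aestronglyMeasurable ?_
    refine Continuous.aestronglyMeasurable ?_
    exact (continuous_const.clm_comp (hdp.comp (continuous_id.sub continuous_const))).neg
  · rw [norm_smul, norm_neg, norm_mul, RCLike.norm_ofReal]
    have h1 : ‖(RCLike.ofRealCLM (K := 𝕜)).comp (fderiv ℝ p (z - x))‖ ≤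
        C * y ^ (-((n : ℝ) + 1) - 1) := by
      refine (ContinuousLinearMap.opNorm_comp_le _ _).trans ?_
      rw [RCLike.ofRealCLM_norm, one_mul]
      exact hp.fderiv_le hγ hy _
    calc _ ≤ M * |q (z - x')| * (C * y ^ (-((n : ℝ) + 1) - 1)) := by
          gcongr
          exact hM z
      _ = _ := by ring

/-- The gradient estimate for a kernel whose coefficient does not depend on the space variable. -/
lemma HasWeightBound.norm_gradient_le_of_const {p q : E n → ℝ} {y C : ℝ}
    (hp : HasWeightBound γ y C p) (hq : HasWeightBound γ y C q) (hγ : 0 < γ) (hn : 1 ≤ n)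
    (hy : 0 < y) {a : 𝕜} {M : ℝ} (hM : ‖a‖ ≤ M) (x x' : E n) :
    (2 * y) * ‖∫ z, (a * ((q (z - x') : ℝ) : 𝕜)) •
        (-((RCLike.ofRealCLM (K := 𝕜)).comp (fderiv ℝ p (z - x))))‖ ≤
      8 * M * C ^ 2 * convConst n (n + γ) * levelWeight γ (n + 1) y ‖x - x'‖ := by
  have hM0 : 0 ≤ M := (norm_nonneg _).trans hM
  have hw := levelWeight_nonneg (γ := γ) (N := n + 1) hy (norm_nonneg (x - x'))
  have hcc := convConst_nonneg n (n + γ)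
  have hpos : 0 < y + ‖x - x'‖ := by positivity
  rw [← le_div_iff₀' (by positivity)]
  refine ContinuousLinearMap.opNorm_le_bound _ (by positivity) fun h => ?_
  rw [ContinuousLinearMap.integral_apply (hp.integrable_gradient hq hγ hy measurable_const
    (fun _ => hM) x x')]
  have e : ∀ z, ((a * ((q (z - x') : ℝ) : 𝕜)) •
        (-((RCLike.ofRealCLM (K := 𝕜)).comp (fderiv ℝ p (z - x))))) h =
      -a * ((fderiv ℝ p (z - x) h * q (z - x') : ℝ) : 𝕜) := by
    intro z
    simp
    ring
  simp_rw [e]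
  rw [integral_const_mul, integral_ofReal, norm_mul, norm_neg, RCLike.norm_ofReal]
  have key := hp.norm_gradient_correlation_le hq hγ hn hy x x' h
  -- Dividing the correlation estimate by `y + ‖x - x'‖` raises the order of the weight from `n` to
  -- `n + 1`.
  rw [← levelWeight_add_one_mul (N := n) hy (norm_nonneg _)] at key
  have key' : |∫ z, fderiv ℝ p (z - x) h * q (z - x')| ≤ 4 * C ^ 2 * ‖h‖ *
      (convConst n (n + γ) * y⁻¹ * levelWeight γ (n + 1) y ‖x - x'‖) := by
    refine le_of_mul_le_mul_left (key.trans (le_of_eq ?_)) hpos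
    ring
  calc _ ≤ M * (4 * C ^ 2 * ‖h‖ *
      (convConst n (n + γ) * y⁻¹ * levelWeight γ (n + 1) y ‖x - x'‖)) := by gcongr
    _ = _ := by field_simp; ring

namespace IsProfile

variable {Ψ Ψ₁ Ψ₂ : ℝ → E n → ℝ}

lemma exists_hasWeightBound (h₁ : IsProfile γ Ψ₁) (h₂ : IsProfile γ Ψ₂) :
    ∃ C, 0 ≤ C ∧ ∀ y, 0 < y → HasWeightBound γ y C (Ψ₁ y) ∧ HasWeightBound γ y C (Ψ₂ y) := by
  obtain ⟨C₁, p₁, b₁⟩ := h₁.bound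
  obtain ⟨C₂, p₂, b₂⟩ := h₂.bound
  refine ⟨C₁ + C₂, by positivity, fun y hy => ?_⟩
  have wn : ∀ (N : ℝ) (v : E n), 0 ≤ levelWeight γ N y ‖v‖ := fun N v =>
    levelWeight_nonneg hy (norm_nonneg v)
  refine ⟨⟨h₁.contDiff y hy, by positivity, fun x => (b₁ y hy x).1.trans ?_,
    fun x => (b₁ y hy x).2.trans ?_⟩, ⟨h₂.contDiff y hy, by positivity,
    fun x => (b₂ y hy x).1.trans ?_, fun x => (b₂ y hy x).2.trans ?_⟩⟩ <;>
  · refine mul_le_mul_of_nonneg_right ?_ (wn _ _)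
    linarith

lemma integrable (h : IsProfile γ Ψ) (hγ : 0 < γ) {y : ℝ} (hy : 0 < y) : Integrable (Ψ y) := by
  obtain ⟨C, -, hC⟩ := h.exists_hasWeightBound h
  exact (hC y hy).1.integrable hγ hy

variable {a : E n → ℝ → 𝕜} {M : ℝ}

/-- The derivative in `x` falls on `Ψ₁` and improves only that factor. The other factor has to bring
the same order of decay by being tangential; otherwise a coefficient constant in space allows the
derivative to be moved between the factors by parts. -/
lemma exists_pairKernel_gradient (h₁ : IsProfile γ Ψ₁) (h₂ : IsProfile γ Ψ₂) (hγ : 0 < γ)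
    (hn : 1 ≤ n) (ha : Measurable fun p : E n × ℝ => a p.1 p.2) (hM : ∀ z y, ‖a z y‖ ≤ M)
    (hcase : IsTangential γ Ψ₂ ∨ ∀ z z' y, a z y = a z' y) :
    ∃ C, 0 ≤ C ∧ ∀ y, 0 < y → ∀ x x',
      DifferentiableAt ℝ (fun w => pairKernel a Ψ₁ Ψ₂ y w x') x ∧
      ‖fderiv ℝ (fun w => pairKernel a Ψ₁ Ψ₂ y w x') x‖ ≤
        C * levelWeight γ (n + 1) y ‖x - x'‖ := by
  obtain ⟨C, hC, hb⟩ := h₁.exists_hasWeightBound h₂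
  have hM0 : 0 ≤ M := (norm_nonneg _).trans (hM 0 0)
  have hd : ∀ y, 0 < y → ∀ x x', DifferentiableAt ℝ (fun w => pairKernel a Ψ₁ Ψ₂ y w x') x ∧
      ‖fderiv ℝ (fun w => pairKernel a Ψ₁ Ψ₂ y w x') x‖ ≤
        (2 * y) * ‖∫ z, (a z y * ((Ψ₂ y (z - x') : ℝ) : 𝕜)) •
        (-((RCLike.ofRealCLM (K := 𝕜)).comp (fderiv ℝ (Ψ₁ y) (z - x))))‖ := by
    intro y hy x x'
    have := ((hb y hy).1.hasFDerivAt (hb y hy).2 hγ hy (a := fun z => a z y)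
      (ha.comp measurable_prodMk_right) (fun z => hM z y) x x').const_mul ((2 * y : ℝ) : 𝕜)
    refine ⟨this.differentiableAt, ?_⟩
    have e := this.fderiv
    unfold pairKernel
    rw [e, norm_smul, RCLike.norm_ofReal, abs_of_pos (by positivity)]
  have c1 := convConst_nonneg n (n + 1 + γ)
  have c2 := convConst_nonneg n (n + γ)
  rcases hcase with ⟨C₁, hC₁, ht⟩ | hconst
  · refine ⟨2 * M * C * C₁ * convConst n (n + 1 + γ), by positivity, fun y hy x x' =>
      ⟨(hd y hy x x').1, (hd y hy x x').2.trans ?_⟩⟩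
    exact (hb y hy).1.norm_gradient_le_of_tangential hγ hy (fun z => hM z y) hC₁
      (fun z => ht y hy z) x x'
  · refine ⟨8 * M * C ^ 2 * convConst n (n + γ), by positivity, fun y hy x x' =>
      ⟨(hd y hy x x').1, (hd y hy x x').2.trans ?_⟩⟩
    have e : ∀ z, a z y = a 0 y := fun z => hconst z 0 y
    simp_rw [e]
    exact (hb y hy).1.norm_gradient_le_of_const (hb y hy).2 hγ hn hy (hM 0 y) x x'

lemma measurable_conv (h : IsProfile γ Ψ) {f : E n → 𝕜} (hf : Measurable f) :
    Measurable fun p : ℝ × E n => ∫ x, ((Ψ p.1 (p.2 - x) : ℝ) : 𝕜) * f x := by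
  have hofr : Measurable (RCLike.ofReal : ℝ → 𝕜) := RCLike.continuous_ofReal.measurable
  refine (StronglyMeasurable.integral_prod_right' (f := fun q : (ℝ × E n) × E n =>
    ((Ψ q.1.1 (q.1.2 - q.2) : ℝ) : 𝕜) * f q.2) ?_).measurable
  have hg : Measurable fun q : (ℝ × E n) × E n => (q.1.1, q.1.2 - q.2) :=
    (measurable_fst.comp measurable_fst).prodMk
      ((measurable_snd.comp measurable_fst).sub measurable_snd)
  exact ((hofr.comp (h.measurable.comp hg)).mul (hf.comp measurable_snd)).stronglyMeasurable

/-- The square function estimate for real or complex functions. -/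
lemma square_function_le (h : IsProfile γ Ψ) (hγ : 0 < γ) :
    ∃ C : ℝ≥0, ∀ f : E n → 𝕜, Measurable f → Integrable f → MemLp f 2 →
      ∫⁻ y in Ioi (0 : ℝ), ∫⁻ z, ENNReal.ofReal y * ‖∫ x, ((Ψ y (z - x) : ℝ) : 𝕜) * f x‖ₑ ^ 2 ≤
        C * eLpNorm f 2 volume ^ 2 := by
  obtain ⟨C, hC⟩ := h.square_function
  obtain ⟨B, -, hB⟩ := h.exists_hasWeightBound h
  refine ⟨C, fun f hf hfi hf2 => ?_⟩
  have hre : Measurable fun x => RCLike.re (f x) := RCLike.measurable_re.comp hf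
  have him : Measurable fun x => RCLike.im (f x) := RCLike.measurable_im.comp hf
  have hsq : ∀ w : 𝕜, ‖w‖ₑ ^ 2 = ‖RCLike.re w‖ₑ ^ 2 + ‖RCLike.im w‖ₑ ^ 2 := by
    intro w
    rw [← ofReal_norm, ← ofReal_norm, ← ofReal_norm, ← ENNReal.ofReal_pow (norm_nonneg _),
      ← ENNReal.ofReal_pow (norm_nonneg _), ← ENNReal.ofReal_pow (norm_nonneg _),
      ← ENNReal.ofReal_add (by positivity) (by positivity), Real.norm_eq_abs, Real.norm_eq_abs,
      sq_abs, sq_abs, RCLike.norm_sq_eq_def]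
    congr 1
    ring
  have hint : ∀ y ∈ Ioi (0 : ℝ), ∀ z, Integrable fun x => ((Ψ y (z - x) : ℝ) : 𝕜) * f x := by
    intro y hy z
    refine hfi.bdd_mul (c := B * y ^ (-(n : ℝ) - 1)) ?_ (ae_of_all _ fun x => ?_)
    · exact (RCLike.continuous_ofReal.comp ((hB y hy).1.contDiff.continuous.comp
        (continuous_const.sub continuous_id))).aestronglyMeasurable
    · rw [RCLike.norm_ofReal]
      exact (hB y hy).1.abs_le hγ hy _
  have hsplit : ∀ y ∈ Ioi (0 : ℝ),
      ∫⁻ z, ENNReal.ofReal y * ‖∫ x, ((Ψ y (z - x) : ℝ) : 𝕜) * f x‖ₑ ^ 2 ≤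
      (∫⁻ z, ENNReal.ofReal y * ‖∫ x, Ψ y (z - x) * RCLike.re (f x)‖ₑ ^ 2) +
      ∫⁻ z, ENNReal.ofReal y * ‖∫ x, Ψ y (z - x) * RCLike.im (f x)‖ₑ ^ 2 := by
    intro y hy
    rw [← lintegral_add_left]
    · refine le_of_eq (lintegral_congr fun z => ?_)
      rw [← mul_add, hsq]
      congr 4
      · have := integral_re (hint y hy z)
        simp only [RCLike.re_ofReal_mul] at this
        exact this.symm
      · have := integral_im (hint y hy z)
        simp only [RCLike.im_ofReal_mul] at this
        exact this.symm
    · have := (h.measurable_conv (𝕜 := ℝ) hre).comp (measurable_prodMk_left (x := y))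
      exact ((this.enorm.pow_const 2).const_mul _)
  refine (setLIntegral_mono' measurableSet_Ioi hsplit).trans ?_
  rw [lintegral_add_left, eLpNorm_two_sq]
  · have e : ∫⁻ x, ‖f x‖ₑ ^ 2 = (∫⁻ x, ‖RCLike.re (f x)‖ₑ ^ 2) + ∫⁻ x, ‖RCLike.im (f x)‖ₑ ^ 2 := by
      rw [← lintegral_add_left (hre.enorm.pow_const 2)]
      exact lintegral_congr fun x => hsq _
    rw [e, mul_add]
    exact add_le_add (hC _ hre hfi.re hf2.re) (hC _ him hfi.im hf2.im)
  · have := (h.measurable_conv (𝕜 := ℝ) hre)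
    exact Measurable.lintegral_prod_right' (f := fun q : ℝ × E n => ENNReal.ofReal q.1 *
      ‖∫ x, Ψ q.1 (q.2 - x) * RCLike.re (f x)‖ₑ ^ 2)
      ((ENNReal.measurable_ofReal.comp measurable_fst).mul (this.enorm.pow_const 2))

end IsProfile

end PairKernel

/-! ### Pairs of profiles generate level kernels -/

section PairKernelIsLevel

variable {n : ℕ} {𝕜 : Type*} [RCLike 𝕜] {γ : ℝ}

lemma integral_correlation_swap {b g : E n → 𝕜} {p : E n → ℝ}
    (hi : Integrable fun q : E n × E n => b q.2 * ((p (q.2 - q.1) : ℝ) : 𝕜) * g q.1) :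
    ∫ x, (∫ z, b z * ((p (z - x) : ℝ) : 𝕜)) * g x =
      ∫ z, b z * ∫ x, ((p (z - x) : ℝ) : 𝕜) * g x := by
  simp_rw [← integral_mul_const, ← integral_const_mul]
  rw [integral_integral_swap (f := fun x z => b z * ((p (z - x) : ℝ) : 𝕜) * g x) hi]
  simp_rw [mul_assoc]

/-- Two variants of integrability are needed because `pairing_pairKernel` exchanges integrals twice:
once against the bounded `f`, and once against the merely integrable `g`, when the other factor is
bounded. -/
lemma integrable_correlation_of_bdd_left {b g : E n → 𝕜} {p : E n → ℝ} (hb : Measurable b)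
    {M : ℝ} (hM : ∀ z, ‖b z‖ ≤ M) (hp : Integrable p) (hg : Integrable g) :
    Integrable fun q : E n × E n => b q.2 * ((p (q.2 - q.1) : ℝ) : 𝕜) * g q.1 := by
  have h := (hg.convolution_integrand (ContinuousLinearMap.mul ℝ 𝕜) (hp.ofReal (𝕜 := 𝕜))
    (μ := (volume : Measure (E n)))).swap
  refine (h.bdd_mul (hb.comp measurable_snd).aestronglyMeasurable
    (ae_of_all _ fun q => hM q.2)).congr (ae_of_all _ fun q => ?_)
  simp only [Function.comp, Prod.fst_swap, Prod.snd_swap, ContinuousLinearMap.mul_apply']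
  ring

lemma integrable_correlation_of_bdd_right {b g : E n → 𝕜} {p : E n → ℝ} (hg : Measurable g)
    {M : ℝ} (hM : ∀ z, ‖g z‖ ≤ M) (hp : Integrable p) (hb : Integrable b) :
    Integrable fun q : E n × E n => b q.2 * ((p (q.2 - q.1) : ℝ) : 𝕜) * g q.1 := by
  have h := (hb.convolution_integrand (ContinuousLinearMap.mul ℝ 𝕜) (hp.comp_neg.ofReal (𝕜 := 𝕜))
    (μ := (volume : Measure (E n))))
  refine (h.bdd_mul (hg.comp measurable_fst).aestronglyMeasurable
    (ae_of_all _ fun q => hM q.1)).congr (ae_of_all _ fun q => ?_)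
  simp only [Function.comp, ContinuousLinearMap.mul_apply', neg_sub]
  ring

namespace IsProfile

variable {Ψ₁ Ψ₂ : ℝ → E n → ℝ} {a : E n → ℝ → 𝕜} {M : ℝ}

lemma integrable_coeff_mul (h₁ : IsProfile γ Ψ₁) (hγ : 0 < γ)
    (ha : Measurable fun p : E n × ℝ => a p.1 p.2) (hM : ∀ z y, ‖a z y‖ ≤ M) {y : ℝ} (hy : 0 < y)
    (x : E n) : Integrable fun z => a z y * ((Ψ₁ y (z - x) : ℝ) : 𝕜) :=
  ((h₁.integrable hγ hy).comp_sub_right x).ofReal.bdd_mul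
    (ha.comp measurable_prodMk_right).aestronglyMeasurable (ae_of_all _ fun z => hM z y)

lemma measurable_pairKernel (h₁ : IsProfile γ Ψ₁) (h₂ : IsProfile γ Ψ₂)
    (ha : Measurable fun p : E n × ℝ => a p.1 p.2) :
    Measurable fun p : ℝ × E n × E n => pairKernel a Ψ₁ Ψ₂ p.1 p.2.1 p.2.2 := by
  have hofr : Measurable (RCLike.ofReal : ℝ → 𝕜) := RCLike.continuous_ofReal.measurable
  refine Measurable.mul (hofr.comp (measurable_fst.const_mul 2)) ?_
  have g1 : Measurable fun q : (ℝ × E n × E n) × E n => (q.1.1, q.2 - q.1.2.1) := by fun_prop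
  have g2 : Measurable fun q : (ℝ × E n × E n) × E n => (q.1.1, q.2 - q.1.2.2) := by fun_prop
  have g3 : Measurable fun q : (ℝ × E n × E n) × E n => (q.2, q.1.1) := by fun_prop
  exact (StronglyMeasurable.integral_prod_right' (((ha.comp g3).mul
    (hofr.comp (h₁.measurable.comp g1))).mul
    (hofr.comp (h₂.measurable.comp g2))).stronglyMeasurable).measurable

lemma norm_integral_pair_le {p q : E n → ℝ} {y C : ℝ} (hp : HasWeightBound γ y C p)
    (hq : HasWeightBound γ y C q) (hγ : 0 < γ) (hy : 0 < y) {b : E n → 𝕜}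
    (hb : ∀ z, ‖b z‖ ≤ M) (x x' : E n) :
    ‖∫ z, b z * ((p (z - x) : ℝ) : 𝕜) * ((q (z - x') : ℝ) : 𝕜)‖ ≤
      M * C ^ 2 * (convConst n (n + γ) * y⁻¹ * levelWeight γ n y ‖x - x'‖) := by
  have hM0 : 0 ≤ M := (norm_nonneg _).trans (hb 0)
  have hC := hp.nonneg
  have h := norm_integral_le_of_weights (n := n) (N := n) hγ hy le_rfl (C' := M * C ^ 2)
    (x := x) (x' := x')
    (u := fun z => b z * ((p (z - x) : ℝ) : 𝕜) * ((q (z - x') : ℝ) : 𝕜)) (fun z => ?_)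
    (by positivity)
  · rwa [sub_self, zero_sub, Real.rpow_neg_one] at h
  · rw [norm_mul, norm_mul, RCLike.norm_ofReal, RCLike.norm_ofReal]
    have := levelWeight_nonneg (γ := γ) (N := n) hy (norm_nonneg (z - x))
    calc _ ≤ M * (C * levelWeight γ n y ‖z - x‖) * (C * levelWeight γ n y ‖z - x'‖) := by
          gcongr
          · exact hb z
          · exact hp.bound _
          · exact hq.bound _
      _ = _ := by ring

/-- After two exchanges of integrals the bilinear form factors through one convolution of each
function, with `a` acting as a bounded multiplier. No regularity of `a` is needed for the `L²`
theory. -/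
lemma pairing_pairKernel (h₁ : IsProfile γ Ψ₁) (h₂ : IsProfile γ Ψ₂) (hγ : 0 < γ)
    (ha : Measurable fun p : E n × ℝ => a p.1 p.2) (hM : ∀ z y, ‖a z y‖ ≤ M)
    (f : 𝓢(E n, 𝕜)) {g : E n → 𝕜} (hg : Integrable g) {y : ℝ} (hy : 0 < y) :
    ∫ x, (∫ x', pairKernel a Ψ₁ Ψ₂ y x x' * f x') * g x =
      ((2 * y : ℝ) : 𝕜) * ∫ z, a z y * (∫ x, ((Ψ₁ y (z - x) : ℝ) : 𝕜) * g x) *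
        ∫ x', ((Ψ₂ y (z - x') : ℝ) : 𝕜) * f x' := by
  obtain ⟨C, hC, hb⟩ := h₁.exists_hasWeightBound h₂
  obtain ⟨B, -, hfB, -⟩ := f.exists_holder_bound
  set U : E n → 𝕜 := fun z => ∫ x', ((Ψ₂ y (z - x') : ℝ) : 𝕜) * f x' with hU
  have hUm : Measurable U :=
    (h₂.measurable_conv f.continuous.measurable).comp (measurable_prodMk_left (x := y))
  have hUb : ∀ z, ‖U z‖ ≤ ∫ x', C * y ^ (-(n : ℝ) - 1) * ‖f x'‖ := fun z => by
    refine norm_integral_le_of_norm_le (f.integrable.norm.const_mul _) (ae_of_all _ fun x' => ?_)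
    rw [norm_mul, RCLike.norm_ofReal]
    gcongr
    exact (hb y hy).2.abs_le hγ hy _
  have e1 : ∀ x, ∫ x', pairKernel a Ψ₁ Ψ₂ y x x' * f x' =
      ((2 * y : ℝ) : 𝕜) * ∫ z, (a z y * U z) * ((Ψ₁ y (z - x) : ℝ) : 𝕜) := by
    intro x
    unfold pairKernel
    simp_rw [mul_assoc ((2 * y : ℝ) : 𝕜)]
    rw [integral_const_mul, integral_correlation_swap (b := fun z =>
      a z y * ((Ψ₁ y (z - x) : ℝ) : 𝕜)) (p := Ψ₂ y) (g := f)
      (integrable_correlation_of_bdd_right f.continuous.measurable hfB (h₂.integrable hγ hy)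
        (h₁.integrable_coeff_mul hγ ha hM hy x))]
    congr 2
    ext z
    ring
  simp_rw [e1, mul_assoc ((2 * y : ℝ) : 𝕜)]
  rw [integral_const_mul, integral_correlation_swap (b := fun z => a z y * U z) (p := Ψ₁ y)
    (integrable_correlation_of_bdd_left (M := M * ∫ x', C * y ^ (-(n : ℝ) - 1) * ‖f x'‖)
      ((ha.comp measurable_prodMk_right).mul hUm)
      (fun z => ?_) (h₁.integrable hγ hy) hg)]
  · congr 2
    ext z
    ring
  · have hM0 : 0 ≤ M := (norm_nonneg _).trans (hM 0 0)
    exact (norm_mul_le _ _).trans (mul_le_mul (hM z y) (hUb z) (norm_nonneg _) hM0)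

/-- A pair of profiles together with an admissible coefficient generates a level kernel. -/
lemma isLevelKernel_pairKernel (h₁ : IsProfile γ Ψ₁) (h₂ : IsProfile γ Ψ₂) (hγ : 0 < γ)
    (hn : 1 ≤ n) (ha : Measurable fun p : E n × ℝ => a p.1 p.2) (hM : ∀ z y, ‖a z y‖ ≤ M)
    (hcase : (IsTangential γ Ψ₁ ∧ IsTangential γ Ψ₂) ∨ ∀ z z' y, a z y = a z' y) :
    IsLevelKernel γ (pairKernel a Ψ₁ Ψ₂) where
  measurable := h₁.measurable_pairKernel h₂ ha
  bound := by
    obtain ⟨C, hC, hb⟩ := h₁.exists_hasWeightBound h₂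
    have hM0 : 0 ≤ M := (norm_nonneg _).trans (hM 0 0)
    have c2 := convConst_nonneg n (n + γ)
    refine ⟨2 * M * C ^ 2 * convConst n (n + γ), by positivity, fun y hy x x' => ?_⟩
    unfold pairKernel
    rw [norm_mul, RCLike.norm_ofReal, abs_of_pos (by positivity)]
    have := norm_integral_pair_le (hb y hy).1 (hb y hy).2 hγ hy (fun z => hM z y) x x'
    calc _ ≤ 2 * y * _ := mul_le_mul_of_nonneg_left this (by positivity)
      _ = _ := by field_simp
  diff_left := h₁.exists_pairKernel_gradient h₂ hγ hn ha hM (hcase.imp_left And.right)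
  diff_right := by
    obtain ⟨C, hC, h⟩ := h₂.exists_pairKernel_gradient h₁ hγ hn ha hM (hcase.imp_left And.left)
    refine ⟨C, hC, fun y hy x x' => ?_⟩
    simp_rw [pairKernel_swap a Ψ₁ Ψ₂, norm_sub_rev x x']
    exact h y hy x' x
  -- Integrating in `x'` first meets only `Ψ₂`, which has mean zero, whatever the coefficient is.
  cancel y hy x := by
    have := integral_correlation_swap (b := fun z => a z y * ((Ψ₁ y (z - x) : ℝ) : 𝕜)) (p := Ψ₂ y)
      (g := fun _ => (1 : 𝕜)) (integrable_correlation_of_bdd_right measurable_const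
        (M := 1) (by simp) (h₂.integrable hγ hy) (h₁.integrable_coeff_mul hγ ha hM hy x))
    simp only [mul_one] at this
    unfold pairKernel
    rw [integral_const_mul, this]
    have e : ∀ z, ∫ x', ((Ψ₂ y (z - x') : ℝ) : 𝕜) = 0 := fun z => by
      rw [integral_ofReal, integral_sub_left_eq_self (Ψ₂ y) volume z, h₂.mean_zero y hy,
        RCLike.ofReal_zero]
    simp [e]
  pairing := by
    obtain ⟨C₁, hC₁⟩ := h₁.square_function_le (𝕜 := 𝕜) hγ
    obtain ⟨C₂, hC₂⟩ := h₂.square_function_le (𝕜 := 𝕜) hγ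
    have hM0 : 0 ≤ M := (norm_nonneg _).trans (hM 0 0)
    -- Cauchy–Schwarz produces the geometric mean of `C₁` and `C₂`; their sum is a larger constant
    -- that avoids square roots.
    refine ⟨Real.toNNReal (2 * M) * (C₁ + C₂), fun f g hg hgi hg2 => ?_⟩
    set U : ℝ × E n → 𝕜 := fun q => ∫ x', ((Ψ₂ q.1 (q.2 - x') : ℝ) : 𝕜) * f x' with hU
    set V : ℝ × E n → 𝕜 := fun q => ∫ x', ((Ψ₁ q.1 (q.2 - x') : ℝ) : 𝕜) * g x' with hV
    have hUm : Measurable U := h₂.measurable_conv f.continuous.measurable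
    have hVm : Measurable V := h₁.measurable_conv hg
    -- The measure `y dy dz` of the square functions is obtained by giving each convolution one
    -- factor `√y`.
    set A : ℝ × E n → ℝ≥0∞ := fun q => ENNReal.ofReal (√q.1) * ‖U q‖ₑ with hA
    set B : ℝ × E n → ℝ≥0∞ := fun q => ENNReal.ofReal (√q.1) * ‖V q‖ₑ with hB
    have hsm : Measurable fun q : ℝ × E n => ENNReal.ofReal (√q.1) :=
      ENNReal.measurable_ofReal.comp (Real.continuous_sqrt.measurable.comp measurable_fst)
    have hAm : Measurable A := hsm.mul hUm.enorm
    have hBm : Measurable B := hsm.mul hVm.enorm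
    have hpt : ∀ y ∈ Ioi (0 : ℝ), ‖∫ x, (∫ x', pairKernel a Ψ₁ Ψ₂ y x x' * f x') * g x‖ₑ ≤
        ENNReal.ofReal (2 * M) * ∫⁻ z, A (y, z) * B (y, z) := by
      intro y hy
      have hy : 0 < y := hy
      rw [h₁.pairing_pairKernel h₂ hγ ha hM f hgi hy, enorm_mul]
      have e0 : ‖((2 * y : ℝ) : 𝕜)‖ₑ = ENNReal.ofReal (2 * y) := by
        rw [← ofReal_norm, RCLike.norm_ofReal, abs_of_pos (by positivity)]
      rw [e0, ← lintegral_const_mul' _ _ ENNReal.ofReal_ne_top]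
      calc _ ≤ ENNReal.ofReal (2 * y) * ∫⁻ z, ‖a z y * V (y, z) * U (y, z)‖ₑ := by
            gcongr
            exact enorm_integral_le_lintegral_enorm _
        _ = ∫⁻ z, ENNReal.ofReal (2 * y) * ‖a z y * V (y, z) * U (y, z)‖ₑ := by
            rw [lintegral_const_mul']
            exact ENNReal.ofReal_ne_top
        _ ≤ _ := by
            refine lintegral_mono fun z => ?_
            rw [enorm_mul, enorm_mul]
            have e1 : ‖a z y‖ₑ ≤ ENNReal.ofReal M := by
              rw [← ofReal_norm]
              exact ENNReal.ofReal_le_ofReal (hM z y)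
            calc _ ≤ ENNReal.ofReal (2 * y) * (ENNReal.ofReal M * ‖V (y, z)‖ₑ * ‖U (y, z)‖ₑ) := by
                  gcongr
              _ = ENNReal.ofReal (2 * y) * ENNReal.ofReal M * (‖V (y, z)‖ₑ * ‖U (y, z)‖ₑ) := by
                  ring
              _ = ENNReal.ofReal (2 * M) * (ENNReal.ofReal (√y) * ENNReal.ofReal (√y)) *
                    (‖V (y, z)‖ₑ * ‖U (y, z)‖ₑ) := by
                  rw [← ENNReal.ofReal_mul (by positivity), ← ENNReal.ofReal_mul (by positivity),
                    ← ENNReal.ofReal_mul (by positivity), Real.mul_self_sqrt hy.le]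
                  ring_nf
              _ = _ := by simp only [hA, hB]; ring
    refine (setLIntegral_mono' measurableSet_Ioi hpt).trans ?_
    rw [lintegral_const_mul' _ _ ENNReal.ofReal_ne_top]
    have hprod : ∫⁻ y in Ioi (0 : ℝ), ∫⁻ z, A (y, z) * B (y, z) =
        ∫⁻ q, A q * B q ∂((volume.restrict (Ioi (0 : ℝ))).prod volume) :=
      (lintegral_prod _ (hAm.mul hBm).aemeasurable).symm
    have hsq : ∀ W : ℝ × E n → 𝕜, Measurable W →
        ∫⁻ q, (ENNReal.ofReal (√q.1) * ‖W q‖ₑ) ^ 2 ∂((volume.restrict (Ioi (0 : ℝ))).prod volume) =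
        ∫⁻ y in Ioi (0 : ℝ), ∫⁻ z, ENNReal.ofReal y * ‖W (y, z)‖ₑ ^ 2 := by
      intro W hW
      have hm : Measurable fun q : ℝ × E n => (ENNReal.ofReal (√q.1) * ‖W q‖ₑ) ^ 2 :=
        (hsm.mul hW.enorm).pow_const 2
      rw [lintegral_prod _ hm.aemeasurable]
      refine setLIntegral_congr_fun measurableSet_Ioi fun y hy => lintegral_congr fun z => ?_
      rw [mul_pow, ← ENNReal.ofReal_pow (Real.sqrt_nonneg _), Real.sq_sqrt (le_of_lt hy)]
    have hfin : ∫⁻ y in Ioi (0 : ℝ), ∫⁻ z, A (y, z) * B (y, z) ≤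
        (C₁ + C₂ : ℝ≥0) * eLpNorm f 2 volume * eLpNorm g 2 volume := by
      refine ENNReal.le_of_sq_le_sq ?_
      rw [hprod]
      calc _ ≤ _ := lintegral_mul_sq_le hAm.aemeasurable hBm.aemeasurable
        _ ≤ (C₂ * eLpNorm f 2 volume ^ 2) * (C₁ * eLpNorm g 2 volume ^ 2) := by
            rw [hsq U hUm, hsq V hVm]
            exact mul_le_mul' (hC₂ f f.continuous.measurable f.integrable (f.memLp 2 volume))
              (hC₁ g hg hgi hg2)
        _ = (C₁ * C₂ : ℝ≥0) * (eLpNorm f 2 volume ^ 2 * eLpNorm g 2 volume ^ 2) := by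
            push_cast; ring
        _ ≤ ((C₁ + C₂) ^ 2 : ℝ≥0) * (eLpNorm f 2 volume ^ 2 * eLpNorm g 2 volume ^ 2) := by
            gcongr
            have : C₁ * C₂ ≤ (C₁ + C₂) * (C₁ + C₂) :=
              mul_le_mul' le_self_add le_add_self
            rwa [sq]
        _ = _ := by push_cast; ring
    calc _ ≤ ENNReal.ofReal (2 * M) * _ := mul_le_mul' le_rfl hfin
      _ = _ := by
        rw [ENNReal.coe_mul, ← ENNReal.ofReal]
        ring

end IsProfile

end PairKernelIsLevel

/-! ### Reduction of the operators to profiles and bounded coefficients -/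

section Assembly

variable {n : ℕ} {𝕜 : Type*} [RCLike 𝕜] {γ : ℝ}

lemma ae_level_of_ae_halfSpace {P : E n × ℝ → Prop} (h : ∀ᵐ p ∂(halfSpace n), P p) :
    ∀ᵐ y ∂(volume.restrict (Ioi (0 : ℝ))), ∀ᵐ z : E n, P (z, y) := by
  have h2 : ∀ᵐ q ∂((volume.restrict (Ioi (0 : ℝ))).prod (volume : Measure (E n))), P q.swap := by
    have := (Measure.measurePreserving_swap (μ := volume.restrict (Ioi (0 : ℝ)))
      (ν := (volume : Measure (E n)))).quasiMeasurePreserving.ae h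
    exact this
  exact Measure.ae_ae_of_ae_prod h2

/-- A bounded measurable representative of a coefficient. -/
lemma exists_representative {c : E n → ℝ → 𝕜}
    (hc : AEMeasurable (fun p : E n × ℝ => c p.1 p.2) (halfSpace n)) {M : ℝ} (hM0 : 0 ≤ M)
    (hM : ∀ᵐ p ∂(halfSpace n), ‖c p.1 p.2‖ ≤ M) :
    ∃ a : E n → ℝ → 𝕜, Measurable (fun p : E n × ℝ => a p.1 p.2) ∧ (∀ z y, ‖a z y‖ ≤ M) ∧
      (∀ᵐ p ∂(halfSpace n), c p.1 p.2 = a p.1 p.2) := by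
  classical
  set c₀ := hc.mk _ with hc₀
  have hm : Measurable c₀ := hc.measurable_mk
  refine ⟨fun z y => {p : E n × ℝ | ‖c₀ p‖ ≤ M}.indicator c₀ (z, y), ?_, fun z y => ?_, ?_⟩
  · exact hm.indicator (measurableSet_le hm.norm measurable_const)
  · by_cases h : (z, y) ∈ {p : E n × ℝ | ‖c₀ p‖ ≤ M}
    · dsimp only
      rw [indicator_of_mem h]
      exact h
    · simpa only [indicator_of_notMem h, norm_zero] using hM0
  · filter_upwards [hM, hc.ae_eq_mk] with p h1 h2
    have h3 : p ∈ {p : E n × ℝ | ‖c₀ p‖ ≤ M} := by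
      change ‖c₀ p‖ ≤ M
      rwa [hc₀, ← h2]
    rw [h2]
    exact (indicator_of_mem h3 c₀).symm

/-- Passing to a representative may destroy independence of `z`. Fubini provides one `z₀` at which
the representative is correct for almost every level, and freezing it there restores exact
independence. -/
lemma exists_representative_const {c : E n → ℝ → 𝕜}
    (hc : AEMeasurable (fun p : E n × ℝ => c p.1 p.2) (halfSpace n)) {M : ℝ} (hM0 : 0 ≤ M)
    (hM : ∀ᵐ p ∂(halfSpace n), ‖c p.1 p.2‖ ≤ M) (hconst : ∀ z z' y, 0 < y → c z y = c z' y) :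
    ∃ a : E n → ℝ → 𝕜, Measurable (fun p : E n × ℝ => a p.1 p.2) ∧ (∀ z y, ‖a z y‖ ≤ M) ∧
      (∀ᵐ p ∂(halfSpace n), c p.1 p.2 = a p.1 p.2) ∧ ∀ z z' y, a z y = a z' y := by
  obtain ⟨a, ha, hb, hae⟩ := exists_representative hc hM0 hM
  obtain ⟨z₀, hz₀⟩ := (Measure.ae_ae_of_ae_prod hae).exists
  refine ⟨fun _ y => a z₀ y, ?_, fun _ y => hb z₀ y, ?_, fun _ _ _ => rfl⟩
  · exact ha.comp (measurable_const.prodMk measurable_snd)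
  · have : ∀ᵐ y ∂(volume.restrict (Ioi (0 : ℝ))), ∀ z, c z y = a z₀ y := by
      filter_upwards [hz₀, ae_restrict_mem measurableSet_Ioi] with y hy hy0 z
      rw [hconst z z₀ y hy0]
      exact hy
    exact (Measure.quasiMeasurePreserving_snd.ae this).mono fun p hp => hp p.1

lemma IsAdmissible.ae_norm_entry_le
    {A : E n → ℝ → Matrix (Fin (n + 1)) (Fin (n + 1)) 𝕜} (hA : IsAdmissible A) :
    ∃ M : ℝ, 0 ≤ M ∧ ∀ i j, ∀ᵐ p ∂(halfSpace n), ‖A p.1 p.2 i j‖ ≤ M := by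
  obtain ⟨M, hM⟩ := hA.bounded
  refine ⟨max M 0, le_max_right _ _, fun i j => ?_⟩
  filter_upwards [hM] with p hp
  have h1 := hp (EuclideanSpace.single j 1) (by simp)
  refine le_trans ?_ (h1.trans (le_max_left _ _))
  have h2 := PiLp.norm_apply_le (Matrix.toEuclideanLin (A p.1 p.2) (EuclideanSpace.single j 1)) i
  simpa [Matrix.toLpLin_apply] using h2

/-- Admissible matrices have measurable bounded representatives with the same structure. -/
lemma IsAdmissible.exists_coefficients
    {A : E n → ℝ → Matrix (Fin (n + 1)) (Fin (n + 1)) 𝕜} (hA : IsAdmissible A) :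
    ∃ (M : ℝ) (a : Fin (n + 1) → Fin (n + 1) → E n → ℝ → 𝕜),
      (∀ i j, Measurable fun p : E n × ℝ => a i j p.1 p.2) ∧ (∀ i j z y, ‖a i j z y‖ ≤ M) ∧
      (∀ᵐ p ∂(halfSpace n), ∀ i j, A p.1 p.2 i j = a i j p.1 p.2) ∧
      ∀ i j, i = Fin.last n ∨ j = Fin.last n → ∀ z z' y, a i j z y = a i j z' y := by
  obtain ⟨M, hM0, hM⟩ := hA.ae_norm_entry_le
  have : ∀ i j, ∃ a : E n → ℝ → 𝕜, Measurable (fun p : E n × ℝ => a p.1 p.2) ∧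
      (∀ z y, ‖a z y‖ ≤ M) ∧
      (∀ᵐ p ∂(halfSpace n), A p.1 p.2 i j = a p.1 p.2) ∧
      (i = Fin.last n ∨ j = Fin.last n → ∀ z z' y, a z y = a z' y) := by
    intro i j
    by_cases hij : i = Fin.last n ∨ j = Fin.last n
    · obtain ⟨a, h1, h2, h3, h4⟩ := exists_representative_const (c := fun z y => A z y i j)
        (hA.measurable i j) hM0 (hM i j) (hA.indep_of_x i j hij)
      exact ⟨a, h1, h2, h3, fun _ => h4⟩
    · obtain ⟨a, h1, h2, h3⟩ := exists_representative (c := fun z y => A z y i j)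
        (hA.measurable i j) hM0 (hM i j)
      exact ⟨a, h1, h2, h3, fun h => absurd h hij⟩
  choose a h1 h2 h3 h4 using this
  refine ⟨M, a, h1, h2, ?_, h4⟩
  simp_rw [eventually_all]
  exact h3

/-- Integrating absolute values in space leaves, up to a constant, the weight of order `n` at
distance `‖x - x'‖`, which is integrable over the levels off the diagonal. -/
lemma IsProfile.integrable_pair_halfSpace {Ψ₁ Ψ₂ : ℝ → E n → ℝ} {a : E n → ℝ → 𝕜} {M : ℝ}
    (h₁ : IsProfile γ Ψ₁) (h₂ : IsProfile γ Ψ₂) (hγ : 0 < γ) (hn : 1 ≤ n)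
    (ha : Measurable fun p : E n × ℝ => a p.1 p.2) (hM : ∀ z y, ‖a z y‖ ≤ M) {x x' : E n}
    (hx : x ≠ x') :
    Integrable (fun p : E n × ℝ => ((2 * p.2 : ℝ) : 𝕜) * (a p.1 p.2 *
      ((Ψ₁ p.2 (p.1 - x) : ℝ) : 𝕜) * ((Ψ₂ p.2 (p.1 - x') : ℝ) : 𝕜))) (halfSpace n) := by
  obtain ⟨C, hC, hb⟩ := h₁.exists_hasWeightBound h₂
  have hM0 : 0 ≤ M := (norm_nonneg _).trans (hM 0 0)
  have hn' : (0 : ℝ) < n := by exact_mod_cast hn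
  have hr : 0 < ‖x - x'‖ := norm_pos_iff.2 (sub_ne_zero.2 hx)
  have hofr : Measurable (RCLike.ofReal : ℝ → 𝕜) := RCLike.continuous_ofReal.measurable
  have g1 : Measurable fun q : E n × ℝ => (q.2, q.1 - x) := by fun_prop
  have g2 : Measurable fun q : E n × ℝ => (q.2, q.1 - x') := by fun_prop
  have hm : Measurable (fun p : E n × ℝ => ((2 * p.2 : ℝ) : 𝕜) * (a p.1 p.2 *
      ((Ψ₁ p.2 (p.1 - x) : ℝ) : 𝕜) * ((Ψ₂ p.2 (p.1 - x') : ℝ) : 𝕜))) :=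
    (hofr.comp (measurable_snd.const_mul 2)).mul ((ha.mul (hofr.comp (h₁.measurable.comp g1))).mul
      (hofr.comp (h₂.measurable.comp g2)))
  have hpt : ∀ y, 0 < y → ∀ z, ‖((2 * y : ℝ) : 𝕜) * (a z y *
      ((Ψ₁ y (z - x) : ℝ) : 𝕜) * ((Ψ₂ y (z - x') : ℝ) : 𝕜))‖ ≤ 2 * y * M * C ^ 2 *
      (levelWeight γ n y ‖z - x‖ * levelWeight γ n y ‖z - x'‖) := by
    intro y hy z
    simp only [norm_mul, RCLike.norm_ofReal]
    have := levelWeight_nonneg (γ := γ) (N := n) hy (norm_nonneg (z - x))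
    rw [abs_of_pos (show 0 < 2 * y by positivity)]
    calc _ ≤ 2 * y * (M * (C * levelWeight γ n y ‖z - x‖) * (C * levelWeight γ n y ‖z - x'‖)) := by
          gcongr
          · exact hM z y
          · exact (hb y hy).1.bound _
          · exact (hb y hy).2.bound _
      _ = _ := by ring
  rw [halfSpace, integrable_prod_iff' hm.aestronglyMeasurable]
  constructor
  · filter_upwards [ae_restrict_mem measurableSet_Ioi] with y hy
    exact Integrable.mono' ((integrable_levelWeight_mul hγ le_rfl hy x x').const_mul _)
      (hm.comp measurable_prodMk_right).aestronglyMeasurable (ae_of_all _ (hpt y hy))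
  · refine Integrable.mono' ((integrableOn_levelWeight hγ hn' hr).const_mul
      (2 * M * C ^ 2 * convConst n (n + γ)))
      (hm.norm.stronglyMeasurable.integral_prod_left').aestronglyMeasurable ?_
    filter_upwards [ae_restrict_mem measurableSet_Ioi] with y hy
    have hy : 0 < y := hy
    refine (norm_integral_le_of_weights (n := n) (N := n) hγ hy le_rfl
      (fun z => by rw [norm_norm]; exact hpt y hy z) (by positivity)).trans (le_of_eq ?_)
    rw [sub_self, zero_sub, Real.rpow_neg_one]
    field_simp

/-- If the components of `∇ φ_y` are profiles, then `φ` generates Calderón–Zygmund operators. -/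
theorem generatesCZ_of_profiles {φ : E n → ℝ} {Ψ : Fin (n + 1) → ℝ → E n → ℝ} (hγ : 0 < γ)
    (hγ1 : γ ≤ 1) (hn : 1 ≤ n) (hφ : ∀ y, 0 < y → ∀ x i, fullGrad φ y x i = Ψ i y x)
    (hΨ : ∀ i, IsProfile γ (Ψ i)) (htan : ∀ i, i ≠ Fin.last n → IsTangential γ (Ψ i))
    {A : E n → ℝ → Matrix (Fin (n + 1)) (Fin (n + 1)) 𝕜} (hA : IsAdmissible A) :
    GeneratesCZ φ A := by
  obtain ⟨M, a, ham, haM, hae, hconst⟩ := hA.exists_coefficients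
  -- The row index of `A` is paired with the gradient at `z - x` and the column index with the one
  -- at `z - x'`; this fixes the order of the two profiles.
  set k : ℝ → E n → E n → 𝕜 := fun y x x' =>
    ∑ q : Fin (n + 1) × Fin (n + 1), pairKernel (a q.1 q.2) (Ψ q.1) (Ψ q.2) y x x' with hk
  have hkl : IsLevelKernel γ k := by
    refine IsLevelKernel.sum _ (fun q _ => ?_) hγ hγ1 hn
    refine (hΨ q.1).isLevelKernel_pairKernel (hΨ q.2) hγ hn (ham q.1 q.2) (haM q.1 q.2) ?_
    -- Entries in the last row or column have a coefficient depending on the level only; all other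
    -- entries involve two tangential profiles.
    by_cases h : q.1 = Fin.last n ∨ q.2 = Fin.last n
    · exact Or.inr (hconst q.1 q.2 h)
    · push Not at h
      exact Or.inl ⟨htan _ h.1, htan _ h.2⟩
  have hexp' : ∀ᵐ p ∂(halfSpace n), ∀ x x',
      kernelIntegrand φ A x x' p.1 p.2 = ∑ q : Fin (n + 1) × Fin (n + 1), ((2 * p.2 : ℝ) : 𝕜) *
        (a q.1 q.2 p.1 p.2 * ((Ψ q.1 p.2 (p.1 - x) : ℝ) : 𝕜) *
          ((Ψ q.2 p.2 (p.1 - x') : ℝ) : 𝕜)) := by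
    have hpos : ∀ᵐ p : E n × ℝ ∂(halfSpace n), p.2 ∈ Ioi (0 : ℝ) :=
      Measure.quasiMeasurePreserving_snd.ae (ae_restrict_mem measurableSet_Ioi)
    filter_upwards [hae, hpos] with p hz hy0 x x'
    unfold kernelIntegrand
    simp only [hφ p.2 hy0, dotProduct, Matrix.mulVec, hz]
    rw [← Finset.mul_sum, Fintype.sum_prod_type]
    congr 1
    refine Finset.sum_congr rfl fun i _ => ?_
    rw [Finset.sum_mul]
    refine Finset.sum_congr rfl fun j _ => ?_
    ring
  have hexp := ae_level_of_ae_halfSpace hexp'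
  have hint : ∀ᵐ y ∂(volume.restrict (Ioi (0 : ℝ))), ∀ x x',
      ∫ z, kernelIntegrand φ A x x' z y = k y x x' := by
    filter_upwards [hexp, ae_restrict_mem measurableSet_Ioi] with y hy hy0 x x'
    rw [integral_congr_ae (hy.mono fun z hz => hz x x'), integral_finsetSum]
    · refine Finset.sum_congr rfl fun q _ => ?_
      rw [integral_const_mul]
      rfl
    · intro q _
      obtain ⟨C, -, hb⟩ := (hΨ q.1).exists_hasWeightBound (hΨ q.2)
      refine Integrable.const_mul ?_ _
      refine (((hΨ q.1).integrable_coeff_mul hγ (ham q.1 q.2) (haM q.1 q.2) hy0 x).mul_bdd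
        (c := C * y ^ (-(n : ℝ) - 1)) ?_ (ae_of_all _ fun z => ?_))
      · exact (RCLike.continuous_ofReal.comp ((hb y hy0).2.contDiff.continuous.comp
          (continuous_id.sub continuous_const))).aestronglyMeasurable
      · rw [RCLike.norm_ofReal]
        exact (hb y hy0).2.abs_le hγ hy0 _
  have hK : kernelA φ A = superpose k := by
    ext x x'
    exact integral_congr_ae (hint.mono fun y hy => hy x x')
  have hL : ∀ (f : E n → 𝕜) (x : E n), ∀ᵐ y ∂(volume.restrict (Ioi (0 : ℝ))),
      levelOperator φ A f x y = levelOp k f x y := fun f x => by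
    filter_upwards [hint] with y hy
    unfold levelOperator levelOp
    simp_rw [hy]
  have hO : operatorA φ A = fun f : 𝓢(E n, 𝕜) => cutOp k 0 f := by
    ext f x
    exact integral_congr_ae (hL f x)
  refine ⟨fun x x' hx => ?_, fun f x => ?_, ?_, ?_, ?_, ?_⟩
  · have hi : Integrable (fun p : E n × ℝ => ∑ q : Fin (n + 1) × Fin (n + 1),
        ((2 * p.2 : ℝ) : 𝕜) * (a q.1 q.2 p.1 p.2 *
        ((Ψ q.1 p.2 (p.1 - x) : ℝ) : 𝕜) * ((Ψ q.2 p.2 (p.1 - x') : ℝ) : 𝕜))) (halfSpace n) :=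
      integrable_finsetSum _ fun q _ => (hΨ q.1).integrable_pair_halfSpace (hΨ q.2) hγ hn
        (ham q.1 q.2) (haM q.1 q.2) hx
    exact hi.congr (hexp'.mono fun p hp => (hp x x').symm)
  · exact (hkl.integrableOn_levelOp hγ hγ1 hn f x).congr ((hL f x).mono fun y hy => hy.symm)
  · rw [hK, hO]
    exact hkl.isCZOperator_cutOp hγ hγ1 hn
  · rw [hK, hO]
    exact hkl.exists_principal_value hγ hγ1 hn
  · rw [hK]
    exact hkl.eLpNorm_truncated_le hγ hγ1 hn
  · rw [hK]
    exact fun S hS => hkl.isCZOperator_of_tendsto hγ hγ1 hn hS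

end Assembly

/-! ### Gaussian mixtures -/

section GaussianMixture

/-- Mixing measures: probability measures on `(0, ∞)` with negative moments of all orders, which
are dominated by a multiple of `s ^ (-1 - γ / 2) ds`. -/
structure IsMixing (γ : ℝ) (μ : Measure ℝ) : Prop where
  prob : IsProbabilityMeasure μ
  pos : ∀ᵐ s ∂μ, 0 < s
  moments : ∀ a : ℝ, 0 ≤ a → Integrable (fun s => s ^ (-a)) μ
  tail : ∃ C : ℝ, 0 ≤ C ∧ ∀ g : ℝ → ℝ≥0∞, Measurable g →
    ∫⁻ s, g s ∂μ ≤ ENNReal.ofReal C * ∫⁻ s in Ioi (0 : ℝ), ENNReal.ofReal (s ^ (-1 - γ / 2)) * g s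

/-- The `k`-th derivative in `|x|²` of the heat kernel at time `s`, without the exponential. -/
noncomputable def heatCoeff (n k : ℕ) (s : ℝ) : ℝ :=
  (4 * Real.pi * s) ^ (-(n : ℝ) / 2) * (-(1 / (4 * s))) ^ k

/-- The `k`-th derivative in `|x|²` of a mixture of heat kernels. -/
noncomputable def mixture (μ : Measure ℝ) {n : ℕ} (k : ℕ) (x : E n) : ℝ :=
  ∫ s, heatCoeff n k s * Real.exp (-(‖x‖ ^ 2 / (4 * s))) ∂μ

lemma measurable_heatCoeff (n k : ℕ) : Measurable (heatCoeff n k) := by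
  unfold heatCoeff
  exact ((measurable_id.const_mul _).pow_const _).mul
    (((measurable_const.div (measurable_id.const_mul _)).neg).pow_const k)

lemma abs_heatCoeff (n k : ℕ) {s : ℝ} (hs : 0 < s) :
    |heatCoeff n k s| = (4 * Real.pi) ^ (-(n : ℝ) / 2) * (4 ^ k)⁻¹ * s ^ (-((n : ℝ) / 2 + k)) := by
  unfold heatCoeff
  have hpi := Real.pi_pos
  rw [abs_mul, abs_of_nonneg (by positivity), abs_pow, abs_neg, abs_of_pos (by positivity),
    Real.mul_rpow (by positivity) hs.le, neg_add, Real.rpow_add hs, Real.rpow_neg hs.le (k : ℝ),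
    Real.rpow_natCast, one_div, inv_pow, mul_pow, mul_inv, neg_div]
  ring

lemma heatCoeff_succ (n k : ℕ) (s : ℝ) :
    heatCoeff n (k + 1) s = heatCoeff n k s * (-(1 / (4 * s))) := by
  unfold heatCoeff
  rw [pow_succ]
  ring

variable {γ : ℝ} {μ : Measure ℝ} {n : ℕ}

lemma IsMixing.integrable_heatCoeff (hμ : IsMixing γ μ) (k : ℕ) :
    Integrable (heatCoeff n k) μ := by
  refine Integrable.mono' ((hμ.moments ((n : ℝ) / 2 + k) (by positivity)).const_mul
    ((4 * Real.pi) ^ (-(n : ℝ) / 2) * (4 ^ k)⁻¹)) (measurable_heatCoeff n k).aestronglyMeasurable ?_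
  filter_upwards [hμ.pos] with s hs
  rw [Real.norm_eq_abs, abs_heatCoeff n k hs]

lemma exp_neg_div_le_one (x : E n) {s : ℝ} (hs : 0 < s) :
    Real.exp (-(‖x‖ ^ 2 / (4 * s))) ≤ 1 :=
  Real.exp_le_one_iff.2 (neg_nonpos.2 (by positivity))

lemma measurable_mixture_integrand (k : ℕ) (x : E n) :
    Measurable fun s => heatCoeff n k s * Real.exp (-(‖x‖ ^ 2 / (4 * s))) :=
  (measurable_heatCoeff n k).mul
    (Real.measurable_exp.comp (measurable_const.div (measurable_id.const_mul _)).neg)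

lemma IsMixing.integrable_mixture (hμ : IsMixing γ μ) (k : ℕ) (x : E n) :
    Integrable (fun s => heatCoeff n k s * Real.exp (-(‖x‖ ^ 2 / (4 * s)))) μ := by
  refine Integrable.mono' (hμ.integrable_heatCoeff (n := n) k).abs
    (measurable_mixture_integrand k x).aestronglyMeasurable ?_
  filter_upwards [hμ.pos] with s hs
  rw [Real.norm_eq_abs, abs_mul, Real.abs_exp]
  exact mul_le_of_le_one_right (abs_nonneg _) (exp_neg_div_le_one x hs)

/-- The point enters only through `|x|²`, whose gradient is `2x`. Each derivative in `|x|²` brings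
down `-1/(4s)`, hence the passage from `k` to `k + 1`, and the negative moments of `μ` provide the
domination. -/
lemma IsMixing.hasFDerivAt_mixture (hμ : IsMixing γ μ) (k : ℕ) (x : E n) :
    HasFDerivAt (mixture μ k) ((2 * mixture μ (k + 1) x) • innerSL ℝ x) x := by
  have key := hasFDerivAt_integral_of_dominated_of_fderiv_le (𝕜 := ℝ) (μ := μ)
    (F := fun (x : E n) s => heatCoeff n k s * Real.exp (-(‖x‖ ^ 2 / (4 * s))))
    (F' := fun x s => (2 * (heatCoeff n (k + 1) s * Real.exp (-(‖x‖ ^ 2 / (4 * s))))) • innerSL ℝ x)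
    (x₀ := x) (s := Metric.ball x 1)
    (bound := fun s => 2 * |heatCoeff n (k + 1) s| * (‖x‖ + 1))
    (Metric.ball_mem_nhds x one_pos)
    (Eventually.of_forall fun w => (measurable_mixture_integrand k w).aestronglyMeasurable)
    (hμ.integrable_mixture k x)
    (((measurable_mixture_integrand (k + 1) x).const_mul 2).aestronglyMeasurable.smul_const _)
    (by
      filter_upwards [hμ.pos] with s hs w hw
      rw [norm_smul, innerSL_apply_norm, norm_mul, norm_mul, Real.norm_eq_abs, Real.norm_eq_abs,
        Real.norm_eq_abs, Real.abs_exp, abs_two]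
      have h1 := exp_neg_div_le_one w hs
      have h2 : ‖w‖ ≤ ‖x‖ + 1 := by
        rw [Metric.mem_ball, dist_eq_norm] at hw
        have := norm_le_norm_add_norm_sub' w x
        linarith
      calc 2 * (|heatCoeff n (k + 1) s| * Real.exp (-(‖w‖ ^ 2 / (4 * s)))) * ‖w‖
          ≤ 2 * (|heatCoeff n (k + 1) s| * 1) * (‖x‖ + 1) := by gcongr
        _ = _ := by ring)
    (((hμ.integrable_heatCoeff (n := n) (k + 1)).abs.const_mul 2).mul_const _)
    (by
      refine ae_of_all _ fun s w _ => ?_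
      have h1 : HasFDerivAt (fun w : E n => -(‖w‖ ^ 2 / (4 * s)))
          ((-(1 / (4 * s))) • ((2 : ℝ) • innerSL ℝ w)) w := by
        have := (hasStrictFDerivAt_norm_sq w).hasFDerivAt.const_mul (-(1 / (4 * s)))
        refine (this.congr_of_eventuallyEq (Eventually.of_forall fun v => ?_)).congr_fderiv ?_
        · simp only
          ring
        · ext v
          simp
      have h2 := h1.exp.const_mul (heatCoeff n k s)
      refine h2.congr_fderiv ?_
      rw [heatCoeff_succ]
      ext v
      simp
      ring)
  refine key.congr_fderiv ?_
  rw [integral_smul_const, integral_const_mul]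
  rfl

lemma IsMixing.fderiv_mixture (hμ : IsMixing γ μ) (k : ℕ) (x : E n) :
    fderiv ℝ (mixture μ k) x = (2 * mixture μ (k + 1) x) • innerSL ℝ x :=
  (hμ.hasFDerivAt_mixture k x).fderiv

/-- Since differentiating the `k`-th mixture produces the next one, the induction on the order of
smoothness runs over all `k` at once. -/
lemma IsMixing.contDiff_mixture (hμ : IsMixing γ μ) (k : ℕ) :
    ContDiff ℝ (⊤ : ℕ∞) (mixture μ k : E n → ℝ) := by
  rw [contDiff_infty]
  intro N
  induction N generalizing k with
  | zero =>
    rw [Nat.cast_zero, contDiff_zero]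
    exact continuous_iff_continuousAt.2 fun x => (hμ.hasFDerivAt_mixture k x).continuousAt
  | succ N ih =>
    rw [Nat.cast_succ, contDiff_succ_iff_fderiv]
    refine ⟨fun x => (hμ.hasFDerivAt_mixture k x).differentiableAt, by simp, ?_⟩
    have : fderiv ℝ (mixture μ k : E n → ℝ) =
        fun x => (2 * mixture μ (k + 1) x) • innerSL ℝ x := funext fun x => hμ.fderiv_mixture k x
    rw [this]
    exact (contDiff_const.mul (ih (k + 1))).smul (innerSL ℝ).contDiff

/-- Polynomial bounds for the exponential. -/
lemma exists_exp_neg_le (b : ℝ) (hb : 0 < b) :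
    ∃ C, 0 ≤ C ∧ ∀ u, 0 ≤ u → Real.exp (-(u / 4)) ≤ C * (1 + u) ^ (-b) := by
  refine ⟨Real.exp (1 / 4 + b * (Real.log (4 * b) - 1)), by positivity, fun u hu => ?_⟩
  have hx : 0 < 1 + u := by positivity
  -- The inequality `log v ≤ v - 1` at `v = (1 + u) / (4b)`, scaled so that multiplying by `b`
  -- leaves exactly `(1 + u) / 4`.
  have h1 : Real.log (1 + u) ≤ (1 + u) / (4 * b) + Real.log (4 * b) - 1 := by
    have := Real.log_le_sub_one_of_pos (show 0 < (1 + u) / (4 * b) by positivity)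
    rw [Real.log_div hx.ne' (by positivity)] at this
    linarith
  rw [Real.rpow_def_of_pos hx, ← Real.exp_add]
  refine Real.exp_le_exp.2 ?_
  have h2 : b * Real.log (1 + u) ≤ b * ((1 + u) / (4 * b) + Real.log (4 * b) - 1) :=
    mul_le_mul_of_nonneg_left h1 hb.le
  have h3 : b * ((1 + u) / (4 * b)) = (1 + u) / 4 := by field_simp
  nlinarith

/-- Replacing `μ` by its tail bound makes the integral in `s` homogeneous. After a polynomial bound
for the exponential, the integrand is a multiple of `levelWeight 1 a s r` with `r = ‖x‖²` and `a =
(n + γ + 2k)/2`, so the estimate already proved for that weight yields `r^(-a)`. -/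
lemma IsMixing.abs_mixture_le_rpow (hμ : IsMixing γ μ) (hγ : 0 < γ) (k : ℕ) :
    ∃ C, 0 ≤ C ∧ ∀ x : E n, x ≠ 0 →
      |mixture μ k x| ≤ C * ‖x‖ ^ (-((n : ℝ) + γ + 2 * k)) := by
  obtain ⟨C₀, hC₀, ht⟩ := hμ.tail
  set a : ℝ := ((n : ℝ) + γ + 2 * k) / 2 with ha
  have ha0 : 0 < a := by positivity
  obtain ⟨C₁, hC₁, he⟩ := exists_exp_neg_le (a + 1) (by positivity)
  set c : ℝ := (4 * Real.pi) ^ (-(n : ℝ) / 2) * (4 ^ k)⁻¹ with hc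
  have hpi := Real.pi_pos
  have hc0 : 0 ≤ c := by positivity
  refine ⟨C₀ * (c * C₁ * (1 / 1 + 1 / a)), by positivity, fun x hx => ?_⟩
  have hx0 : 0 < ‖x‖ := norm_pos_iff.2 hx
  have hx2 : 0 < ‖x‖ ^ 2 := by positivity
  have h1 : ENNReal.ofReal |mixture μ k x| ≤
      ENNReal.ofReal (C₀ * (c * C₁ * (1 / 1 + 1 / a)) * ‖x‖ ^ (-((n : ℝ) + γ + 2 * k))) := by
    calc ENNReal.ofReal |mixture μ k x|
        ≤ ∫⁻ s, ENNReal.ofReal |heatCoeff n k s * Real.exp (-(‖x‖ ^ 2 / (4 * s)))| ∂μ := by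
          have := enorm_integral_le_lintegral_enorm (μ := μ)
            (fun s => heatCoeff n k s * Real.exp (-(‖x‖ ^ 2 / (4 * s))))
          simp only [← ofReal_norm, Real.norm_eq_abs] at this
          exact this
      _ ≤ ENNReal.ofReal C₀ * ∫⁻ s in Ioi (0 : ℝ), ENNReal.ofReal (s ^ (-1 - γ / 2)) *
          ENNReal.ofReal |heatCoeff n k s * Real.exp (-(‖x‖ ^ 2 / (4 * s)))| :=
          ht _ ((measurable_mixture_integrand k x).norm.ennreal_ofReal)
      _ ≤ ENNReal.ofReal C₀ * ∫⁻ s in Ioi (0 : ℝ),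
          ENNReal.ofReal (c * C₁ * levelWeight 1 a s (‖x‖ ^ 2)) := by
          gcongr ENNReal.ofReal C₀ * ?_
          refine setLIntegral_mono' measurableSet_Ioi fun s hs => ?_
          have hs : 0 < s := hs
          rw [← ENNReal.ofReal_mul (by positivity)]
          refine ENNReal.ofReal_le_ofReal ?_
          rw [abs_mul, abs_heatCoeff n k hs, Real.abs_exp, levelWeight_eq hs hx2.le]
          have h2 := he (‖x‖ ^ 2 / s) (by positivity)
          have h3 : s ^ (-a - 1) = s ^ (-1 - γ / 2) * s ^ (-((n : ℝ) / 2 + k)) := by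
            rw [← Real.rpow_add hs, ha]
            ring_nf
          rw [show ‖x‖ ^ 2 / (4 * s) = ‖x‖ ^ 2 / s / 4 by field_simp, h3]
          calc _ ≤ s ^ (-1 - γ / 2) * (c * s ^ (-((n : ℝ) / 2 + k)) *
                (C₁ * (1 + ‖x‖ ^ 2 / s) ^ (-(a + 1)))) := by gcongr
            _ = _ := by ring
      _ = ENNReal.ofReal C₀ * ENNReal.ofReal (∫ s in Ioi (0 : ℝ),
          c * C₁ * levelWeight 1 a s (‖x‖ ^ 2)) := by
          congr 1
          rw [ofReal_integral_eq_lintegral_ofReal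
            ((integrableOn_levelWeight one_pos ha0 hx2).const_mul _)]
          filter_upwards [ae_restrict_mem measurableSet_Ioi] with s hs
          exact mul_nonneg (by positivity) (levelWeight_nonneg hs hx2.le)
      _ ≤ _ := by
          rw [← ENNReal.ofReal_mul hC₀]
          refine ENNReal.ofReal_le_ofReal ?_
          rw [integral_const_mul]
          have h4 := integral_levelWeight_level_le one_pos ha0 hx2
          have h5 : (‖x‖ ^ 2) ^ (-a) = ‖x‖ ^ (-((n : ℝ) + γ + 2 * k)) := by
            rw [← Real.rpow_natCast, ← Real.rpow_mul hx0.le, ha]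
            push_cast
            ring_nf
          rw [h5] at h4
          calc _ ≤ C₀ * (c * C₁ * ((1 / 1 + 1 / a) * ‖x‖ ^ (-((n : ℝ) + γ + 2 * k)))) := by gcongr
            _ = _ := by ring
  exact (ENNReal.ofReal_le_ofReal_iff (by positivity)).1 h1

/-- All derivatives of the mixture decay like those of a homogeneous function. -/
lemma IsMixing.abs_mixture_le (hμ : IsMixing γ μ) (hγ : 0 < γ) (k : ℕ) :
    ∃ C, 0 ≤ C ∧ ∀ x : E n, |mixture μ k x| ≤ C * (1 + ‖x‖) ^ (-((n : ℝ) + γ + 2 * k)) := by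
  obtain ⟨C₁, hC₁, h1⟩ := hμ.abs_mixture_le_rpow (n := n) hγ k
  set C₂ := ∫ s, |heatCoeff n k s| ∂μ with hC₂
  have hC₂0 : 0 ≤ C₂ := integral_nonneg fun s => abs_nonneg _
  have h2 : ∀ x : E n, |mixture μ k x| ≤ C₂ := by
    intro x
    rw [mixture, ← Real.norm_eq_abs]
    refine norm_integral_le_of_norm_le (hμ.integrable_heatCoeff (n := n) k).abs ?_
    filter_upwards [hμ.pos] with s hs
    rw [Real.norm_eq_abs, abs_mul, Real.abs_exp]
    exact mul_le_of_le_one_right (abs_nonneg _) (exp_neg_div_le_one x hs)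
  set b : ℝ := (n : ℝ) + γ + 2 * k with hb
  have hb0 : 0 < b := by positivity
  refine ⟨(C₁ + C₂) * 2 ^ b, by positivity, fun x => ?_⟩
  have hx1 : 0 < 1 + ‖x‖ := by positivity
  rcases le_total ‖x‖ 1 with hx | hx
  · calc |mixture μ k x| ≤ C₂ := h2 x
      _ ≤ (C₁ + C₂) * 2 ^ b * 2 ^ (-b) := by
          rw [mul_assoc, ← Real.rpow_add two_pos, add_neg_cancel, Real.rpow_zero]
          linarith
      _ ≤ _ := by
          gcongr ?_ * ?_
          exact Real.rpow_le_rpow_of_nonpos hx1 (by linarith) (by linarith)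
  · have hx0 : x ≠ 0 := by
      rintro rfl
      simp at hx
      linarith
    calc |mixture μ k x| ≤ C₁ * ‖x‖ ^ (-b) := h1 x hx0
      _ ≤ C₁ * ((1 + ‖x‖) / 2) ^ (-b) := by
          gcongr ?_ * ?_
          exact Real.rpow_le_rpow_of_nonpos (by positivity) (by linarith) (by linarith)
      _ = C₁ * 2 ^ b * (1 + ‖x‖) ^ (-b) := by
          rw [Real.div_rpow hx1.le two_pos.le, Real.rpow_neg two_pos.le, div_inv_eq_mul]
          ring
      _ ≤ _ := by
          gcongr
          linarith

end GaussianMixture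

/-! ### The components of the gradient of a dilated mixture -/

section MixtureProfiles

variable {γ γ' : ℝ} {μ : Measure ℝ} {n : ℕ}

/-- The profile at level `y` built from the profile at level `1`. -/
noncomputable def scaledProfile (ψ : E n → ℝ) (y : ℝ) (x : E n) : ℝ :=
  (y ^ (n + 1))⁻¹ * ψ (y⁻¹ • x)

lemma hasFDerivAt_comp_smul {ψ : E n → ℝ} (hψ : Differentiable ℝ ψ) (c : ℝ) (x : E n) :
    HasFDerivAt (fun x => ψ (c • x)) (c • fderiv ℝ ψ (c • x)) x := by
  have := (hψ (c • x)).hasFDerivAt.comp x ((hasFDerivAt_id x).const_smul c)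
  refine this.congr_fderiv ?_
  ext v
  simp

lemma scaledProfile_bound {ψ : E n → ℝ} (hψ : ContDiff ℝ 1 ψ) {C : ℝ}
    (h0 : ∀ x, |ψ x| ≤ C * (1 + ‖x‖) ^ (-((n : ℝ) + γ)))
    (h1 : ∀ x, ‖fderiv ℝ ψ x‖ ≤ C * (1 + ‖x‖) ^ (-((n : ℝ) + 1 + γ))) {y : ℝ} (hy : 0 < y)
    (x : E n) :
    |scaledProfile ψ y x| ≤ C * levelWeight γ n y ‖x‖ ∧
      ‖fderiv ℝ (scaledProfile ψ y) x‖ ≤ C * levelWeight γ (n + 1) y ‖x‖ := by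
  have e1 : (y ^ (n + 1))⁻¹ = y ^ (-(n : ℝ) - 1) := by
    rw [show -(n : ℝ) - 1 = -((n + 1 : ℕ) : ℝ) by push_cast; ring, Real.rpow_neg hy.le,
      Real.rpow_natCast]
  have e2 : ‖y⁻¹ • x‖ = ‖x‖ / y := by
    rw [norm_smul, norm_inv, Real.norm_eq_abs, abs_of_pos hy]
    ring
  constructor
  · unfold scaledProfile
    rw [abs_mul, abs_of_pos (by positivity), levelWeight_eq hy (norm_nonneg x), e1]
    have := h0 (y⁻¹ • x)
    rw [e2] at this
    calc _ ≤ y ^ (-(n : ℝ) - 1) * (C * (1 + ‖x‖ / y) ^ (-((n : ℝ) + γ))) := by gcongr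
      _ = _ := by ring
  · have hd := (hasFDerivAt_comp_smul (hψ.differentiable one_ne_zero) y⁻¹ x).const_mul
      ((y ^ (n + 1))⁻¹)
    have e3 : fderiv ℝ (scaledProfile ψ y) x =
        (y ^ (n + 1))⁻¹ • y⁻¹ • fderiv ℝ ψ (y⁻¹ • x) := hd.fderiv
    rw [e3, norm_smul, norm_smul, norm_inv, norm_inv, Real.norm_of_nonneg (by positivity),
      Real.norm_of_nonneg hy.le, levelWeight_eq hy (norm_nonneg x), e1]
    have := h1 (y⁻¹ • x)
    rw [e2] at this
    have e4 : y ^ (-((n : ℝ) + 1) - 1) = y ^ (-(n : ℝ) - 1) * y⁻¹ := by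
      rw [← Real.rpow_neg_one, ← Real.rpow_add hy]
      ring_nf
    rw [e4]
    calc _ ≤ y ^ (-(n : ℝ) - 1) * (y⁻¹ * (C * (1 + ‖x‖ / y) ^ (-((n : ℝ) + 1 + γ)))) := by gcongr
      _ = _ := by ring

lemma measurable_scaledProfile {ψ : E n → ℝ} (hψ : Measurable ψ) :
    Measurable fun p : ℝ × E n => scaledProfile ψ p.1 p.2 :=
  (measurable_fst.pow_const (n + 1)).inv.mul
    (hψ.comp (measurable_fst.inv.smul measurable_snd))

lemma contDiff_scaledProfile {ψ : E n → ℝ} (hψ : ContDiff ℝ 1 ψ) (y : ℝ) :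
    ContDiff ℝ 1 (scaledProfile ψ y) :=
  contDiff_const.mul (hψ.comp (contDiff_const_smul y⁻¹))

/-- The partial derivatives of a Gaussian mixture. -/
noncomputable def tangentialProfile (μ : Measure ℝ) (i : Fin n) (x : E n) : ℝ :=
  2 * (x i * mixture μ 1 x)

/-- The derivative in the dilation parameter of a Gaussian mixture. -/
noncomputable def radialProfile (μ : Measure ℝ) (x : E n) : ℝ :=
  -(n * mixture μ 0 x + 2 * (‖x‖ ^ 2 * mixture μ 1 x))

lemma norm_pow_mul_rpow_le (j : ℕ) {c d : ℝ} (h : c + j ≤ d) (x : E n) :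
    ‖x‖ ^ j * (1 + ‖x‖) ^ (-d) ≤ (1 + ‖x‖) ^ (-c) := by
  have hx : 0 < 1 + ‖x‖ := by positivity
  calc ‖x‖ ^ j * (1 + ‖x‖) ^ (-d) ≤ (1 + ‖x‖) ^ j * (1 + ‖x‖) ^ (-(c + j)) := by
        gcongr
        · linarith
        · linarith [norm_nonneg x]
    _ = (1 + ‖x‖) ^ (-c) := by
        rw [← Real.rpow_natCast, ← Real.rpow_add hx]
        ring_nf

namespace IsMixing

lemma abs_mixture_le' (hμ : IsMixing γ μ) (hγ' : 0 < γ') (hle : γ' ≤ γ) (k : ℕ) :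
    ∃ C, 0 ≤ C ∧ ∀ x : E n, |mixture μ k x| ≤ C * (1 + ‖x‖) ^ (-((n : ℝ) + γ' + 2 * k)) := by
  obtain ⟨C, hC, h⟩ := hμ.abs_mixture_le (n := n) (hγ'.trans_le hle) k
  refine ⟨C, hC, fun x => (h x).trans ?_⟩
  gcongr
  linarith [norm_nonneg x]

lemma contDiff_tangentialProfile (hμ : IsMixing γ μ) (i : Fin n) :
    ContDiff ℝ 1 (tangentialProfile μ i) := by
  have h1 : ContDiff ℝ 1 (mixture μ 1 : E n → ℝ) := (hμ.contDiff_mixture 1).of_le (by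
    exact_mod_cast le_top)
  have h2 : ContDiff ℝ 1 fun x : E n => x i :=
    (EuclideanSpace.proj i : E n →L[ℝ] ℝ).contDiff
  exact contDiff_const.mul (h2.mul h1)

lemma contDiff_radialProfile (hμ : IsMixing γ μ) :
    ContDiff ℝ 1 (radialProfile μ : E n → ℝ) := by
  have h (k : ℕ) : ContDiff ℝ 1 (mixture μ k : E n → ℝ) := (hμ.contDiff_mixture k).of_le (by
    exact_mod_cast le_top)
  exact ((contDiff_const.mul (h 0)).add
    (contDiff_const.mul ((contDiff_norm_sq ℝ).mul (h 1)))).neg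

/-- The first derivative in `|x|²` gains two orders of decay, and the factor `x i` uses only one of
them; in the radial profile the factor `|x|²` uses both. This surplus is what makes the spatial
derivatives tangential. The gradient decays even faster, but the same exponent suffices. -/
lemma tangentialProfile_bound (hμ : IsMixing γ μ) (hγ' : 0 < γ') (hle : γ' ≤ γ) (i : Fin n) :
    ∃ C, 0 ≤ C ∧ ∀ x : E n,
      |tangentialProfile μ i x| ≤ C * (1 + ‖x‖) ^ (-((n : ℝ) + 1 + γ')) ∧
      ‖fderiv ℝ (tangentialProfile μ i) x‖ ≤ C * (1 + ‖x‖) ^ (-((n : ℝ) + 1 + γ')) := by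
  obtain ⟨C₁, hC₁, h1⟩ := hμ.abs_mixture_le' (n := n) hγ' hle 1
  obtain ⟨C₂, hC₂, h2⟩ := hμ.abs_mixture_le' (n := n) hγ' hle 2
  refine ⟨2 * C₁ + 4 * C₂, by positivity, fun x => ?_⟩
  have hxi : |x i| ≤ ‖x‖ := PiLp.norm_apply_le x i
  set R := (1 + ‖x‖) ^ (-((n : ℝ) + 1 + γ')) with hR
  have hR0 : 0 ≤ R := by positivity
  have k0 : ‖x‖ ^ 0 * (1 + ‖x‖) ^ (-((n : ℝ) + γ' + 2 * (1 : ℕ))) ≤ R :=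
    norm_pow_mul_rpow_le 0 (by push_cast; linarith) x
  have k1 : ‖x‖ ^ 1 * (1 + ‖x‖) ^ (-((n : ℝ) + γ' + 2 * (1 : ℕ))) ≤ R :=
    norm_pow_mul_rpow_le 1 (by push_cast; linarith) x
  have k2 : ‖x‖ ^ 2 * (1 + ‖x‖) ^ (-((n : ℝ) + γ' + 2 * (2 : ℕ))) ≤ R :=
    norm_pow_mul_rpow_le 2 (by push_cast; linarith) x
  constructor
  · unfold tangentialProfile
    rw [abs_mul, abs_mul, abs_two]
    calc 2 * (|x i| * |mixture μ 1 x|)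
        ≤ 2 * (‖x‖ * (C₁ * (1 + ‖x‖) ^ (-((n : ℝ) + γ' + 2 * (1 : ℕ))))) := by
          gcongr
          exact h1 x
      _ = 2 * C₁ * (‖x‖ ^ 1 * (1 + ‖x‖) ^ (-((n : ℝ) + γ' + 2 * (1 : ℕ)))) := by ring
      _ ≤ 2 * C₁ * R := by gcongr
      _ ≤ _ := by gcongr; linarith
  · have hd : HasFDerivAt (tangentialProfile μ i) ((2 : ℝ) • (x i • ((2 * mixture μ 2 x) • innerSL ℝ x) +
        mixture μ 1 x • (EuclideanSpace.proj i : E n →L[ℝ] ℝ))) x :=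
      (((EuclideanSpace.proj i : E n →L[ℝ] ℝ).hasFDerivAt (x := x)).mul
        (hμ.hasFDerivAt_mixture 1 x)).const_mul 2
    rw [hd.fderiv, norm_smul, Real.norm_of_nonneg two_pos.le]
    have hp : ‖(EuclideanSpace.proj i : E n →L[ℝ] ℝ)‖ ≤ 1 :=
      ContinuousLinearMap.opNorm_le_bound _ zero_le_one fun v => by
        rw [one_mul]
        exact PiLp.norm_apply_le v i
    have hn1 : ‖x i • ((2 * mixture μ 2 x) • innerSL ℝ x)‖ ≤ 2 * C₂ * R := by
      rw [norm_smul, norm_smul, innerSL_apply_norm, norm_mul, Real.norm_eq_abs, Real.norm_eq_abs,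
        Real.norm_eq_abs, abs_two]
      calc |x i| * (2 * |mixture μ 2 x| * ‖x‖)
          ≤ ‖x‖ * (2 * (C₂ * (1 + ‖x‖) ^ (-((n : ℝ) + γ' + 2 * (2 : ℕ)))) * ‖x‖) := by
            gcongr
            exact h2 x
        _ = 2 * C₂ * (‖x‖ ^ 2 * (1 + ‖x‖) ^ (-((n : ℝ) + γ' + 2 * (2 : ℕ)))) := by ring
        _ ≤ _ := by gcongr
    have hn2 : ‖mixture μ 1 x • (EuclideanSpace.proj i : E n →L[ℝ] ℝ)‖ ≤ C₁ * R := by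
      rw [norm_smul, Real.norm_eq_abs]
      calc _ ≤ (C₁ * (1 + ‖x‖) ^ (-((n : ℝ) + γ' + 2 * (1 : ℕ)))) * 1 := by
            gcongr
            exact h1 x
        _ = C₁ * (‖x‖ ^ 0 * (1 + ‖x‖) ^ (-((n : ℝ) + γ' + 2 * (1 : ℕ)))) := by ring
        _ ≤ _ := by gcongr
    calc _ ≤ 2 * (2 * C₂ * R + C₁ * R) := by
          gcongr
          exact (norm_add_le _ _).trans (add_le_add hn1 hn2)
      _ = _ := by ring

lemma radialProfile_bound (hμ : IsMixing γ μ) (hγ' : 0 < γ') (hle : γ' ≤ γ) :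
    ∃ C, 0 ≤ C ∧ ∀ x : E n,
      |radialProfile μ x| ≤ C * (1 + ‖x‖) ^ (-((n : ℝ) + γ')) ∧
      ‖fderiv ℝ (radialProfile μ) x‖ ≤ C * (1 + ‖x‖) ^ (-((n : ℝ) + 1 + γ')) := by
  obtain ⟨C₀, hC₀, h0⟩ := hμ.abs_mixture_le' (n := n) hγ' hle 0
  obtain ⟨C₁, hC₁, h1⟩ := hμ.abs_mixture_le' (n := n) hγ' hle 1
  obtain ⟨C₂, hC₂, h2⟩ := hμ.abs_mixture_le' (n := n) hγ' hle 2
  refine ⟨n * C₀ + 2 * n * C₁ + 4 * C₁ + 4 * C₂, by positivity, fun x => ?_⟩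
  constructor
  · set R := (1 + ‖x‖) ^ (-((n : ℝ) + γ')) with hR
    have hR0 : 0 ≤ R := by positivity
    have k0 : ‖x‖ ^ 0 * (1 + ‖x‖) ^ (-((n : ℝ) + γ' + 2 * (0 : ℕ))) ≤ R :=
      norm_pow_mul_rpow_le 0 (by push_cast; linarith) x
    have k2 : ‖x‖ ^ 2 * (1 + ‖x‖) ^ (-((n : ℝ) + γ' + 2 * (1 : ℕ))) ≤ R :=
      norm_pow_mul_rpow_le 2 (by push_cast; linarith) x
    unfold radialProfile
    rw [abs_neg]
    refine (abs_add_le _ _).trans ?_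
    rw [abs_mul, abs_mul, abs_mul, abs_two, abs_of_nonneg (Nat.cast_nonneg n),
      abs_of_nonneg (by positivity : 0 ≤ ‖x‖ ^ 2)]
    calc n * |mixture μ 0 x| + 2 * (‖x‖ ^ 2 * |mixture μ 1 x|)
        ≤ n * (C₀ * (1 + ‖x‖) ^ (-((n : ℝ) + γ' + 2 * (0 : ℕ)))) +
          2 * (‖x‖ ^ 2 * (C₁ * (1 + ‖x‖) ^ (-((n : ℝ) + γ' + 2 * (1 : ℕ))))) := by
          gcongr
          · exact h0 x
          · exact h1 x
      _ = n * C₀ * (‖x‖ ^ 0 * (1 + ‖x‖) ^ (-((n : ℝ) + γ' + 2 * (0 : ℕ)))) +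
          2 * C₁ * (‖x‖ ^ 2 * (1 + ‖x‖) ^ (-((n : ℝ) + γ' + 2 * (1 : ℕ)))) := by ring
      _ ≤ n * C₀ * R + 2 * C₁ * R := by gcongr
      _ ≤ n * C₀ * R + 2 * C₁ * R + (2 * n * C₁ + 2 * C₁ + 4 * C₂) * R :=
          le_add_of_nonneg_right (by positivity)
      _ = _ := by ring
  · set R := (1 + ‖x‖) ^ (-((n : ℝ) + 1 + γ')) with hR
    have hR0 : 0 ≤ R := by positivity
    have k1 : ‖x‖ ^ 1 * (1 + ‖x‖) ^ (-((n : ℝ) + γ' + 2 * (1 : ℕ))) ≤ R :=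
      norm_pow_mul_rpow_le 1 (by push_cast; linarith) x
    have k3 : ‖x‖ ^ 3 * (1 + ‖x‖) ^ (-((n : ℝ) + γ' + 2 * (2 : ℕ))) ≤ R :=
      norm_pow_mul_rpow_le 3 (by push_cast; linarith) x
    have hd : HasFDerivAt (radialProfile μ) (-((n : ℝ) • ((2 * mixture μ 1 x) • innerSL ℝ x) +
        (2 : ℝ) • (‖x‖ ^ 2 • ((2 * mixture μ 2 x) • innerSL ℝ x) +
          mixture μ 1 x • ((2 : ℝ) • innerSL ℝ x)))) x := by
      have hsq : HasFDerivAt (fun x : E n => ‖x‖ ^ 2) ((2 : ℝ) • innerSL ℝ x) x := by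
        have := (hasStrictFDerivAt_norm_sq x).hasFDerivAt
        refine this.congr_fderiv ?_
        ext v
        simp
      exact (((hμ.hasFDerivAt_mixture 0 x).const_mul (n : ℝ)).add
        ((hsq.mul (hμ.hasFDerivAt_mixture 1 x)).const_mul 2)).neg
    have e : -((n : ℝ) • ((2 * mixture μ 1 x) • innerSL ℝ x) +
        (2 : ℝ) • (‖x‖ ^ 2 • ((2 * mixture μ 2 x) • innerSL ℝ x) +
          mixture μ 1 x • ((2 : ℝ) • innerSL ℝ x))) =
        (-((2 * n + 4) * mixture μ 1 x + 4 * ‖x‖ ^ 2 * mixture μ 2 x)) • innerSL ℝ x := by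
      ext v
      simp
      ring
    rw [hd.fderiv, e, norm_smul, innerSL_apply_norm, norm_neg, Real.norm_eq_abs]
    have habs : |(2 * n + 4) * mixture μ 1 x + 4 * ‖x‖ ^ 2 * mixture μ 2 x| ≤
        (2 * n + 4) * |mixture μ 1 x| + 4 * ‖x‖ ^ 2 * |mixture μ 2 x| := by
      refine (abs_add_le _ _).trans ?_
      rw [abs_mul, abs_mul (4 * ‖x‖ ^ 2), abs_of_nonneg (by positivity : (0 : ℝ) ≤ 2 * n + 4),
        abs_of_nonneg (by positivity : 0 ≤ 4 * ‖x‖ ^ 2)]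
    calc _ ≤ ((2 * n + 4) * (C₁ * (1 + ‖x‖) ^ (-((n : ℝ) + γ' + 2 * (1 : ℕ)))) +
          4 * ‖x‖ ^ 2 * (C₂ * (1 + ‖x‖) ^ (-((n : ℝ) + γ' + 2 * (2 : ℕ))))) * ‖x‖ := by
          gcongr
          refine habs.trans ?_
          gcongr
          · exact h1 x
          · exact h2 x
      _ = (2 * n + 4) * C₁ * (‖x‖ ^ 1 * (1 + ‖x‖) ^ (-((n : ℝ) + γ' + 2 * (1 : ℕ)))) +
          4 * C₂ * (‖x‖ ^ 3 * (1 + ‖x‖) ^ (-((n : ℝ) + γ' + 2 * (2 : ℕ)))) := by ring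
      _ ≤ (2 * n + 4) * C₁ * R + 4 * C₂ * R := by gcongr
      _ ≤ (2 * n + 4) * C₁ * R + 4 * C₂ * R + n * C₀ * R :=
          le_add_of_nonneg_right (by positivity)
      _ = _ := by ring

lemma fullGrad_castSucc (hμ : IsMixing γ μ) {y : ℝ} (hy : 0 < y) (x : E n) (i : Fin n) :
    fullGrad (mixture μ 0) y x i.castSucc = scaledProfile (tangentialProfile μ i) y x := by
  have hd := (hasFDerivAt_comp_smul (fun x : E n => (hμ.hasFDerivAt_mixture 0 x).differentiableAt)
    y⁻¹ x).const_mul ((y ^ n)⁻¹)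
  have e : fderiv ℝ (dilate (mixture μ 0) y) x = _ := hd.fderiv
  unfold fullGrad
  rw [Fin.snoc_castSucc, e, hμ.fderiv_mixture]
  simp only [scaledProfile, tangentialProfile, smul_apply, innerSL_apply_apply, smul_eq_mul,
    EuclideanSpace.inner_single_right, PiLp.smul_apply, map_mul, conj_trivial]
  rw [pow_succ]
  field_simp

/-- The derivative of `y^(-n) φ(x/y)` in `y` is `-y^(-n-1) (n φ + x · ∇φ)(x/y)`, and for a mixture
`x · ∇φ = 2 |x|² mixture μ 1`. This explains the form of `radialProfile`. -/
lemma hasDerivAt_dilate (hμ : IsMixing γ μ) {y : ℝ} (hy : 0 < y) (x : E n) :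
    HasDerivAt (fun s => dilate (mixture μ 0) s x) (scaledProfile (radialProfile μ) y x) y := by
  have h1 : HasDerivAt (fun s : ℝ => (s ^ n)⁻¹) (-((n * y ^ (n - 1)) / (y ^ n) ^ 2)) y := by
    have := (hasDerivAt_pow n y).fun_inv (pow_ne_zero n hy.ne')
    exact this.congr_deriv (neg_div _ _)
  have h2 : HasDerivAt (fun s : ℝ => s⁻¹ • x) ((-(y ^ 2)⁻¹) • x) y :=
    (hasDerivAt_inv hy.ne').smul_const x
  have h3 : HasDerivAt (mixture μ 0 ∘ fun s : ℝ => s⁻¹ • x)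
      (((2 * mixture μ 1 (y⁻¹ • x)) • innerSL ℝ (y⁻¹ • x)) ((-(y ^ 2)⁻¹) • x)) y :=
    (hμ.hasFDerivAt_mixture 0 (y⁻¹ • x)).comp_hasDerivAt y h2
  have h4 := h1.fun_mul h3
  refine h4.congr_deriv ?_
  simp only [scaledProfile, radialProfile, Function.comp_apply, smul_apply, innerSL_apply_apply, smul_eq_mul,
    inner_smul_left, inner_smul_right, real_inner_self_eq_norm_sq, norm_smul, norm_inv,
    Real.norm_eq_abs, abs_of_pos hy, conj_trivial]
  rcases n with _ | n
  · simp
    field_simp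
  · simp only [Nat.add_sub_cancel]
    field_simp
    ring

lemma fullGrad_last (hμ : IsMixing γ μ) {y : ℝ} (hy : 0 < y) (x : E n) :
    fullGrad (mixture μ 0) y x (Fin.last n) = scaledProfile (radialProfile μ) y x := by
  unfold fullGrad
  rw [Fin.snoc_last]
  exact (hμ.hasDerivAt_dilate hy x).deriv

end IsMixing

end MixtureProfiles

/-! ### Plancherel's theorem and square functions -/

section Plancherel

open scoped FourierTransform ContDiff Convolution

variable {n : ℕ}

/-- Both transforms agree when tested against smooth compactly supported functions: the `L²`
transform is compatible with the distributional one, and the Fourier integral is self-adjoint for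
the bilinear pairing. -/
lemma fourier_toLp_ae_eq {f : E n → ℂ} (hf : Integrable f) (hf2 : MemLp f 2) :
    (𝓕 (hf2.toLp f) : Lp ℂ 2 (volume : Measure (E n))) =ᵐ[volume] 𝓕 f := by
  have hc : Continuous (𝓕 f) :=
    VectorFourier.fourierIntegral_continuous Real.continuous_fourierChar
      (by exact continuous_inner) hf
  refine ae_eq_of_integral_contDiff_smul_eq
    ((Lp.memLp _).locallyIntegrable (by norm_num)) hc.locallyIntegrable fun g hg hgc => ?_
  have hg1 : HasCompactSupport fun x => (g x : ℂ) := hgc.comp_left (g := Complex.ofReal) rfl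
  have hg2 : ContDiff ℝ ∞ fun x => (g x : ℂ) := Complex.ofRealCLM.contDiff.comp hg
  set G : 𝓢(E n, ℂ) := hg1.toSchwartzMap hg2 with hG
  have hGx : ∀ x, G x = g x := fun x => rfl
  have h1 := congrArg (fun D => D G) (Lp.fourier_toTemperedDistribution_eq (hf2.toLp f))
  simp only [TemperedDistribution.fourier_apply, Lp.toTemperedDistribution_apply] at h1
  have h2 := VectorFourier.integral_fourierIntegral_smul_eq_flip (L := innerₗ (E n))
      Real.continuous_fourierChar (by exact continuous_inner) (G.integrable (μ := volume)) hf
  have h3 : ∫ x, (𝓕 G) x • (hf2.toLp f) x = ∫ x, (𝓕 G) x • f x := by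
    refine integral_congr_ae ?_
    filter_upwards [hf2.coeFn_toLp] with x hx
    rw [hx]
  have h4 : ∫ x, (𝓕 G) x • f x = ∫ x, G x • 𝓕 f x := by
    simp only [flip_innerₗ] at h2
    exact h2
  rw [h3, h4] at h1
  calc ∫ x, g x • (𝓕 (hf2.toLp f) : Lp ℂ 2 (volume : Measure (E n))) x
      = ∫ x, G x • (𝓕 (hf2.toLp f) : Lp ℂ 2 (volume : Measure (E n))) x := by
        simp only [hGx]; rfl
    _ = ∫ x, G x • 𝓕 f x := h1.symm
    _ = _ := by simp only [hGx]; rfl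

/-- Plancherel's theorem for functions in `L¹ ∩ L²`. -/
lemma lintegral_enorm_fourier_sq {f : E n → ℂ} (hf : Integrable f) (hf2 : MemLp f 2) :
    ∫⁻ ξ, ‖𝓕 f ξ‖ₑ ^ 2 = ∫⁻ x, ‖f x‖ₑ ^ 2 := by
  rw [← eLpNorm_two_sq, ← eLpNorm_two_sq, ← eLpNorm_congr_ae (fourier_toLp_ae_eq hf hf2)]
  have := Lp.norm_fourier_eq (hf2.toLp f)
  rw [Lp.norm_def, Lp.norm_def, ENNReal.toReal_eq_toReal_iff' (Lp.eLpNorm_ne_top _)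
    (Lp.eLpNorm_ne_top _), eLpNorm_congr_ae hf2.coeFn_toLp] at this
  rw [this]

lemma measurable_fourier_uncurry {Ψ : ℝ → E n → ℝ}
    (hm : Measurable fun p : ℝ × E n => Ψ p.1 p.2) :
    Measurable fun p : ℝ × E n => 𝓕 (fun x => (Ψ p.1 x : ℂ)) p.2 := by
  have h : Measurable fun q : (ℝ × E n) × E n =>
      Complex.exp (((-2 * Real.pi * inner ℝ q.2 q.1.2 : ℝ) : ℂ) * Complex.I) •
        ((Ψ q.1.1 q.2 : ℝ) : ℂ) := by
    have h1 : Measurable fun q : (ℝ × E n) × E n => Ψ q.1.1 q.2 :=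
      hm.comp (measurable_fst.fst.prodMk measurable_snd)
    have h2 : Measurable fun q : (ℝ × E n) × E n =>
      Complex.exp (((-2 * Real.pi * inner ℝ q.2 q.1.2 : ℝ) : ℂ) * Complex.I) := by
      have : Continuous fun q : (ℝ × E n) × E n =>
        Complex.exp (((-2 * Real.pi * inner ℝ q.2 q.1.2 : ℝ) : ℂ) * Complex.I) := by fun_prop
      exact this.measurable
    exact h2.smul (Complex.measurable_ofReal.comp h1)
  have h' := (h.stronglyMeasurable.integral_prod_right' (ν := (volume : Measure (E n)))).measurable
  simpa only [Real.fourier_eq'] using h'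

lemma lintegral_convolution_sq {ψ f : E n → ℝ} (hψ : Integrable ψ) {C : ℝ} (hC : ∀ x, |ψ x| ≤ C)
    (hf : Integrable f) :
    ∫⁻ z, ‖∫ x, ψ (z - x) * f x‖ₑ ^ 2 =
      ∫⁻ ξ, ‖𝓕 (fun x => (ψ x : ℂ)) ξ‖ₑ ^ 2 * ‖𝓕 (fun x => (f x : ℂ)) ξ‖ₑ ^ 2 := by
  have hψc : Integrable fun x => (ψ x : ℂ) := hψ.ofReal
  have hfc : Integrable fun x => (f x : ℂ) := hf.ofReal
  set h : E n → ℂ := (fun x => (ψ x : ℂ)) ⋆[ContinuousLinearMap.mul ℂ ℂ] fun x => (f x : ℂ) with hh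
  have hpt : ∀ z, h z = ((∫ x, ψ (z - x) * f x : ℝ) : ℂ) := by
    intro z
    rw [hh, convolution_eq_swap, ← integral_complex_ofReal]
    simp
  have hint : Integrable h := hψc.integrable_convolution _ hfc
  have hb : ∀ z, ‖h z‖ ≤ C * ∫ x, |f x| := by
    intro z
    rw [hpt, Complex.norm_real, ← integral_const_mul]
    refine norm_integral_le_of_norm_le (hf.abs.const_mul C) (ae_of_all _ fun x => ?_)
    rw [norm_mul, Real.norm_eq_abs, Real.norm_eq_abs]
    exact mul_le_mul_of_nonneg_right (hC _) (abs_nonneg _)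
  have h2 : MemLp h 2 := by
    refine (memLp_two_iff_integrable_sq_norm hint.aestronglyMeasurable).2 ?_
    refine (hint.norm.const_mul (C * ∫ x, |f x|)).mono' (hint.aestronglyMeasurable.norm.pow 2)
      (ae_of_all _ fun z => ?_)
    rw [Real.norm_of_nonneg (by positivity), pow_two]
    exact mul_le_mul_of_nonneg_right (hb z) (norm_nonneg _)
  have h3 := lintegral_enorm_fourier_sq hint h2
  calc ∫⁻ z, ‖∫ x, ψ (z - x) * f x‖ₑ ^ 2 = ∫⁻ z, ‖h z‖ₑ ^ 2 := by
        refine lintegral_congr fun z => ?_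
        rw [hpt, ← ofReal_norm, ← ofReal_norm, Complex.norm_real]
    _ = ∫⁻ ξ, ‖𝓕 h ξ‖ₑ ^ 2 := h3.symm
    _ = _ := by
        refine lintegral_congr fun ξ => ?_
        rw [hh, Real.fourier_mul_convolution_eq hψc hfc, enorm_mul, mul_pow]

/-- Plancherel at each level turns the convolution into a product. Tonelli then moves the integral
over levels inside, at fixed frequency, where only the multiplier depends on `y`. -/
lemma square_function_of_multiplier {Ψ : ℝ → E n → ℝ}
    (hm : Measurable fun p : ℝ × E n => Ψ p.1 p.2) (hint : ∀ y, 0 < y → Integrable (Ψ y))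
    (hb : ∀ y, 0 < y → ∃ C, ∀ x, |Ψ y x| ≤ C) {C : ℝ≥0}
    (hC : ∀ ξ, ∫⁻ y in Ioi (0 : ℝ), ENNReal.ofReal y * ‖𝓕 (fun x => (Ψ y x : ℂ)) ξ‖ₑ ^ 2 ≤ C)
    {f : E n → ℝ} (hf : Integrable f) (hf2 : MemLp f 2) :
    ∫⁻ y in Ioi (0 : ℝ), ∫⁻ z, ENNReal.ofReal y * ‖∫ x, Ψ y (z - x) * f x‖ₑ ^ 2 ≤
      C * ∫⁻ x, ‖f x‖ₑ ^ 2 := by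
  have hfm : Measurable fun ξ => ‖𝓕 (fun x => (f x : ℂ)) ξ‖ₑ ^ 2 := by
    have hc : Continuous (𝓕 fun x => (f x : ℂ)) :=
      VectorFourier.fourierIntegral_continuous Real.continuous_fourierChar
        (by exact continuous_inner) hf.ofReal
    exact hc.measurable.enorm.pow_const 2
  have hΨm := ((measurable_fourier_uncurry hm).enorm.pow_const 2)
  have hym : Measurable fun p : ℝ × E n => ENNReal.ofReal p.1 := measurable_fst.ennreal_ofReal
  calc ∫⁻ y in Ioi (0 : ℝ), ∫⁻ z, ENNReal.ofReal y * ‖∫ x, Ψ y (z - x) * f x‖ₑ ^ 2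
      = ∫⁻ y in Ioi (0 : ℝ), ∫⁻ ξ, ENNReal.ofReal y * ‖𝓕 (fun x => (Ψ y x : ℂ)) ξ‖ₑ ^ 2 *
          ‖𝓕 (fun x => (f x : ℂ)) ξ‖ₑ ^ 2 := by
        refine setLIntegral_congr_fun measurableSet_Ioi fun y hy => ?_
        obtain ⟨D, hD⟩ := hb y hy
        simp only [mul_assoc]
        rw [lintegral_const_mul' _ _ ENNReal.ofReal_ne_top,
          lintegral_const_mul' _ _ ENNReal.ofReal_ne_top,
          lintegral_convolution_sq (hint y hy) hD hf]
    _ = ∫⁻ ξ, ∫⁻ y in Ioi (0 : ℝ), ENNReal.ofReal y * ‖𝓕 (fun x => (Ψ y x : ℂ)) ξ‖ₑ ^ 2 *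
          ‖𝓕 (fun x => (f x : ℂ)) ξ‖ₑ ^ 2 := by
        refine lintegral_lintegral_swap ?_
        have := ((hym.mul hΨm).mul (hfm.comp measurable_snd)).aemeasurable
          (μ := (volume.restrict (Ioi (0 : ℝ))).prod (volume : Measure (E n)))
        exact this
    _ = ∫⁻ ξ, (∫⁻ y in Ioi (0 : ℝ), ENNReal.ofReal y * ‖𝓕 (fun x => (Ψ y x : ℂ)) ξ‖ₑ ^ 2) *
          ‖𝓕 (fun x => (f x : ℂ)) ξ‖ₑ ^ 2 := by
        refine lintegral_congr fun ξ => ?_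
        have := (hym.mul hΨm).comp (measurable_id.prodMk (measurable_const (a := ξ)))
        exact lintegral_mul_const _ this
    _ ≤ ∫⁻ ξ, C * ‖𝓕 (fun x => (f x : ℂ)) ξ‖ₑ ^ 2 :=
        lintegral_mono fun ξ => mul_le_mul_left (hC ξ) _
    _ = C * ∫⁻ ξ, ‖𝓕 (fun x => (f x : ℂ)) ξ‖ₑ ^ 2 := lintegral_const_mul _ hfm
    _ = C * ∫⁻ x, ‖f x‖ₑ ^ 2 := by
        have := lintegral_enorm_fourier_sq (f := fun x => (f x : ℂ)) hf.ofReal hf2.ofReal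
        rw [this]
        congr 1
        refine lintegral_congr fun x => ?_
        rw [← ofReal_norm, ← ofReal_norm, Complex.norm_real]

/-- The factor `y⁻¹` appears because profiles carry `y^(-n-1)`, one power beyond the `L¹`-preserving
dilation. -/
lemma fourier_scaledProfile (ψ : E n → ℝ) {y : ℝ} (hy : 0 < y) (ξ : E n) :
    𝓕 (fun x => (scaledProfile ψ y x : ℂ)) ξ =
      ((y⁻¹ : ℝ) : ℂ) * 𝓕 (fun x => (ψ x : ℂ)) (y • ξ) := by
  have h := Measure.integral_comp_inv_smul (volume : Measure (E n))
    (fun x : E n => Real.fourierChar (-inner ℝ x (y • ξ)) • (ψ x : ℂ)) y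
  have h1 : ∀ x : E n, inner ℝ (y⁻¹ • x) (y • ξ) = inner ℝ x ξ := by
    intro x
    rw [inner_smul_left, inner_smul_right]
    simp [hy.ne']
  simp only [h1, finrank_euclideanSpace, Fintype.card_fin, abs_of_pos (pow_pos hy n)] at h
  rw [Real.fourier_eq, Real.fourier_eq]
  have h2 : ∀ x : E n, Real.fourierChar (-inner ℝ x ξ) • (scaledProfile ψ y x : ℂ) =
      (((y ^ (n + 1))⁻¹ : ℝ) : ℂ) * (Real.fourierChar (-inner ℝ x ξ) • (ψ (y⁻¹ • x) : ℂ)) := by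
    intro x
    rw [scaledProfile, Complex.ofReal_mul, mul_smul_comm]
  simp only [h2]
  rw [integral_const_mul, h, Complex.real_smul, ← mul_assoc, ← Complex.ofReal_mul]
  congr 2
  field_simp
  rw [pow_succ]

end Plancherel

/-! ### Fourier transforms of Gaussian mixtures -/

section GaussianFourierTransform

open scoped FourierTransform

variable {n : ℕ}

lemma fourier_exp_neg_mul_sq {b : ℝ} (hb : 0 < b) (ξ : E n) :
    𝓕 (fun x : E n => ((Real.exp (-b * ‖x‖ ^ 2) : ℝ) : ℂ)) ξ =
      (((Real.pi / b) ^ ((n : ℝ) / 2) * Real.exp (-(Real.pi ^ 2 * ‖ξ‖ ^ 2 / b)) : ℝ) : ℂ) := by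
  have h := fourier_gaussian_innerProductSpace (V := E n) (b := (b : ℂ)) (by simpa using hb) ξ
  have e : (fun x : E n => ((Real.exp (-b * ‖x‖ ^ 2) : ℝ) : ℂ)) =
      fun x : E n => Complex.exp (-(b : ℂ) * (‖x‖ : ℂ) ^ 2) := by
    funext x
    push_cast
    rfl
  rw [e, h, finrank_euclideanSpace, Fintype.card_fin, Complex.ofReal_mul,
    Complex.ofReal_cpow (div_nonneg Real.pi_pos.le hb.le)]
  push_cast
  congr 2
  ring

lemma integrable_exp_neg_mul_norm_sq {b : ℝ} (hb : 0 < b) :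
    Integrable fun x : E n => Real.exp (-b * ‖x‖ ^ 2) := by
  have := (GaussianFourier.integrable_cexp_neg_mul_sq_norm_add (V := E n) (b := (b : ℂ))
    (by simpa using hb) 0 0).norm
  refine this.congr (ae_of_all _ fun x => ?_)
  simp only [zero_mul, add_zero]
  rw [show -(b : ℂ) * (‖x‖ : ℂ) ^ 2 = ((-b * ‖x‖ ^ 2 : ℝ) : ℂ) by push_cast; rfl,
    ← Complex.ofReal_exp, Complex.norm_real, Real.norm_of_nonneg (Real.exp_nonneg _)]

lemma sq_mul_exp_neg_le {b : ℝ} (hb : 0 < b) (x : E n) :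
    ‖x‖ ^ 2 * Real.exp (-b * ‖x‖ ^ 2) ≤ 2 / b * Real.exp (-(b / 2) * ‖x‖ ^ 2) := by
  have h1 : b / 2 * ‖x‖ ^ 2 ≤ Real.exp (b / 2 * ‖x‖ ^ 2) :=
    (lt_add_one _).le.trans (Real.add_one_le_exp _)
  have h2 : ‖x‖ ^ 2 ≤ 2 / b * Real.exp (b / 2 * ‖x‖ ^ 2) := by
    calc ‖x‖ ^ 2 = 2 / b * (b / 2 * ‖x‖ ^ 2) := by field_simp
      _ ≤ _ := by gcongr
  calc ‖x‖ ^ 2 * Real.exp (-b * ‖x‖ ^ 2)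
      ≤ 2 / b * Real.exp (b / 2 * ‖x‖ ^ 2) * Real.exp (-b * ‖x‖ ^ 2) := by gcongr
    _ = _ := by
      rw [mul_assoc, ← Real.exp_add]
      ring_nf

lemma integrable_sq_mul_exp_neg {b : ℝ} (hb : 0 < b) :
    Integrable fun x : E n => ‖x‖ ^ 2 * Real.exp (-b * ‖x‖ ^ 2) := by
  refine ((integrable_exp_neg_mul_norm_sq (half_pos hb)).const_mul (2 / b)).mono'
    (by fun_prop) (ae_of_all _ fun x => ?_)
  rw [Real.norm_of_nonneg (by positivity)]
  exact sq_mul_exp_neg_le hb x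

/-- Minus the derivative in `b` of the Gaussian transform. Restricting to parameters above `b/2`
gives an integrable majorant for the differentiated integrand. -/
lemma fourier_sq_mul_exp_neg {b : ℝ} (hb : 0 < b) (ξ : E n) :
    𝓕 (fun x : E n => ((‖x‖ ^ 2 * Real.exp (-b * ‖x‖ ^ 2) : ℝ) : ℂ)) ξ =
      (((n / (2 * b) - Real.pi ^ 2 * ‖ξ‖ ^ 2 / b ^ 2) *
        ((Real.pi / b) ^ ((n : ℝ) / 2) * Real.exp (-(Real.pi ^ 2 * ‖ξ‖ ^ 2 / b))) : ℝ) : ℂ) := by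
  have hpi := Real.pi_pos
  have key := (hasDerivAt_integral_of_dominated_loc_of_deriv_le (𝕜 := ℝ)
    (μ := (volume : Measure (E n)))
    (F := fun (a : ℝ) (x : E n) =>
      Real.fourierChar (-inner ℝ x ξ) • ((Real.exp (-a * ‖x‖ ^ 2) : ℝ) : ℂ))
    (F' := fun (a : ℝ) (x : E n) =>
      Real.fourierChar (-inner ℝ x ξ) • ((-(‖x‖ ^ 2 * Real.exp (-a * ‖x‖ ^ 2)) : ℝ) : ℂ))
    (x₀ := b) (s := Ioi (b / 2))
    (bound := fun x => ‖x‖ ^ 2 * Real.exp (-(b / 2) * ‖x‖ ^ 2))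
    (Ioi_mem_nhds (by linarith))
    (Eventually.of_forall fun a => by
      refine Continuous.aestronglyMeasurable ?_
      exact (Real.continuous_fourierChar.comp (by fun_prop)).smul (by fun_prop))
    (by
      refine (Real.fourierIntegral_convergent_iff (μ := (volume : Measure (E n))) ξ).2 ?_
      exact (integrable_exp_neg_mul_norm_sq (n := n) hb).ofReal)
    (by
      refine Continuous.aestronglyMeasurable ?_
      exact (Real.continuous_fourierChar.comp (by fun_prop)).smul (by fun_prop))
    (by
      refine ae_of_all _ fun x a ha => ?_
      rw [Circle.norm_smul, Complex.norm_real, norm_neg, Real.norm_of_nonneg (by positivity)]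
      have : b / 2 < a := ha
      gcongr)
    (integrable_sq_mul_exp_neg (half_pos hb))
    (by
      refine ae_of_all _ fun x a _ => ?_
      have h1 : HasDerivAt (fun a : ℝ => Real.exp (-a * ‖x‖ ^ 2))
          (-(‖x‖ ^ 2 * Real.exp (-a * ‖x‖ ^ 2))) a := by
        have := ((hasDerivAt_id a).neg.mul_const (‖x‖ ^ 2)).exp
        refine this.congr_deriv ?_
        simp
        ring
      exact (h1.ofReal_comp).const_smul (Real.fourierChar (-inner ℝ x ξ)))).2
  have hr : HasDerivAt (fun a : ℝ => (Real.pi / a) ^ ((n : ℝ) / 2) *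
      Real.exp (-(Real.pi ^ 2 * ‖ξ‖ ^ 2 / a)))
      (-((n / (2 * b) - Real.pi ^ 2 * ‖ξ‖ ^ 2 / b ^ 2) *
        ((Real.pi / b) ^ ((n : ℝ) / 2) * Real.exp (-(Real.pi ^ 2 * ‖ξ‖ ^ 2 / b))))) b := by
    have hinv : ∀ c : ℝ, HasDerivAt (fun a : ℝ => c / a) (-(c / b ^ 2)) b := by
      intro c
      have := (hasDerivAt_inv hb.ne').const_mul c
      simpa [div_eq_mul_inv] using this
    have h1 := (hinv Real.pi).rpow_const (p := (n : ℝ) / 2) (Or.inl (by positivity))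
    have h2 := (hinv (Real.pi ^ 2 * ‖ξ‖ ^ 2)).fun_neg.exp
    refine (h1.fun_mul h2).congr_deriv ?_
    rw [Real.rpow_sub (by positivity), Real.rpow_one]
    field_simp
    ring
  have heq : (fun a : ℝ => ∫ x : E n,
      Real.fourierChar (-inner ℝ x ξ) • ((Real.exp (-a * ‖x‖ ^ 2) : ℝ) : ℂ)) =ᶠ[𝓝 b]
      fun a => (((Real.pi / a) ^ ((n : ℝ) / 2) *
        Real.exp (-(Real.pi ^ 2 * ‖ξ‖ ^ 2 / a)) : ℝ) : ℂ) := by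
    filter_upwards [Ioi_mem_nhds hb] with a ha
    rw [← fourier_exp_neg_mul_sq ha, Real.fourier_eq]
  have := (key.congr_of_eventuallyEq heq.symm).unique hr.ofReal_comp
  have h3 : 𝓕 (fun x : E n => ((‖x‖ ^ 2 * Real.exp (-b * ‖x‖ ^ 2) : ℝ) : ℂ)) ξ =
      -∫ x : E n, Real.fourierChar (-inner ℝ x ξ) •
        ((-(‖x‖ ^ 2 * Real.exp (-b * ‖x‖ ^ 2)) : ℝ) : ℂ) := by
    rw [Real.fourier_eq, ← integral_neg]
    refine integral_congr_ae (ae_of_all _ fun x => ?_)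
    simp only [Complex.ofReal_neg, smul_neg, neg_neg]
  rw [h3, this]
  push_cast
  ring

/-- The heat kernel at time `s`. -/
noncomputable def heatKernel (s : ℝ) (x : E n) : ℝ :=
  heatCoeff n 0 s * Real.exp (-(‖x‖ ^ 2 / (4 * s)))

lemma heatKernel_eq (s : ℝ) (x : E n) :
    heatKernel s x = (4 * Real.pi * s) ^ (-(n : ℝ) / 2) * Real.exp (-(1 / (4 * s)) * ‖x‖ ^ 2) := by
  unfold heatKernel heatCoeff
  rw [pow_zero, mul_one]
  congr 2
  ring

lemma heatKernel_normalization {s : ℝ} (hs : 0 < s) :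
    (4 * Real.pi * s) ^ (-(n : ℝ) / 2) * (Real.pi / (1 / (4 * s))) ^ ((n : ℝ) / 2) = 1 := by
  have hpi := Real.pi_pos
  rw [show Real.pi / (1 / (4 * s)) = 4 * Real.pi * s by field_simp, ← Real.rpow_add (by positivity)]
  rw [show -(n : ℝ) / 2 + n / 2 = 0 by ring, Real.rpow_zero]

lemma heatKernel_nonneg {s : ℝ} (hs : 0 < s) (x : E n) : 0 ≤ heatKernel s x := by
  have hpi := Real.pi_pos
  rw [heatKernel_eq]
  positivity

lemma integrable_heatKernel {s : ℝ} (hs : 0 < s) : Integrable (heatKernel (n := n) s) := by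
  have := (integrable_exp_neg_mul_norm_sq (n := n) (b := 1 / (4 * s)) (by positivity)).const_mul
    ((4 * Real.pi * s) ^ (-(n : ℝ) / 2))
  exact this.congr (ae_of_all _ fun x => (heatKernel_eq s x).symm)

lemma integrable_sq_mul_heatKernel {s : ℝ} (hs : 0 < s) :
    Integrable fun x : E n => ‖x‖ ^ 2 * heatKernel s x := by
  have := (integrable_sq_mul_exp_neg (n := n) (b := 1 / (4 * s)) (by positivity)).const_mul
    ((4 * Real.pi * s) ^ (-(n : ℝ) / 2))
  refine this.congr (ae_of_all _ fun x => ?_)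
  simp only [heatKernel_eq]
  ring

lemma fourier_const_mul (c : ℝ) (f : E n → ℝ) (ξ : E n) :
    𝓕 (fun x => ((c * f x : ℝ) : ℂ)) ξ = c * 𝓕 (fun x => (f x : ℂ)) ξ := by
  rw [Real.fourier_eq, Real.fourier_eq, ← integral_const_mul]
  refine integral_congr_ae (ae_of_all _ fun x => ?_)
  simp only [Complex.ofReal_mul, mul_smul_comm]

lemma fourier_heatKernel {s : ℝ} (hs : 0 < s) (ξ : E n) :
    𝓕 (fun x : E n => (heatKernel s x : ℂ)) ξ =
      ((Real.exp (-(4 * Real.pi ^ 2 * ‖ξ‖ ^ 2 * s)) : ℝ) : ℂ) := by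
  simp only [heatKernel_eq]
  rw [fourier_const_mul, fourier_exp_neg_mul_sq (by positivity), ← Complex.ofReal_mul, ← mul_assoc,
    heatKernel_normalization hs, one_mul]
  congr 3
  field_simp

lemma fourier_sq_mul_heatKernel {s : ℝ} (hs : 0 < s) (ξ : E n) :
    𝓕 (fun x : E n => ((‖x‖ ^ 2 * heatKernel s x : ℝ) : ℂ)) ξ =
      (((2 * n * s - 16 * Real.pi ^ 2 * ‖ξ‖ ^ 2 * s ^ 2) *
        Real.exp (-(4 * Real.pi ^ 2 * ‖ξ‖ ^ 2 * s)) : ℝ) : ℂ) := by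
  have e : ∀ x : E n, ‖x‖ ^ 2 * heatKernel s x = (4 * Real.pi * s) ^ (-(n : ℝ) / 2) *
      (‖x‖ ^ 2 * Real.exp (-(1 / (4 * s)) * ‖x‖ ^ 2)) := by
    intro x
    rw [heatKernel_eq]
    ring
  simp only [e]
  rw [fourier_const_mul, fourier_sq_mul_exp_neg (by positivity), ← Complex.ofReal_mul,
    mul_left_comm, ← mul_assoc (_ ^ _) (_ ^ _), heatKernel_normalization hs, one_mul]
  congr 1
  rw [show -(Real.pi ^ 2 * ‖ξ‖ ^ 2 / (1 / (4 * s))) = -(4 * Real.pi ^ 2 * ‖ξ‖ ^ 2 * s) by field_simp]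
  congr 1
  field_simp
  ring

lemma integral_eq_of_fourier_zero {f : E n → ℝ} {c : ℝ} (h : 𝓕 (fun x => (f x : ℂ)) 0 = c) :
    ∫ x, f x = c := by
  rw [Real.fourier_eq] at h
  simp only [inner_zero_right, neg_zero, AddChar.map_zero_eq_one, one_smul] at h
  rw [integral_complex_ofReal] at h
  exact_mod_cast h

lemma integral_heatKernel {s : ℝ} (hs : 0 < s) : ∫ x : E n, heatKernel s x = 1 := by
  refine integral_eq_of_fourier_zero ?_
  rw [fourier_heatKernel hs]
  simp

lemma integral_sq_mul_heatKernel {s : ℝ} (hs : 0 < s) :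
    ∫ x : E n, ‖x‖ ^ 2 * heatKernel s x = 2 * n * s := by
  refine integral_eq_of_fourier_zero (f := fun x : E n => ‖x‖ ^ 2 * heatKernel s x) ?_
  rw [fourier_sq_mul_heatKernel hs]
  simp

end GaussianFourierTransform

/-! ### Fourier transforms of the mixture and its derivatives -/

section MixtureFourier

open scoped FourierTransform

variable {n : ℕ} {γ : ℝ} {μ : Measure ℝ}

lemma fourier_integral_eq [SFinite μ] {G : ℝ → E n → ℝ}
    (hG : Integrable (fun p : ℝ × E n => G p.1 p.2) (μ.prod volume)) (ξ : E n) :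
    𝓕 (fun x => ((∫ s, G s x ∂μ : ℝ) : ℂ)) ξ = ∫ s, 𝓕 (fun x => (G s x : ℂ)) ξ ∂μ := by
  simp only [Real.fourier_eq]
  have hc : Continuous fun p : ℝ × E n => ((Real.fourierChar (-inner ℝ p.2 ξ) : Circle) : ℂ) :=
    continuous_subtype_val.comp (Real.continuous_fourierChar.comp (by fun_prop))
  have hint : Integrable (fun p : ℝ × E n => Real.fourierChar (-inner ℝ p.2 ξ) • (G p.1 p.2 : ℂ))
      (μ.prod volume) := by
    refine (hG.ofReal (𝕜 := ℂ)).bdd_mul (c := 1) hc.aestronglyMeasurable (ae_of_all _ fun p => ?_)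
    exact (Circle.norm_coe _).le
  rw [integral_integral_swap hint]
  refine integral_congr_ae (ae_of_all _ fun x => ?_)
  simp only [Circle.smul_def, smul_eq_mul]
  rw [integral_const_mul, integral_complex_ofReal]

lemma measurable_heatKernel_uncurry :
    Measurable fun p : ℝ × E n => heatKernel p.1 p.2 :=
  ((measurable_heatCoeff n 0).comp measurable_fst).mul (Real.measurable_exp.comp
    ((measurable_snd.norm.pow_const 2).div (measurable_fst.const_mul 4)).neg)

/-- The derivative of the dilated heat kernel in the dilation parameter. -/
noncomputable def heatRadial (s : ℝ) (x : E n) : ℝ :=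
  -(n * heatKernel s x) + 1 / (2 * s) * (‖x‖ ^ 2 * heatKernel s x)

lemma measurable_heatRadial_uncurry :
    Measurable fun p : ℝ × E n => heatRadial p.1 p.2 := by
  have h := measurable_heatKernel_uncurry (n := n)
  exact (h.const_mul _).neg.add ((measurable_const.div (measurable_fst.const_mul 2)).mul
    ((measurable_snd.norm.pow_const 2).mul h))

/-- The contribution of the second moment cancels the term with `-n`, and what remains vanishes at
zero frequency. This is the mean zero property of the dilation derivative. -/
lemma fourier_heatRadial {s : ℝ} (hs : 0 < s) (ξ : E n) :
    𝓕 (fun x : E n => (heatRadial s x : ℂ)) ξ =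
      ((-(8 * Real.pi ^ 2 * ‖ξ‖ ^ 2 * s * Real.exp (-(4 * Real.pi ^ 2 * ‖ξ‖ ^ 2 * s))) : ℝ) : ℂ) := by
  have e : ∀ x : E n, heatRadial s x =
      (-n : ℝ) * heatKernel s x + 1 / (2 * s) * (‖x‖ ^ 2 * heatKernel s x) := by
    intro x
    rw [heatRadial]
    ring
  have h1 := fourier_const_mul (n := n) (-n : ℝ) (heatKernel s) ξ
  have h2 := fourier_const_mul (n := n) (1 / (2 * s)) (fun x => ‖x‖ ^ 2 * heatKernel s x) ξ
  rw [fourier_heatKernel hs] at h1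
  rw [fourier_sq_mul_heatKernel hs] at h2
  have i1 := ((Real.fourierIntegral_convergent_iff (μ := (volume : Measure (E n))) ξ).2
    (((integrable_heatKernel (n := n) hs).const_mul (-n : ℝ)).ofReal (𝕜 := ℂ)))
  have i2 := ((Real.fourierIntegral_convergent_iff (μ := (volume : Measure (E n))) ξ).2
    (((integrable_sq_mul_heatKernel (n := n) hs).const_mul (1 / (2 * s))).ofReal (𝕜 := ℂ)))
  have h3 := integral_add i1 i2
  rw [Real.fourier_eq] at h1 h2 ⊢
  rw [show (∫ x : E n, Real.fourierChar (-inner ℝ x ξ) • (heatRadial s x : ℂ)) =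
    ((∫ x : E n, Real.fourierChar (-inner ℝ x ξ) • ((-n * heatKernel s x : ℝ) : ℂ)) +
      ∫ x : E n, Real.fourierChar (-inner ℝ x ξ) •
        ((1 / (2 * s) * (‖x‖ ^ 2 * heatKernel s x) : ℝ) : ℂ)) from ?_, h1, h2]
  · rw [← Complex.ofReal_mul, ← Complex.ofReal_mul, ← Complex.ofReal_add]
    congr 1
    field_simp
    ring
  · refine Eq.trans (integral_congr_ae (ae_of_all _ fun x => ?_)) h3
    simp only [e, Complex.ofReal_add, smul_add]
    rfl

/-- The heat kernel has mass `1` and second moment `2ns`, so the two terms contribute `n` each.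
Independence of `s` allows integration against any mixing measure. -/
lemma integral_abs_heatRadial_le {s : ℝ} (hs : 0 < s) :
    Integrable (heatRadial (n := n) s) ∧ ∫ x : E n, |heatRadial s x| ≤ 2 * n := by
  have i1 := (integrable_heatKernel (n := n) hs).const_mul (n : ℝ)
  have i2 := (integrable_sq_mul_heatKernel (n := n) hs).const_mul (1 / (2 * s))
  have i3 : Integrable (heatRadial (n := n) s) := i1.neg.add i2
  refine ⟨i3, ?_⟩
  calc ∫ x : E n, |heatRadial s x|
      ≤ ∫ x : E n, (n * heatKernel s x + 1 / (2 * s) * (‖x‖ ^ 2 * heatKernel s x)) := by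
        refine integral_mono i3.abs (i1.add i2) fun x => ?_
        have h0 := heatKernel_nonneg hs x
        refine (abs_add_le _ _).trans (le_of_eq ?_)
        rw [abs_neg, abs_of_nonneg (by positivity), abs_of_nonneg (by positivity)]
    _ = 2 * n := by
        rw [integral_add i1 i2, integral_const_mul, integral_const_mul, integral_heatKernel hs,
          integral_sq_mul_heatKernel hs]
        field_simp
        ring

/-- The Laplace transform of the mixing measure, as a function of the frequency. -/
noncomputable def laplaceSymbol (μ : Measure ℝ) (ξ : E n) : ℝ :=
  ∫ s, Real.exp (-(4 * Real.pi ^ 2 * ‖ξ‖ ^ 2 * s)) ∂μ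

lemma lintegral_mul_exp_neg_sq_le {a : ℝ} (ha : 0 < a) :
    ∫⁻ y in Ioi (0 : ℝ), ENNReal.ofReal (y * Real.exp (-(a * y ^ 2))) =
      ENNReal.ofReal (1 / (2 * a)) := by
  have hd : ∀ y ∈ Ici (0 : ℝ), HasDerivAt (fun y : ℝ => -(1 / (2 * a)) * Real.exp (-(a * y ^ 2)))
      (y * Real.exp (-(a * y ^ 2))) y := by
    intro y _
    have := (((hasDerivAt_pow 2 y).const_mul a).fun_neg.exp).const_mul (-(1 / (2 * a)))
    refine this.congr_deriv ?_
    field_simp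
    simp
  have hnn : ∀ y ∈ Ioi (0 : ℝ), 0 ≤ y * Real.exp (-(a * y ^ 2)) := fun y hy =>
    mul_nonneg (le_of_lt hy) (Real.exp_nonneg _)
  have hlim : Tendsto (fun y : ℝ => -(1 / (2 * a)) * Real.exp (-(a * y ^ 2))) atTop (𝓝 0) := by
    have h1 : Tendsto (fun y : ℝ => a * y ^ 2) atTop atTop :=
      (tendsto_pow_atTop two_ne_zero).const_mul_atTop ha
    have := (Real.tendsto_exp_neg_atTop_nhds_zero.comp h1).const_mul (-(1 / (2 * a)))
    simpa using this
  have hi := integrableOn_Ioi_deriv_of_nonneg' hd hnn hlim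
  rw [← ofReal_integral_eq_lintegral_ofReal hi
    ((ae_restrict_iff' measurableSet_Ioi).2 (ae_of_all _ hnn)),
    integral_Ioi_of_hasDerivAt_of_nonneg' hd hnn hlim]
  simp

namespace IsMixing

lemma integrable_heatKernel_prod (hμ : IsMixing γ μ) :
    Integrable (fun p : ℝ × E n => heatKernel p.1 p.2) (μ.prod volume) := by
  have := hμ.prob
  refine (integrable_prod_iff measurable_heatKernel_uncurry.aestronglyMeasurable).2 ⟨?_, ?_⟩
  · filter_upwards [hμ.pos] with s hs using integrable_heatKernel hs
  · refine (integrable_const (1 : ℝ)).congr ?_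
    filter_upwards [hμ.pos] with s hs
    have : ∀ x : E n, ‖heatKernel s x‖ = heatKernel s x := fun x =>
      Real.norm_of_nonneg (heatKernel_nonneg hs x)
    simp only [this, integral_heatKernel hs]

lemma integrable_heatRadial_prod (hμ : IsMixing γ μ) :
    Integrable (fun p : ℝ × E n => heatRadial p.1 p.2) (μ.prod volume) := by
  have := hμ.prob
  refine (integrable_prod_iff measurable_heatRadial_uncurry.aestronglyMeasurable).2 ⟨?_, ?_⟩
  · filter_upwards [hμ.pos] with s hs using (integral_abs_heatRadial_le hs).1
  · refine (integrable_const (2 * n : ℝ)).mono' ?_ ?_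
    · have := (measurable_heatRadial_uncurry (n := n)).norm.stronglyMeasurable.integral_prod_right'
        (ν := (volume : Measure (E n)))
      exact this.aestronglyMeasurable
    · filter_upwards [hμ.pos] with s hs
      rw [Real.norm_of_nonneg (integral_nonneg fun x => norm_nonneg _)]
      exact (integral_abs_heatRadial_le hs).2

lemma mixture_zero_eq (x : E n) : mixture μ 0 x = ∫ s, heatKernel s x ∂μ := rfl

lemma mixture_nonneg (hμ : IsMixing γ μ) (x : E n) : 0 ≤ mixture μ 0 x := by
  rw [mixture_zero_eq]
  refine integral_nonneg_of_ae ?_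
  filter_upwards [hμ.pos] with s hs using heatKernel_nonneg hs x

lemma radialProfile_eq (hμ : IsMixing γ μ) (x : E n) :
    radialProfile μ x = ∫ s, heatRadial s x ∂μ := by
  have h0 := hμ.integrable_mixture 0 x
  have h1 := hμ.integrable_mixture 1 x
  have e : ∀ s, heatRadial s x = -(n * (heatCoeff n 0 s * Real.exp (-(‖x‖ ^ 2 / (4 * s))))) -
      2 * (‖x‖ ^ 2 * (heatCoeff n 1 s * Real.exp (-(‖x‖ ^ 2 / (4 * s))))) := by
    intro s
    rw [heatRadial, heatKernel, heatCoeff_succ n 0 s]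
    rcases eq_or_ne s 0 with rfl | hs
    · simp
    · field_simp
      ring
  simp only [e]
  rw [integral_sub (h0.const_mul _).fun_neg ((h1.const_mul _).const_mul _), integral_neg,
    integral_const_mul, integral_const_mul, integral_const_mul, radialProfile, mixture, mixture]
  ring

lemma fourier_mixture (hμ : IsMixing γ μ) (ξ : E n) :
    𝓕 (fun x : E n => (mixture μ 0 x : ℂ)) ξ = (laplaceSymbol μ ξ : ℂ) := by
  have := hμ.prob
  simp only [mixture_zero_eq]
  rw [fourier_integral_eq hμ.integrable_heatKernel_prod, laplaceSymbol, ← integral_complex_ofReal]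
  refine integral_congr_ae ?_
  filter_upwards [hμ.pos] with s hs using fourier_heatKernel hs ξ

lemma integrable_mixture_zero (hμ : IsMixing γ μ) : Integrable (mixture μ 0 : E n → ℝ) := by
  have := hμ.prob
  exact hμ.integrable_heatKernel_prod.integral_prod_right

lemma fourier_radialProfile (hμ : IsMixing γ μ) (ξ : E n) :
    𝓕 (fun x : E n => (radialProfile μ x : ℂ)) ξ =
      ((-∫ s, 8 * Real.pi ^ 2 * ‖ξ‖ ^ 2 * s * Real.exp (-(4 * Real.pi ^ 2 * ‖ξ‖ ^ 2 * s)) ∂μ : ℝ) :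
        ℂ) := by
  have := hμ.prob
  simp only [hμ.radialProfile_eq]
  rw [fourier_integral_eq hμ.integrable_heatRadial_prod, ← integral_neg, ← integral_complex_ofReal]
  refine integral_congr_ae ?_
  filter_upwards [hμ.pos] with s hs using fourier_heatRadial hs ξ

/-- The tangential profile is the `i`-th partial derivative of the mixture, so its transform is `2πi
ξ_i` times the transform of the mixture; the decay of the mixture makes the derivative integrable.
-/
lemma fourier_tangentialProfile (hμ : IsMixing γ μ) (hγ : 0 < γ) (i : Fin n) (ξ : E n) :
    𝓕 (fun x : E n => (tangentialProfile μ i x : ℂ)) ξ =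
      2 * Real.pi * Complex.I * (ξ i : ℂ) * (laplaceSymbol μ ξ : ℂ) := by
  have hd : ∀ x : E n, HasFDerivAt (fun x : E n => (mixture μ 0 x : ℂ))
      (Complex.ofRealCLM ∘L ((2 * mixture μ 1 x) • innerSL ℝ x)) x := fun x =>
    Complex.ofRealCLM.hasFDerivAt.comp x (hμ.hasFDerivAt_mixture 0 x)
  have hd' : fderiv ℝ (fun x : E n => (mixture μ 0 x : ℂ)) =
      fun x => Complex.ofRealCLM ∘L ((2 * mixture μ 1 x) • innerSL ℝ x) :=
    funext fun x => (hd x).fderiv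
  have hint : Integrable (fderiv ℝ (fun x : E n => (mixture μ 0 x : ℂ))) := by
    rw [hd']
    obtain ⟨C, hC, h⟩ := hμ.abs_mixture_le (n := n) hγ 1
    have hb := (integrable_one_add_norm (E := E n) (μ := volume) (r := (n : ℝ) + γ)
      (by rw [finrank_euclideanSpace, Fintype.card_fin]; linarith)).const_mul (2 * C)
    refine hb.mono' ?_ (ae_of_all _ fun x => ?_)
    · have hm : Continuous (mixture μ 1 : E n → ℝ) := (hμ.contDiff_mixture 1).continuous
      refine Continuous.aestronglyMeasurable ?_
      exact continuous_const.clm_comp ((continuous_const.mul hm).smul (innerSL ℝ).continuous)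
    · refine (ContinuousLinearMap.opNorm_comp_le _ _).trans ?_
      rw [Complex.ofRealCLM_norm, one_mul, norm_smul, innerSL_apply_norm, norm_mul,
        Real.norm_eq_abs, Real.norm_eq_abs, abs_two]
      have h1 := norm_pow_mul_rpow_le 1 (c := (n : ℝ) + γ) (d := (n : ℝ) + γ + 2 * (1 : ℕ))
        (by push_cast; linarith) x
      calc 2 * |mixture μ 1 x| * ‖x‖
          ≤ 2 * (C * (1 + ‖x‖) ^ (-((n : ℝ) + γ + 2 * (1 : ℕ)))) * ‖x‖ := by
            gcongr
            exact h x
        _ = 2 * C * (‖x‖ ^ 1 * (1 + ‖x‖) ^ (-((n : ℝ) + γ + 2 * (1 : ℕ)))) := by ring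
        _ ≤ _ := by gcongr
  have h1 := Real.fourier_fderiv (hμ.integrable_mixture_zero (n := n)).ofReal
    (fun x => (hd x).differentiableAt) hint
  have h2 := Real.fourier_continuousLinearMap_apply (a := EuclideanSpace.single i (1 : ℝ)) (v := ξ) hint
  have h3 : (fun x : E n => (tangentialProfile μ i x : ℂ)) = fun x =>
      fderiv ℝ (fun x : E n => (mixture μ 0 x : ℂ)) x (EuclideanSpace.single i (1 : ℝ)) := by
    funext x
    rw [hd']
    simp [tangentialProfile, EuclideanSpace.inner_single_right]
    ring
  rw [h3, ← h2]
  have h4 := congrArg (fun F => F ξ (EuclideanSpace.single i (1 : ℝ))) h1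
  refine h4.trans ?_
  have h5 := hμ.fourier_mixture ξ
  simp only [VectorFourier.fourierSMulRight_apply]
  refine Eq.trans (congrArg (fun z => -(2 * Real.pi * Complex.I) •
    ((-innerSL ℝ) ξ (EuclideanSpace.single i (1 : ℝ)) • z)) h5) ?_
  simp [EuclideanSpace.inner_single_right]
  ring

end IsMixing

end MixtureFourier

/-! ### Uniform multiplier bounds and the operators generated by a mixture -/

section MixtureGeneratesCZ

open scoped FourierTransform

variable {n : ℕ} {γ γ' : ℝ} {μ : Measure ℝ}

lemma mul_exp_neg_le_one (t : ℝ) : t * Real.exp (-t) ≤ 1 := by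
  have h := (lt_add_one t).le.trans (Real.add_one_le_exp t)
  calc t * Real.exp (-t) ≤ Real.exp t * Real.exp (-t) := by gcongr
    _ = 1 := by rw [← Real.exp_add, add_neg_cancel, Real.exp_zero]

lemma norm_smul_sq {y : ℝ} (hy : 0 < y) (ξ : E n) : ‖y • ξ‖ ^ 2 = y ^ 2 * ‖ξ‖ ^ 2 := by
  rw [norm_smul, Real.norm_of_nonneg hy.le, mul_pow]

namespace IsMixing

/-- For `b > 0` the integral of `b y exp (-b s y²)` over the levels is `1/(2s)`, whatever `b` is.
With `b = 4π²|ξ|²` the frequency drops out and only a moment of `μ` remains. -/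
lemma lintegral_level_exp_le (hμ : IsMixing γ μ) {w : ℝ → ℝ} (hw : Measurable w)
    (hw0 : ∀ s, 0 < s → 0 ≤ w s) {b : ℝ} (hb : 0 ≤ b) :
    ∫⁻ y in Ioi (0 : ℝ), ∫⁻ s, ENNReal.ofReal (w s * (b * (y * Real.exp (-(b * s * y ^ 2))))) ∂μ ≤
      ∫⁻ s, ENNReal.ofReal (w s / (2 * s)) ∂μ := by
  have := hμ.prob
  rw [lintegral_lintegral_swap (by
    refine Measurable.aemeasurable ?_
    refine Measurable.ennreal_ofReal ?_
    exact (hw.comp measurable_snd).mul ((measurable_fst.mul (Real.measurable_exp.comp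
      ((measurable_snd.const_mul b).mul (measurable_fst.pow_const 2)).neg)).const_mul b))]
  refine lintegral_mono_ae ?_
  filter_upwards [hμ.pos] with s hs
  rcases hb.eq_or_lt with rfl | hb
  · simp
  have h1 : ∀ y : ℝ, ENNReal.ofReal (w s * (b * (y * Real.exp (-(b * s * y ^ 2))))) =
      ENNReal.ofReal (w s * b) * ENNReal.ofReal (y * Real.exp (-(b * s * y ^ 2))) := by
    intro y
    rw [← ENNReal.ofReal_mul (mul_nonneg (hw0 s hs) hb.le), mul_assoc (w s)]
  simp only [h1]
  rw [lintegral_const_mul' _ _ ENNReal.ofReal_ne_top, lintegral_mul_exp_neg_sq_le (by positivity),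
    ← ENNReal.ofReal_mul (mul_nonneg (hw0 s hs) hb.le)]
  refine ENNReal.ofReal_le_ofReal (le_of_eq ?_)
  field_simp

lemma laplaceSymbol_mem (hμ : IsMixing γ μ) (ξ : E n) :
    0 ≤ laplaceSymbol μ ξ ∧ laplaceSymbol μ ξ ≤ 1 := by
  have := hμ.prob
  refine ⟨integral_nonneg fun s => Real.exp_nonneg _, ?_⟩
  have := norm_integral_le_of_norm_le_const (μ := μ) (C := 1)
    (f := fun s => Real.exp (-(4 * Real.pi ^ 2 * ‖ξ‖ ^ 2 * s))) (by
      filter_upwards [hμ.pos] with s hs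
      rw [Real.norm_of_nonneg (Real.exp_nonneg _)]
      exact Real.exp_le_one_iff.2 (neg_nonpos.2 (by positivity)))
  simp only [probReal_univ, mul_one] at this
  exact (le_abs_self _).trans this

/-- The squared multiplier contains the Laplace symbol twice. Bounding one copy by `1` leaves an
expression linear in `μ`, to which `lintegral_level_exp_le` applies with `w = 1`; the constant is
the moment of `1/(2s)`. -/
lemma tangential_multiplier_le (hμ : IsMixing γ μ) (hγ : 0 < γ) (i : Fin n) :
    ∃ C : ℝ≥0, ∀ ξ : E n, ∫⁻ y in Ioi (0 : ℝ), ENNReal.ofReal y *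
      ‖𝓕 (fun x => (scaledProfile (tangentialProfile μ i) y x : ℂ)) ξ‖ₑ ^ 2 ≤ C := by
  have hfin : ∫⁻ s, ENNReal.ofReal (1 / (2 * s)) ∂μ ≠ ∞ := by
    have h1 : Integrable (fun s : ℝ => 1 / (2 * s)) μ := by
      refine ((hμ.moments 1 zero_le_one).const_mul (1 / 2)).congr ?_
      filter_upwards [hμ.pos] with s hs
      rw [Real.rpow_neg_one]
      field_simp
    exact (lt_of_le_of_lt (lintegral_ofReal_le_lintegral_enorm _) h1.2).ne
  refine ⟨(∫⁻ s, ENNReal.ofReal (1 / (2 * s)) ∂μ).toNNReal, fun ξ => ?_⟩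
  rw [ENNReal.coe_toNNReal hfin]
  refine le_trans ?_ (hμ.lintegral_level_exp_le (w := fun _ => 1) measurable_const
    (fun _ _ => zero_le_one) (b := 4 * Real.pi ^ 2 * ‖ξ‖ ^ 2) (by positivity))
  refine setLIntegral_mono' measurableSet_Ioi fun y hy => ?_
  have hy : 0 < y := hy
  obtain ⟨h0, h1⟩ := hμ.laplaceSymbol_mem (y • ξ)
  have hξ : |ξ i| ≤ ‖ξ‖ := PiLp.norm_apply_le ξ i
  have e1 : ‖𝓕 (fun x => (scaledProfile (tangentialProfile μ i) y x : ℂ)) ξ‖ =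
      2 * Real.pi * |ξ i| * laplaceSymbol μ (y • ξ) := by
    rw [fourier_scaledProfile _ hy, hμ.fourier_tangentialProfile hγ]
    simp only [norm_mul, Complex.norm_real, Complex.norm_I, PiLp.smul_apply, smul_eq_mul,
      Complex.ofReal_mul, Real.norm_of_nonneg h0, Real.norm_of_nonneg Real.pi_pos.le,
      Real.norm_of_nonneg hy.le, Real.norm_of_nonneg (inv_nonneg.2 hy.le), Complex.norm_ofNat,
      Real.norm_eq_abs (ξ i)]
    field_simp
  have hpi := Real.pi_pos
  rw [← ofReal_norm, e1, ← ENNReal.ofReal_pow (by positivity), ← ENNReal.ofReal_mul hy.le]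
  calc ENNReal.ofReal (y * (2 * Real.pi * |ξ i| * laplaceSymbol μ (y • ξ)) ^ 2)
      ≤ ENNReal.ofReal (4 * Real.pi ^ 2 * ‖ξ‖ ^ 2 * y) * ENNReal.ofReal (laplaceSymbol μ (y • ξ)) := by
        rw [← ENNReal.ofReal_mul (by positivity)]
        refine ENNReal.ofReal_le_ofReal ?_
        calc y * (2 * Real.pi * |ξ i| * laplaceSymbol μ (y • ξ)) ^ 2
            = 4 * Real.pi ^ 2 * |ξ i| ^ 2 * y *
              (laplaceSymbol μ (y • ξ) * laplaceSymbol μ (y • ξ)) := by ring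
          _ ≤ 4 * Real.pi ^ 2 * ‖ξ‖ ^ 2 * y * (laplaceSymbol μ (y • ξ) * 1) := by gcongr
          _ = _ := by ring
    _ ≤ ENNReal.ofReal (4 * Real.pi ^ 2 * ‖ξ‖ ^ 2 * y) *
        ∫⁻ s, ENNReal.ofReal (Real.exp (-(4 * Real.pi ^ 2 * ‖y • ξ‖ ^ 2 * s))) ∂μ := by
        gcongr
        have := enorm_integral_le_lintegral_enorm (μ := μ)
            (fun s => Real.exp (-(4 * Real.pi ^ 2 * ‖y • ξ‖ ^ 2 * s)))
        simp only [← ofReal_norm, Real.norm_eq_abs, Real.abs_exp] at this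
        refine le_trans (ENNReal.ofReal_le_ofReal (le_abs_self _)) this
    _ = _ := by
        rw [← lintegral_const_mul' _ _ ENNReal.ofReal_ne_top]
        refine lintegral_congr fun s => ?_
        rw [← ENNReal.ofReal_mul (by positivity), norm_smul_sq hy]
        congr 1
        rw [show 4 * Real.pi ^ 2 * (y ^ 2 * ‖ξ‖ ^ 2) * s = 4 * Real.pi ^ 2 * ‖ξ‖ ^ 2 * s * y ^ 2 by ring]
        ring

/-- Since `t exp (-t) ≤ 1`, the factor `N` in the multiplier is at most `2`, so `N² ≤ 2N` is linear
in `μ`. The choice `w s = 4 s` cancels `1/(2s)` and leaves the constant `2`. -/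
lemma radial_multiplier_le (hμ : IsMixing γ μ) (ξ : E n) :
    ∫⁻ y in Ioi (0 : ℝ), ENNReal.ofReal y *
      ‖𝓕 (fun x => (scaledProfile (radialProfile μ) y x : ℂ)) ξ‖ₑ ^ 2 ≤ (2 : ℝ≥0) := by
  have := hμ.prob
  have hfin : ∫⁻ s, ENNReal.ofReal (4 * s / (2 * s)) ∂μ = 2 := by
    calc ∫⁻ s, ENNReal.ofReal (4 * s / (2 * s)) ∂μ = ∫⁻ _, 2 ∂μ := by
          refine lintegral_congr_ae ?_
          filter_upwards [hμ.pos] with s hs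
          rw [show 4 * s / (2 * s) = 2 by field_simp; norm_num]
          simp
      _ = 2 := by simp
  have h := hμ.lintegral_level_exp_le (w := fun s => 4 * s) (measurable_id.const_mul 4)
    (fun s hs => by positivity) (b := 4 * Real.pi ^ 2 * ‖ξ‖ ^ 2) (by positivity)
  rw [hfin] at h
  refine le_trans ?_ h
  refine setLIntegral_mono' measurableSet_Ioi fun y hy => ?_
  have hy : 0 < y := hy
  set N : ℝ := ∫ s, 8 * Real.pi ^ 2 * ‖y • ξ‖ ^ 2 * s *
    Real.exp (-(4 * Real.pi ^ 2 * ‖y • ξ‖ ^ 2 * s)) ∂μ with hN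
  have hN0 : 0 ≤ N := by
    refine integral_nonneg_of_ae ?_
    filter_upwards [hμ.pos] with s hs
    simp only [Pi.zero_apply]
    positivity
  have hN2 : N ≤ 2 := by
    have h2 := norm_integral_le_of_norm_le_const (μ := μ) (C := 2)
      (f := fun s => 8 * Real.pi ^ 2 * ‖y • ξ‖ ^ 2 * s *
        Real.exp (-(4 * Real.pi ^ 2 * ‖y • ξ‖ ^ 2 * s))) (by
        filter_upwards [hμ.pos] with s hs
        rw [Real.norm_of_nonneg (by positivity)]
        have := mul_exp_neg_le_one (4 * Real.pi ^ 2 * ‖y • ξ‖ ^ 2 * s)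
        linarith)
    simp only [probReal_univ, mul_one] at h2
    exact (le_abs_self _).trans h2
  have e1 : ‖𝓕 (fun x => (scaledProfile (radialProfile μ) y x : ℂ)) ξ‖ = y⁻¹ * N := by
    rw [fourier_scaledProfile _ hy, hμ.fourier_radialProfile, ← hN, norm_mul, Complex.norm_real,
      Complex.norm_real, norm_neg, Real.norm_of_nonneg hN0, Real.norm_of_nonneg (by positivity)]
  rw [← ofReal_norm, e1, ← ENNReal.ofReal_pow (by positivity), ← ENNReal.ofReal_mul hy.le]
  calc ENNReal.ofReal (y * (y⁻¹ * N) ^ 2)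
      ≤ ENNReal.ofReal (2 * y⁻¹) * ENNReal.ofReal N := by
        rw [← ENNReal.ofReal_mul (by positivity)]
        refine ENNReal.ofReal_le_ofReal ?_
        calc y * (y⁻¹ * N) ^ 2 = y⁻¹ * (N * N) := by field_simp
          _ ≤ y⁻¹ * (2 * N) := by gcongr
          _ = _ := by ring
    _ ≤ ENNReal.ofReal (2 * y⁻¹) * ∫⁻ s, ENNReal.ofReal |8 * Real.pi ^ 2 * ‖y • ξ‖ ^ 2 * s *
          Real.exp (-(4 * Real.pi ^ 2 * ‖y • ξ‖ ^ 2 * s))| ∂μ := by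
        gcongr
        have := enorm_integral_le_lintegral_enorm (μ := μ)
            (fun s => 8 * Real.pi ^ 2 * ‖y • ξ‖ ^ 2 * s *
              Real.exp (-(4 * Real.pi ^ 2 * ‖y • ξ‖ ^ 2 * s)))
        simp only [← ofReal_norm, Real.norm_eq_abs] at this
        refine le_trans (ENNReal.ofReal_le_ofReal (le_abs_self _)) this
    _ = _ := by
        rw [← lintegral_const_mul' _ _ ENNReal.ofReal_ne_top]
        refine lintegral_congr_ae ?_
        filter_upwards [hμ.pos] with s hs
        rw [abs_of_nonneg (by positivity), ← ENNReal.ofReal_mul (by positivity), norm_smul_sq hy]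
        congr 1
        rw [show 4 * Real.pi ^ 2 * (y ^ 2 * ‖ξ‖ ^ 2) * s = 4 * Real.pi ^ 2 * ‖ξ‖ ^ 2 * s * y ^ 2 by ring]
        field_simp
        ring

lemma _root_.isProfile_scaledProfile {ψ : E n → ℝ} (hγ' : 0 < γ') (hψ : ContDiff ℝ 1 ψ) {C : ℝ} (hC : 0 ≤ C)
    (h0 : ∀ x, |ψ x| ≤ C * (1 + ‖x‖) ^ (-((n : ℝ) + γ')))
    (h1 : ∀ x, ‖fderiv ℝ ψ x‖ ≤ C * (1 + ‖x‖) ^ (-((n : ℝ) + 1 + γ')))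
    (hz : 𝓕 (fun x => (ψ x : ℂ)) 0 = 0)
    (hsq : ∃ C : ℝ≥0, ∀ ξ : E n, ∫⁻ y in Ioi (0 : ℝ), ENNReal.ofReal y *
      ‖𝓕 (fun x => (scaledProfile ψ y x : ℂ)) ξ‖ₑ ^ 2 ≤ C) :
    IsProfile γ' (scaledProfile ψ) := by
  have hm := measurable_scaledProfile hψ.continuous.measurable
  have hb : ∀ x, |ψ x| ≤ C := fun x => (h0 x).trans (mul_le_of_le_one_right hC
    (Real.rpow_le_one_of_one_le_of_nonpos (by linarith [norm_nonneg x])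
      (neg_nonpos.2 (by positivity))))
  have hint : Integrable ψ := by
    refine ((integrable_one_add_norm (E := E n) (μ := volume) (r := (n : ℝ) + γ')
      (by rw [finrank_euclideanSpace, Fintype.card_fin]; linarith)).const_mul C).mono'
      hψ.continuous.aestronglyMeasurable (ae_of_all _ h0)
  have hintY : ∀ y, 0 < y → Integrable (scaledProfile ψ y) := fun y hy =>
    (hint.comp_smul (inv_ne_zero hy.ne')).const_mul _
  refine ⟨hm, fun y _ => contDiff_scaledProfile hψ y,
    ⟨C, hC, fun y hy x => scaledProfile_bound hψ h0 h1 hy x⟩, fun y hy => ?_, ?_⟩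
  · have h := fourier_scaledProfile ψ hy 0
    rw [smul_zero, hz, mul_zero] at h
    exact integral_eq_of_fourier_zero (f := scaledProfile ψ y) (c := 0) (by rw [h]; simp)
  · obtain ⟨D, hD⟩ := hsq
    refine ⟨D, fun f _ hf hf2 => square_function_of_multiplier hm hintY (fun y hy =>
      ⟨(y ^ (n + 1))⁻¹ * C, fun x => ?_⟩) hD hf hf2⟩
    rw [scaledProfile, abs_mul, abs_of_pos (by positivity)]
    gcongr
    exact hb _

/-- The profiles of the full gradient of a dilated Gaussian mixture. -/
noncomputable def _root_.gradientProfile (μ : Measure ℝ) : Fin (n + 1) → E n → ℝ :=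
  Fin.snoc (α := fun _ => E n → ℝ) (fun i => tangentialProfile μ i) (radialProfile μ)

theorem generatesCZ {𝕜 : Type*} [RCLike 𝕜] (hμ : IsMixing γ μ) (hγ : 0 < γ) (hn : 1 ≤ n)
    {A : E n → ℝ → Matrix (Fin (n + 1)) (Fin (n + 1)) 𝕜} (hA : IsAdmissible A) :
    GeneratesCZ (mixture μ 0) A := by
  -- Pointwise convergence uses Hölder continuity of order `γ'/2`, which must not exceed one;
  -- lowering the exponent only weakens the decay bounds.
  set γ' := min γ 1 with hγ'
  have hγ0 : 0 < γ' := lt_min hγ one_pos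
  have hle : γ' ≤ γ := min_le_left _ _
  refine generatesCZ_of_profiles (Ψ := fun i => scaledProfile (gradientProfile μ i)) hγ0
    (min_le_right _ _) hn ?_ ?_ ?_ hA
  · intro y hy x i
    refine Fin.lastCases ?_ (fun i => ?_) i
    · rw [gradientProfile, Fin.snoc_last]
      exact hμ.fullGrad_last hy x
    · rw [gradientProfile, Fin.snoc_castSucc]
      exact hμ.fullGrad_castSucc hy x i
  · intro i
    refine Fin.lastCases ?_ (fun i => ?_) i
    · rw [gradientProfile, Fin.snoc_last]
      obtain ⟨C, hC, h⟩ := hμ.radialProfile_bound (n := n) hγ0 hle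
      refine isProfile_scaledProfile hγ0 (hμ.contDiff_radialProfile) hC
        (fun x => (h x).1) (fun x => (h x).2) ?_ ⟨2, hμ.radial_multiplier_le⟩
      rw [hμ.fourier_radialProfile]
      simp
    · rw [gradientProfile, Fin.snoc_castSucc]
      obtain ⟨C, hC, h⟩ := hμ.tangentialProfile_bound hγ0 hle i
      refine isProfile_scaledProfile hγ0 (hμ.contDiff_tangentialProfile i) hC
        (fun x => (h x).1.trans ?_) (fun x => (h x).2) ?_ (hμ.tangential_multiplier_le hγ i)
      · gcongr
        · linarith [norm_nonneg x]
        · linarith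
      · rw [hμ.fourier_tangentialProfile hγ]
        simp
  · intro i hi
    induction i using Fin.lastCases with
    | last => exact absurd rfl hi
    | cast i =>
      rw [gradientProfile, Fin.snoc_castSucc]
      obtain ⟨C, hC, h⟩ := hμ.tangentialProfile_bound hγ0 hle i
      refine ⟨C, hC, fun y hy x => ?_⟩
      have e2 : ‖y⁻¹ • x‖ = ‖x‖ / y := by
        rw [norm_smul, norm_inv, Real.norm_eq_abs, abs_of_pos hy]
        ring
      have h2 := (h (y⁻¹ • x)).1
      rw [e2] at h2
      have e1 : (y ^ (n + 1))⁻¹ = y * y ^ (-((n : ℝ) + 1) - 1) := by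
        rw [show -((n : ℝ) + 1) - 1 = -1 + -((n + 1 : ℕ) : ℝ) by push_cast; ring,
          Real.rpow_add hy, Real.rpow_neg hy.le, Real.rpow_neg hy.le, Real.rpow_natCast,
          Real.rpow_one, ← mul_assoc, mul_inv_cancel₀ hy.ne', one_mul]
      rw [scaledProfile, abs_mul, abs_of_pos (by positivity), levelWeight_eq hy (norm_nonneg x), e1]
      calc _ ≤ y * y ^ (-((n : ℝ) + 1) - 1) * (C * (1 + ‖x‖ / y) ^ (-((n : ℝ) + 1 + γ'))) := by gcongr
        _ = _ := by ring

end IsMixing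

end MixtureGeneratesCZ

/-! ### Subordination -/

section Subordination

variable {Ω : Type*} [MeasurableSpace Ω] {P : Measure Ω} {n : ℕ}
  {B : ℝ≥0 → Ω → E n} {T : ℝ≥0 → Ω → ℝ}

lemma IsSubordinator.nonneg (hT : IsSubordinator T P) (t : ℝ≥0) : ∀ᵐ ω ∂P, 0 ≤ T t ω := by
  filter_upwards [hT.monotone_paths, hT.zero] with ω h1 h2
  rw [← h2]
  exact h1 t.2

/-- Approximation of a nonnegative real from above by multiples of `1 / (k + 1)`. -/
noncomputable def gridTime (k : ℕ) (u : ℝ) : ℝ≥0 := (⌈u * ((k : ℝ) + 1)⌉₊ : ℝ≥0) / ((k : ℝ≥0) + 1)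

lemma tendsto_gridTime {u : ℝ} (hu : 0 ≤ u) :
    Tendsto (fun k => gridTime k u) atTop (𝓝 u.toNNReal) := by
  rw [← NNReal.tendsto_coe, Real.coe_toNNReal u hu]
  have h : Tendsto (fun k : ℕ => (k : ℝ) + 1) atTop atTop :=
    tendsto_atTop_add_const_right _ _ tendsto_natCast_atTop_atTop
  have := (tendsto_nat_ceil_mul_div_atTop hu).comp h
  refine this.congr fun k => ?_
  simp [gridTime]

/-- Evaluating a path at a variable time is not measurable on the full product space in general, but
it is when the time takes countably many values. This is the reason for discretizing the
subordinator. -/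
lemma measurable_eval_gridTime (k : ℕ) (t : ℝ≥0) :
    Measurable fun p : (ℝ≥0 → E n) × (ℝ≥0 → ℝ) => p.1 (gridTime k (p.2 t)) := by
  have h1 : Measurable fun q : ℕ × (ℝ≥0 → E n) => q.2 ((q.1 : ℝ≥0) / ((k : ℝ≥0) + 1)) :=
    measurable_from_prod_countable_right fun j =>
      show Measurable fun b : ℝ≥0 → E n => b ((j : ℝ≥0) / ((k : ℝ≥0) + 1)) from
        measurable_pi_apply _
  have h2 : Measurable fun p : (ℝ≥0 → E n) × (ℝ≥0 → ℝ) => ⌈p.2 t * ((k : ℝ) + 1)⌉₊ :=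
    Nat.measurable_ceil.comp (((measurable_pi_apply t).comp measurable_snd).mul_const _)
  exact h1.comp (h2.prodMk measurable_fst)

lemma measurable_gridTime (k : ℕ) : Measurable (gridTime k) := by
  have : Measurable fun j : ℕ => (j : ℝ≥0) / ((k : ℝ≥0) + 1) := measurable_from_top
  exact this.comp (Nat.measurable_ceil.comp (measurable_id.mul_const _))

lemma measurable_subordinate_grid (hB : IsDoubleSpeedBrownianMotion B P) (hT : IsSubordinator T P)
    (k : ℕ) (t : ℝ≥0) : Measurable fun ω => B (gridTime k (T t ω)) ω :=
  (measurable_eval_gridTime k t).comp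
    ((measurable_pi_iff.2 hB.measurable).prodMk (measurable_pi_iff.2 hT.measurable))

lemma tendsto_subordinate_grid (hB : IsDoubleSpeedBrownianMotion B P) (hT : IsSubordinator T P)
    (t : ℝ≥0) :
    ∀ᵐ ω ∂P, Tendsto (fun k => B (gridTime k (T t ω)) ω) atTop (𝓝 (subordinate B T t ω)) := by
  filter_upwards [hB.continuous_paths, hT.nonneg t] with ω h1 h2
  exact (h1.tendsto _).comp (tendsto_gridTime h2)

lemma aemeasurable_subordinate (hB : IsDoubleSpeedBrownianMotion B P) (hT : IsSubordinator T P)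
    (t : ℝ≥0) : AEMeasurable (subordinate B T t) P :=
  aemeasurable_of_tendsto_metrizable_ae atTop
    (fun k => (measurable_subordinate_grid hB hT k t).aemeasurable)
    (tendsto_subordinate_grid hB hT t)

variable [IsProbabilityMeasure P]

/-- Independence makes the joint law on the two path spaces a product, so the Brownian path can be
integrated first, with the time frozen. -/
lemma integral_exp_subordinate_grid (hB : IsDoubleSpeedBrownianMotion B P)
    (hT : IsSubordinator T P) (hBT : IndepFun (fun ω t => B t ω) (fun ω t => T t ω) P)
    (k : ℕ) (t : ℝ≥0) (ξ : E n) :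
    ∫ ω, Complex.exp ((inner ℝ (B (gridTime k (T t ω)) ω) ξ : ℝ) * Complex.I) ∂P =
      ∫ ω, Complex.exp (-(((gridTime k (T t ω) : ℝ≥0) : ℝ) * ‖ξ‖ ^ 2 : ℝ)) ∂P := by
  have hBm : Measurable fun ω t => B t ω := measurable_pi_iff.2 hB.measurable
  have hTm : Measurable fun ω t => T t ω := measurable_pi_iff.2 hT.measurable
  have hPB : IsProbabilityMeasure (P.map fun ω t => B t ω) :=
    Measure.isProbabilityMeasure_map hBm.aemeasurable
  have hPT : IsProbabilityMeasure (P.map fun ω t => T t ω) :=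
    Measure.isProbabilityMeasure_map hTm.aemeasurable
  set F : (ℝ≥0 → E n) × (ℝ≥0 → ℝ) → ℂ := fun p =>
    Complex.exp ((inner ℝ (p.1 (gridTime k (p.2 t))) ξ : ℝ) * Complex.I) with hF
  have hFm : Measurable F := by
    have h1 : Measurable fun x : E n => Complex.exp ((inner ℝ x ξ : ℝ) * Complex.I) := by
      have : Continuous fun x : E n => Complex.exp ((inner ℝ x ξ : ℝ) * Complex.I) := by fun_prop
      exact this.measurable
    exact h1.comp (measurable_eval_gridTime k t)
  have hFb : ∀ p, ‖F p‖ ≤ 1 := fun p => (Complex.norm_exp_ofReal_mul_I _).le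
  have hFi : Integrable F ((P.map fun ω t => B t ω).prod (P.map fun ω t => T t ω)) :=
    (integrable_const (1 : ℝ)).mono' hFm.aestronglyMeasurable (ae_of_all _ hFb)
  calc ∫ ω, Complex.exp ((inner ℝ (B (gridTime k (T t ω)) ω) ξ : ℝ) * Complex.I) ∂P
      = ∫ ω, F ((fun t => B t ω), (fun t => T t ω)) ∂P := rfl
    _ = ∫ p, F p ∂(P.map fun ω => ((fun t => B t ω), (fun t => T t ω))) :=
        (integral_map (hBm.prodMk hTm).aemeasurable hFm.aestronglyMeasurable).symm
    _ = ∫ p, F p ∂((P.map fun ω t => B t ω).prod (P.map fun ω t => T t ω)) := by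
        rw [(indepFun_iff_map_prod_eq_prod_map_map hBm.aemeasurable hTm.aemeasurable).1 hBT]
    _ = ∫ θ, ∫ b, F (b, θ) ∂(P.map fun ω t => B t ω) ∂(P.map fun ω t => T t ω) :=
        integral_prod_symm F hFi
    _ = ∫ θ : ℝ≥0 → ℝ, Complex.exp (-(((gridTime k (θ t) : ℝ≥0) : ℝ) * ‖ξ‖ ^ 2 : ℝ))
          ∂(P.map fun ω t => T t ω) := by
        refine integral_congr_ae (ae_of_all _ fun θ => ?_)
        simp only [hF]
        rw [← hB.charFun_eq (gridTime k (θ t)) ξ, charFun_apply,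
          integral_map (hB.measurable _).aemeasurable (by fun_prop),
          integral_map hBm.aemeasurable]
        refine Measurable.aestronglyMeasurable ?_
        have h1 : Continuous fun x : E n => Complex.exp ((inner ℝ x ξ : ℝ) * Complex.I) := by
          fun_prop
        exact h1.measurable.comp (measurable_pi_apply _)
    _ = _ := by
        rw [integral_map hTm.aemeasurable]
        refine Measurable.aestronglyMeasurable ?_
        have h1 : Continuous fun u : ℝ≥0 => Complex.exp (-(((u : ℝ≥0) : ℝ) * ‖ξ‖ ^ 2 : ℝ)) := by
          fun_prop
        exact h1.measurable.comp ((measurable_gridTime k).comp (measurable_pi_apply t))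

/-- The characteristic function of a subordinate Brownian motion. -/
lemma charFun_subordinate (hB : IsDoubleSpeedBrownianMotion B P)
    (hT : IsSubordinator T P) (hBT : IndepFun (fun ω t => B t ω) (fun ω t => T t ω) P)
    (t : ℝ≥0) (ξ : E n) :
    charFun (P.map (subordinate B T t)) ξ = ((∫ ω, Real.exp (-‖ξ‖ ^ 2 * T t ω) ∂P : ℝ) : ℂ) := by
  rw [charFun_apply, integral_map (aemeasurable_subordinate hB hT t) (by fun_prop)]
  have hcont : Continuous fun x : E n => Complex.exp ((inner ℝ x ξ : ℝ) * Complex.I) := by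
    fun_prop
  have h1 : Tendsto (fun k => ∫ ω, Complex.exp ((inner ℝ (B (gridTime k (T t ω)) ω) ξ : ℝ) *
      Complex.I) ∂P) atTop
      (𝓝 (∫ ω, Complex.exp ((inner ℝ (subordinate B T t ω) ξ : ℝ) * Complex.I) ∂P)) := by
    refine tendsto_integral_of_dominated_convergence (fun _ => 1)
      (fun k => (hcont.measurable.comp (measurable_subordinate_grid hB hT k t)).aestronglyMeasurable)
      (integrable_const _) (fun k => ae_of_all _ fun ω => (Complex.norm_exp_ofReal_mul_I _).le) ?_
    filter_upwards [tendsto_subordinate_grid hB hT t] with ω hω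
    exact (hcont.tendsto _).comp hω
  have hcont2 : Continuous fun u : ℝ≥0 => Complex.exp (-((u : ℝ) * ‖ξ‖ ^ 2 : ℝ)) := by fun_prop
  have h2 : Tendsto (fun k => ∫ ω, Complex.exp (-(((gridTime k (T t ω) : ℝ≥0) : ℝ) *
      ‖ξ‖ ^ 2 : ℝ)) ∂P) atTop (𝓝 (∫ ω, ((Real.exp (-‖ξ‖ ^ 2 * T t ω) : ℝ) : ℂ) ∂P)) := by
    refine tendsto_integral_of_dominated_convergence (fun _ => 1)
      (fun k => (hcont2.measurable.comp
        ((measurable_gridTime k).comp (hT.measurable t))).aestronglyMeasurable)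
      (integrable_const _) (fun k => ae_of_all _ fun ω => ?_) ?_
    · rw [← Complex.ofReal_neg, ← Complex.ofReal_exp, Complex.norm_real,
        Real.norm_of_nonneg (Real.exp_nonneg _)]
      exact Real.exp_le_one_iff.2 (neg_nonpos.2 (by positivity))
    · filter_upwards [hT.nonneg t] with ω hω
      have := (hcont2.tendsto _).comp (tendsto_gridTime hω)
      refine this.trans (le_of_eq ?_)
      rw [Real.coe_toNNReal _ hω, Complex.ofReal_exp]
      congr 2
      push_cast
      ring
  rw [← integral_complex_ofReal]
  exact tendsto_nhds_unique h1 (h2.congr fun k =>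
    (integral_exp_subordinate_grid hB hT hBT k t ξ).symm)

open scoped FourierTransform in
/-- The subordinate Brownian motion at time one has a Gaussian mixture as its density. -/
lemma isSmoothDensity_mixture (hB : IsDoubleSpeedBrownianMotion B P)
    (hT : IsSubordinator T P) (hBT : IndepFun (fun ω t => B t ω) (fun ω t => T t ω) P)
    {γ : ℝ} (hμ : IsMixing γ (P.map (T 1))) :
    IsSmoothDensity (mixture (P.map (T 1)) 0) (subordinate B T 1) P := by
  set μ := P.map (T 1) with hμdef
  refine ⟨hμ.contDiff_mixture 0, hμ.mixture_nonneg, ?_⟩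
  have hint := hμ.integrable_mixture_zero (n := n)
  have hfin : IsFiniteMeasure ((volume : Measure (E n)).withDensity
      fun x => ENNReal.ofReal (mixture μ 0 x)) :=
    isFiniteMeasure_withDensity_ofReal hint.2
  have hX := aemeasurable_subordinate hB hT 1
  have hXp : IsProbabilityMeasure (P.map (subordinate B T 1)) :=
    Measure.isProbabilityMeasure_map hX
  refine Measure.ext_of_charFun ?_
  funext ξ
  have hm : Measurable (mixture μ 0 : E n → ℝ) := (hμ.contDiff_mixture 0).continuous.measurable
  rw [charFun_subordinate hB hT hBT, charFun_apply,
    integral_withDensity_eq_integral_toReal_smul hm.ennreal_ofReal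
      (ae_of_all _ fun x => ENNReal.ofReal_lt_top)]
  -- The Fourier transform uses the character `exp (-2πi x · η)`, so the characteristic function at
  -- `ξ` corresponds to `η = -ξ/(2π)`, for which `4π²|η|² = |ξ|²`.
  have h1 := hμ.fourier_mixture (n := n) ((-(2 * Real.pi)⁻¹ : ℝ) • ξ)
  have hpi := Real.pi_pos
  rw [laplaceSymbol, norm_smul, norm_neg, Real.norm_of_nonneg (by positivity), hμdef,
    integral_map (hT.measurable 1).aemeasurable (by fun_prop)] at h1
  have h2 : ∀ ω, Real.exp (-(4 * Real.pi ^ 2 * ((2 * Real.pi)⁻¹ * ‖ξ‖) ^ 2 * T 1 ω)) =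
      Real.exp (-‖ξ‖ ^ 2 * T 1 ω) := by
    intro ω
    congr 1
    field_simp
    ring
  simp only [h2] at h1
  rw [← h1, Real.fourier_eq']
  refine integral_congr_ae (ae_of_all _ fun x => ?_)
  simp only [ENNReal.toReal_ofReal (hμ.mixture_nonneg x), inner_smul_right, smul_eq_mul]
  rw [Complex.real_smul, mul_comm]
  congr 3
  push_cast
  field_simp

end Subordination

/-! ### Rapidly decreasing Laplace transforms -/

section LaplaceDecay

lemma exists_exp_neg_rpow_le {c δ N : ℝ} (hc : 0 < c) (hδ : 0 < δ) (hN : 0 < N) :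
    ∃ C, 0 ≤ C ∧ ∀ l : ℝ, 0 < l → Real.exp (-(c * l ^ δ)) ≤ C * l ^ (-N) := by
  obtain ⟨C, hC, h⟩ := exists_exp_neg_le (N / δ) (by positivity)
  refine ⟨C * (4 * c) ^ (-(N / δ)), by positivity, fun l hl => ?_⟩
  have hu : 0 < 4 * c * l ^ δ := by positivity
  have h1 := h (4 * c * l ^ δ) hu.le
  rw [show 4 * c * l ^ δ / 4 = c * l ^ δ by ring] at h1
  calc Real.exp (-(c * l ^ δ)) ≤ C * (1 + 4 * c * l ^ δ) ^ (-(N / δ)) := h1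
    _ ≤ C * (4 * c * l ^ δ) ^ (-(N / δ)) := by
        gcongr ?_ * ?_
        exact Real.rpow_le_rpow_of_nonpos hu (by linarith) (neg_nonpos.2 (by positivity))
    _ = C * (4 * c) ^ (-(N / δ)) * l ^ (-N) := by
        rw [Real.mul_rpow (by positivity) (by positivity), ← Real.rpow_mul hl.le,
          show δ * -(N / δ) = -N by field_simp]
        ring

/-- The Laplace transform of `μ` is rapidly decreasing. -/
def HasRapidLaplaceDecay (μ : Measure ℝ) : Prop :=
  ∀ N : ℝ, 0 < N → ∃ C, 0 ≤ C ∧ ∀ l : ℝ, 1 ≤ l → ∫ s, Real.exp (-l * s) ∂μ ≤ C * l ^ (-N)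

variable {μ : Measure ℝ} [IsProbabilityMeasure μ]

lemma integral_exp_neg_mem (h0 : ∀ᵐ s ∂μ, 0 ≤ s) {l : ℝ} (hl : 0 ≤ l) :
    Integrable (fun s => Real.exp (-l * s)) μ ∧ 0 < ∫ s, Real.exp (-l * s) ∂μ ∧
      ∫ s, Real.exp (-l * s) ∂μ ≤ 1 := by
  have hb : ∀ᵐ s ∂μ, ‖Real.exp (-l * s)‖ ≤ 1 := by
    filter_upwards [h0] with s hs
    rw [Real.norm_of_nonneg (Real.exp_nonneg _)]
    exact Real.exp_le_one_iff.2 (by nlinarith)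
  have hi : Integrable (fun s => Real.exp (-l * s)) μ :=
    (integrable_const (1 : ℝ)).mono' (by fun_prop) hb
  refine ⟨hi, integral_exp_pos hi, ?_⟩
  have := norm_integral_le_of_norm_le_const hb
  simp only [probReal_univ, mul_one] at this
  exact (le_abs_self _).trans this

lemma ofReal_rpow_neg_eq_lintegral {a s : ℝ} (ha : 0 < a) (hs : 0 < s) :
    ENNReal.ofReal (s ^ (-a)) = ENNReal.ofReal (1 / Real.Gamma a) *
      ∫⁻ l in Ioi (0 : ℝ), ENNReal.ofReal (l ^ (a - 1) * Real.exp (-l * s)) := by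
  have h := Real.integral_rpow_mul_exp_neg_mul_Ioi ha hs
  have hG := Real.Gamma_pos_of_pos ha
  have hpos : 0 < (1 / s) ^ a * Real.Gamma a := by positivity
  have hi : IntegrableOn (fun l : ℝ => l ^ (a - 1) * Real.exp (-(s * l))) (Ioi 0) := by
    by_contra hcon
    rw [integral_undef hcon] at h
    exact hpos.ne h
  have e : ∀ l : ℝ, l ^ (a - 1) * Real.exp (-l * s) = l ^ (a - 1) * Real.exp (-(s * l)) := by
    intro l
    congr 2
    ring
  simp only [e]
  rw [← ofReal_integral_eq_lintegral_ofReal hi, h, ← ENNReal.ofReal_mul (by positivity)]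
  · congr 1
    rw [one_div, one_div, Real.inv_rpow hs.le, Real.rpow_neg hs.le]
    field_simp
  · filter_upwards [ae_restrict_mem measurableSet_Ioi] with l hl
    exact mul_nonneg (Real.rpow_nonneg (le_of_lt hl) _) (Real.exp_nonneg _)

/-- Writing `s^(-a)` as a Gamma integral of `exp (-l s)` reduces the moment to the integral of
`l^(a-1)` times the Laplace transform. Near zero the transform is at most `1`; at infinity decay of
order `a + 1` leaves `l^(-2)`. -/
lemma integrable_rpow_neg_of_decay (hpos : ∀ᵐ s ∂μ, 0 < s) (hL : HasRapidLaplaceDecay μ) {a : ℝ}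
    (ha : 0 ≤ a) : Integrable (fun s => s ^ (-a)) μ := by
  rcases ha.eq_or_lt with rfl | ha
  · simp
  refine ⟨(measurable_id.pow_const _).aestronglyMeasurable, ?_⟩
  have h0 : ∀ᵐ s ∂μ, 0 ≤ s := hpos.mono fun s hs => hs.le
  obtain ⟨C, hC, hd⟩ := hL (a + 1) (by positivity)
  have h1 : ∫⁻ s, ‖s ^ (-a)‖ₑ ∂μ = ENNReal.ofReal (1 / Real.Gamma a) *
      ∫⁻ l in Ioi (0 : ℝ), ∫⁻ s, ENNReal.ofReal (l ^ (a - 1) * Real.exp (-l * s)) ∂μ := by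
    rw [lintegral_lintegral_swap (by
      refine Measurable.aemeasurable (Measurable.ennreal_ofReal ?_)
      exact (measurable_fst.pow_const _).mul
        (Real.measurable_exp.comp (measurable_fst.neg.mul measurable_snd))),
      ← lintegral_const_mul' _ _ ENNReal.ofReal_ne_top]
    refine lintegral_congr_ae ?_
    filter_upwards [hpos] with s hs
    rw [← ofReal_rpow_neg_eq_lintegral ha hs, ← ofReal_norm, Real.norm_of_nonneg (by positivity)]
  have h2 : ∀ l ∈ Ioi (0 : ℝ), ∫⁻ s, ENNReal.ofReal (l ^ (a - 1) * Real.exp (-l * s)) ∂μ =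
      ENNReal.ofReal (l ^ (a - 1) * ∫ s, Real.exp (-l * s) ∂μ) := by
    intro l hl
    have hl : 0 < l := hl
    obtain ⟨hi, _, _⟩ := integral_exp_neg_mem h0 hl.le
    rw [← integral_const_mul, ofReal_integral_eq_lintegral_ofReal (hi.const_mul _)]
    exact ae_of_all _ fun s => mul_nonneg (by positivity) (Real.exp_nonneg _)
  have h3 : ∫⁻ l in Ioi (0 : ℝ), ENNReal.ofReal (l ^ (a - 1) * ∫ s, Real.exp (-l * s) ∂μ) < ∞ := by
    rw [← Ioc_union_Ioi_eq_Ioi zero_le_one]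
    refine lt_of_le_of_lt (lintegral_union_le _ _ _) (ENNReal.add_lt_top.2 ⟨?_, ?_⟩)
    · have hi : IntegrableOn (fun l : ℝ => l ^ (a - 1)) (Ioc 0 1) :=
        (intervalIntegral.intervalIntegrable_rpow' (by linarith)).1
      refine lt_of_le_of_lt ?_ (lt_of_le_of_lt (lintegral_ofReal_le_lintegral_enorm _) hi.2)
      refine setLIntegral_mono' measurableSet_Ioc fun l hl => ENNReal.ofReal_le_ofReal ?_
      exact mul_le_of_le_one_right (Real.rpow_nonneg hl.1.le _)
        (integral_exp_neg_mem h0 hl.1.le).2.2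
    · have hi : IntegrableOn (fun l : ℝ => C * l ^ (-2 : ℝ)) (Ioi 1) :=
        (integrableOn_Ioi_rpow_of_lt (by norm_num) one_pos).const_mul C
      refine lt_of_le_of_lt ?_ (lt_of_le_of_lt (lintegral_ofReal_le_lintegral_enorm _) hi.2)
      refine setLIntegral_mono' measurableSet_Ioi fun l hl => ENNReal.ofReal_le_ofReal ?_
      have hl : 1 < l := hl
      have hl0 : 0 < l := by linarith
      calc l ^ (a - 1) * ∫ s, Real.exp (-l * s) ∂μ ≤ l ^ (a - 1) * (C * l ^ (-(a + 1))) := by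
            gcongr
            exact hd l hl.le
        _ = C * (l ^ (a - 1) * l ^ (-(a + 1))) := by ring
        _ = C * l ^ (-2 : ℝ) := by
            rw [← Real.rpow_add hl0]
            ring_nf
  rw [HasFiniteIntegral, h1, setLIntegral_congr_fun measurableSet_Ioi h2]
  exact ENNReal.mul_lt_top ENNReal.ofReal_lt_top h3

end LaplaceDecay

/-! ### The law of the subordinator at time one as a mixing measure -/

section MixingLaw

variable {Ω : Type*} [MeasurableSpace Ω] {P : Measure Ω} {T : ℝ≥0 → Ω → ℝ}

lemma IsSubordinator.laplace_map (hT : IsSubordinator T P) (t : ℝ≥0) (l : ℝ) :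
    ∫ s, Real.exp (-l * s) ∂(P.map (T t)) = ∫ ω, Real.exp (-l * T t ω) ∂P :=
  integral_map (hT.measurable t).aemeasurable (by fun_prop)

lemma IsSubordinator.ae_nonneg_map (hT : IsSubordinator T P) (t : ℝ≥0) :
    ∀ᵐ s ∂(P.map (T t)), 0 ≤ s :=
  (ae_map_iff (hT.measurable t).aemeasurable measurableSet_Ici).2 (hT.nonneg t)

variable [IsProbabilityMeasure P]

lemma IsSubordinator.isProbabilityMeasure_map (hT : IsSubordinator T P) (t : ℝ≥0) :
    IsProbabilityMeasure (P.map (T t)) :=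
  Measure.isProbabilityMeasure_map (hT.measurable t).aemeasurable

lemma IsSubordinator.laplace_eq_exp (hT : IsSubordinator T P) {l : ℝ} (hl : 0 ≤ l) :
    ∫ ω, Real.exp (-l * T 1 ω) ∂P = Real.exp (-laplaceExponent T P l) := by
  have := hT.isProbabilityMeasure_map 1
  have h := (integral_exp_neg_mem (hT.ae_nonneg_map 1) hl).2.1
  rw [hT.laplace_map] at h
  rw [laplaceExponent, neg_neg, Real.exp_log h]

/-- Beyond some `l₁` the transform `exp (-Φ(l))` is below a stretched exponential, which beats every
power. Up to `l₁` the trivial bound `1` is absorbed into the constant `l₁ ^ N`. -/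
lemma hasRapidLaplaceDecay_of_growth (hT : IsSubordinator T P) (hg : LaplaceExponentGrowth T P) :
    HasRapidLaplaceDecay (P.map (T 1)) := by
  intro N hN
  have := hT.isProbabilityMeasure_map 1
  obtain ⟨δ, hδ, hO⟩ := hg
  obtain ⟨c, hc, hcb⟩ := hO.exists_pos
  rw [isBigOWith_iff] at hcb
  obtain ⟨l₀, hl₀⟩ := eventually_atTop.1 hcb
  obtain ⟨C, hC, hCb⟩ := exists_exp_neg_rpow_le (c := c⁻¹) (inv_pos.2 hc) hδ hN
  set l₁ := max l₀ 1 with hl₁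
  have hl₁1 : 1 ≤ l₁ := le_max_right _ _
  refine ⟨C + l₁ ^ N, by positivity, fun l hl => ?_⟩
  have hl0 : 0 < l := by linarith
  obtain ⟨_, hpos, hle⟩ := integral_exp_neg_mem (hT.ae_nonneg_map 1) hl0.le
  rcases le_total l l₁ with h | h
  · calc ∫ s, Real.exp (-l * s) ∂(P.map (T 1)) ≤ 1 := hle
      _ = l ^ N * l ^ (-N) := by rw [← Real.rpow_add hl0, add_neg_cancel, Real.rpow_zero]
      _ ≤ l₁ ^ N * l ^ (-N) := by gcongr
      _ ≤ _ := by
          gcongr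
          linarith
  · have h1 := hl₀ l ((le_max_left _ _).trans h)
    rw [hT.laplace_map] at hpos hle ⊢
    have h2 : 0 ≤ laplaceExponent T P l := by
      rw [laplaceExponent]
      exact neg_nonneg.2 (Real.log_nonpos hpos.le hle)
    rw [Real.norm_of_nonneg (by positivity), Real.norm_of_nonneg h2] at h1
    rw [hT.laplace_eq_exp hl0.le]
    calc Real.exp (-laplaceExponent T P l) ≤ Real.exp (-(c⁻¹ * l ^ δ)) := by
          refine Real.exp_le_exp.2 (neg_le_neg ?_)
          rw [inv_mul_le_iff₀ hc]
          exact h1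
      _ ≤ C * l ^ (-N) := hCb l hl0
      _ ≤ _ := by
          gcongr
          exact le_add_of_nonneg_right (by positivity)

theorem exists_isMixing (hT : IsSubordinator T P) (hg : LaplaceExponentGrowth T P)
    (hd : DensityTailBound T P) : ∃ γ, 0 < γ ∧ IsMixing γ (P.map (T 1)) := by
  have hp := hT.isProbabilityMeasure_map 1
  obtain ⟨C, γ, η, hγ, hηm, hη, hb⟩ := hd
  have hpos : ∀ᵐ s ∂(P.map (T 1)), 0 < s := by
    rw [hη]
    exact (withDensity_absolutelyContinuous _ _).ae_le (ae_restrict_mem measurableSet_Ioi)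
  refine ⟨γ, hγ, hp, hpos, fun a ha =>
    integrable_rpow_neg_of_decay hpos (hasRapidLaplaceDecay_of_growth hT hg) ha,
    max C 0, le_max_right _ _, fun g hgm => ?_⟩
  rw [hη, lintegral_withDensity_eq_lintegral_mul _ hηm.ennreal_ofReal hgm,
    ← lintegral_const_mul' _ _ ENNReal.ofReal_ne_top]
  refine setLIntegral_mono' measurableSet_Ioi fun s hs => ?_
  have hs : 0 < s := hs
  rw [← mul_assoc, ← ENNReal.ofReal_mul (le_max_right _ _)]
  refine mul_le_mul_left (ENNReal.ofReal_le_ofReal ?_) _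
  exact (hb s hs).2.trans (by gcongr; exact le_max_left _ _)

theorem exists_smoothDensity_generatesCZ (𝕜 : Type*) [RCLike 𝕜] {n : ℕ} (hn : 1 ≤ n)
    {B : ℝ≥0 → Ω → E n} (hB : IsDoubleSpeedBrownianMotion B P) (hT : IsSubordinator T P)
    (hBT : IndepFun (fun ω t => B t ω) (fun ω t => T t ω) P) (hg : LaplaceExponentGrowth T P)
    (hd : DensityTailBound T P) :
    ∃ φ : E n → ℝ, IsSmoothDensity φ (subordinate B T 1) P ∧
      ∀ A : E n → ℝ → Matrix (Fin (n + 1)) (Fin (n + 1)) 𝕜, IsAdmissible A → GeneratesCZ φ A := by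
  obtain ⟨γ, hγ, hμ⟩ := exists_isMixing hT hg hd
  exact ⟨_, isSmoothDensity_mixture hB hT hBT hμ, fun A hA => hμ.generatesCZ hγ hn hA⟩

end MixingLaw

/-! ### Laplace transforms of subordinators -/

section SubordinatorLaplace

/-- Monotonicity takes the place of continuity in Cauchy's functional equation: comparing `k t` with
its integer part shows that `k |f t - t f 1|` stays below `f 1` for every `k`. -/
lemma eq_mul_of_additive_monotone {f : ℝ≥0 → ℝ} (hadd : ∀ s t, f (s + t) = f s + f t)
    (hmono : Monotone f) (t : ℝ≥0) : f t = t * f 1 := by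
  have hnsmul : ∀ (k : ℕ) (s : ℝ≥0), f (k * s) = k * f s := by
    intro k s
    induction k with
    | zero =>
      have := hadd 0 0
      simp only [add_zero] at this
      simp only [Nat.cast_zero, zero_mul]
      linarith
    | succ k ih =>
      push_cast
      rw [add_mul, add_mul, one_mul, one_mul, hadd, ih]
  have hnat : ∀ k : ℕ, f k = k * f 1 := fun k => by simpa using hnsmul k 1
  have h1 : 0 ≤ f 1 := by
    have h0 := hnat 0
    simp only [Nat.cast_zero, zero_mul] at h0
    rw [← h0]
    exact hmono zero_le_one
  have key : ∀ k : ℕ, (k : ℝ) * |f t - t * f 1| ≤ f 1 := by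
    intro k
    have ha : f (⌊(k : ℝ≥0) * t⌋₊ : ℝ≥0) ≤ f (k * t) := hmono (Nat.floor_le zero_le)
    have hb : f (k * t) ≤ f ((⌊(k : ℝ≥0) * t⌋₊ + 1 : ℕ) : ℝ≥0) := by
      refine hmono ?_
      push_cast
      exact (Nat.lt_floor_add_one _).le
    rw [hnat, hnsmul] at ha hb
    push_cast at hb
    have hc : ((⌊(k : ℝ≥0) * t⌋₊ : ℝ≥0) : ℝ) ≤ ((k * t : ℝ≥0) : ℝ) :=
      NNReal.coe_le_coe.2 (Nat.floor_le zero_le)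
    have hd : ((k * t : ℝ≥0) : ℝ) ≤ (((⌊(k : ℝ≥0) * t⌋₊ : ℝ≥0) + 1 : ℝ≥0) : ℝ) :=
      NNReal.coe_le_coe.2 (Nat.lt_floor_add_one _).le
    push_cast at hc hd
    have he := mul_le_mul_of_nonneg_right hc h1
    have hf := mul_le_mul_of_nonneg_right hd h1
    rw [← abs_of_nonneg (Nat.cast_nonneg (α := ℝ) k), ← abs_mul, abs_le]
    constructor <;> nlinarith
  by_contra hne
  have hpos : 0 < |f t - t * f 1| := abs_pos.2 (sub_ne_zero.2 hne)
  obtain ⟨k, hk⟩ := exists_nat_gt (f 1 / |f t - t * f 1|)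
  rw [div_lt_iff₀ hpos] at hk
  linarith [key k]

variable {Ω : Type*} [MeasurableSpace Ω] {P : Measure Ω} {T : ℝ≥0 → Ω → ℝ}

/-- The increments over `[0, s]` and `[s, s+t]` are independent, the second is distributed like `T
t`, and `T 0 = 0` almost surely. -/
lemma IsSubordinator.laplace_add (hT : IsSubordinator T P) (l : ℝ) (s t : ℝ≥0) :
    ∫ ω, Real.exp (-l * T (s + t) ω) ∂P =
      (∫ ω, Real.exp (-l * T s ω) ∂P) * ∫ ω, Real.exp (-l * T t ω) ∂P := by
  have hmono : Monotone ![0, s, s + t] := by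
    refine Fin.monotone_iff_le_succ.2 fun i => ?_
    fin_cases i <;> simp
  have hind := (hT.indep_increments 2 ![0, s, s + t] hmono).indepFun
    (show (0 : Fin 2) ≠ 1 by decide)
  have hind' : IndepFun (fun ω => T s ω - T 0 ω) (fun ω => T (s + t) ω - T s ω) P := hind
  have hm := hind'.mgf_add (t := -l)
    (by
      have := (hT.measurable s).sub (hT.measurable 0)
      exact (Real.measurable_exp.comp (this.const_mul (-l))).aestronglyMeasurable)
    (by
      have := (hT.measurable (s + t)).sub (hT.measurable s)
      exact (Real.measurable_exp.comp (this.const_mul (-l))).aestronglyMeasurable)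
  simp only [mgf, Pi.add_apply] at hm
  have h1 : ∫ ω, Real.exp (-l * (T s ω - T 0 ω + (T (s + t) ω - T s ω))) ∂P =
      ∫ ω, Real.exp (-l * T (s + t) ω) ∂P := by
    refine integral_congr_ae ?_
    filter_upwards [hT.zero] with ω hω
    rw [hω]
    congr 2
    ring
  have h2 : ∫ ω, Real.exp (-l * (T s ω - T 0 ω)) ∂P = ∫ ω, Real.exp (-l * T s ω) ∂P := by
    refine integral_congr_ae ?_
    filter_upwards [hT.zero] with ω hω
    rw [hω, sub_zero]
  have h3 : ∫ ω, Real.exp (-l * (T (s + t) ω - T s ω)) ∂P = ∫ ω, Real.exp (-l * T t ω) ∂P := by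
    have hd : Measurable fun ω => T (s + t) ω - T s ω := (hT.measurable _).sub (hT.measurable _)
    rw [← hT.laplace_map t, ← hT.stationary_increments s t,
      integral_map hd.aemeasurable (by fun_prop)]
  rw [h1, h2, h3] at hm
  exact hm

variable [IsProbabilityMeasure P]

/-- Minus the logarithm of the Laplace transform is additive in time by `laplace_add` and monotone
because the paths are, hence linear. This replaces an argument by stochastic continuity. -/
lemma IsSubordinator.laplace_eq_exp_mul (hT : IsSubordinator T P) {l : ℝ} (hl : 0 ≤ l) (t : ℝ≥0) :
    ∫ ω, Real.exp (-l * T t ω) ∂P = Real.exp (-(t * laplaceExponent T P l)) := by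
  have hmem : ∀ t, Integrable (fun ω => Real.exp (-l * T t ω)) P ∧
      0 < ∫ ω, Real.exp (-l * T t ω) ∂P := by
    intro t
    have := hT.isProbabilityMeasure_map t
    obtain ⟨h1, h2, _⟩ := integral_exp_neg_mem (hT.ae_nonneg_map t) hl
    rw [hT.laplace_map] at h2
    exact ⟨(integrable_map_measure (by fun_prop) (hT.measurable t).aemeasurable).1 h1, h2⟩
  have hlin := eq_mul_of_additive_monotone
    (f := fun t => -Real.log (∫ ω, Real.exp (-l * T t ω) ∂P))
    (fun s t => by
      rw [hT.laplace_add, Real.log_mul (hmem s).2.ne' (hmem t).2.ne', neg_add])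
    (fun s t hst => by
      refine neg_le_neg (Real.log_le_log (hmem t).2 (integral_mono_ae (hmem t).1 (hmem s).1 ?_))
      filter_upwards [hT.monotone_paths] with ω hω
      refine Real.exp_le_exp.2 ?_
      have : T s ω ≤ T t ω := hω hst
      nlinarith) t
  rw [laplaceExponent, ← hlin, neg_neg, Real.exp_log (hmem t).2]

end SubordinatorLaplace

/-! ### Exponent and characteristic function in the relativistic case -/

section Relativistic

variable {Ω : Type*} [MeasurableSpace Ω] {P : Measure Ω} {T : ℝ≥0 → Ω → ℝ} {α m : ℝ}

/-- Once `l^(α/2) ≥ 2m`, subtracting `m` loses at most half of `l^(α/2)`, which gives the constant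
`2`. -/
lemma laplaceExponentGrowth_of_relativistic (hα : 0 < α)
    (hm : 0 ≤ m) (hΦ : ∀ l : ℝ, 0 ≤ l →
      laplaceExponent T P l = (l + m ^ (2 / α)) ^ (α / 2) - m) : LaplaceExponentGrowth T P := by
  refine ⟨α / 2, by positivity, IsBigO.of_bound 2 ?_⟩
  have h := (tendsto_rpow_atTop (show 0 < α / 2 by positivity)).eventually_ge_atTop (2 * m)
  filter_upwards [h, eventually_ge_atTop 0] with l h1 hl
  have h2 : l ^ (α / 2) ≤ (l + m ^ (2 / α)) ^ (α / 2) := by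
    gcongr
    exact le_add_of_nonneg_right (by positivity)
  rw [hΦ l hl, Real.norm_of_nonneg (by positivity), Real.norm_of_nonneg (by linarith)]
  linarith

lemma charFun_subordinate_relativistic [IsProbabilityMeasure P] {n : ℕ} {B : ℝ≥0 → Ω → E n}
    (hB : IsDoubleSpeedBrownianMotion B P) (hT : IsSubordinator T P)
    (hBT : IndepFun (fun ω t => B t ω) (fun ω t => T t ω) P)
    (hΦ : ∀ l : ℝ, 0 ≤ l → laplaceExponent T P l = (l + m ^ (2 / α)) ^ (α / 2) - m)
    (t : ℝ≥0) (ξ : E n) : charFun (P.map (subordinate B T t)) ξ =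
      Complex.exp (-((t : ℝ) * ((‖ξ‖ ^ 2 + m ^ (2 / α)) ^ (α / 2) - m) : ℝ)) := by
  rw [charFun_subordinate hB hT hBT, hT.laplace_eq_exp_mul (by positivity), hΦ _ (by positivity)]
  push_cast
  rfl

end Relativistic

/-! ### Size biasing of relativistic stable laws -/

section Uniqueness

lemma integrable_exp_mul_of_lintegral {ν : Measure ℝ} {t : ℝ}
    (h : ∫⁻ s, ENNReal.ofReal (Real.exp (t * s)) ∂ν ≠ ∞) :
    Integrable (fun s => Real.exp (t * s)) ν := by
  refine ⟨by fun_prop, ?_⟩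
  rw [HasFiniteIntegral]
  simp only [← ofReal_norm, Real.norm_eq_abs, Real.abs_exp]
  exact h.lt_top

/-- A finite measure is determined by its exponential moments in a neighbourhood of the origin. -/
lemma ext_of_lintegral_exp_eq {ν₁ ν₂ : Measure ℝ} [IsFiniteMeasure ν₁] [IsFiniteMeasure ν₂]
    (hfin : ∀ t < 1, ∫⁻ s, ENNReal.ofReal (Real.exp (t * s)) ∂ν₁ ≠ ∞)
    (heq : ∀ t < 1, ∫⁻ s, ENNReal.ofReal (Real.exp (t * s)) ∂ν₁ =
      ∫⁻ s, ENNReal.ofReal (Real.exp (t * s)) ∂ν₂) : ν₁ = ν₂ := by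
  -- The complex moment generating functions are analytic for `Re z < 1` and agree at real points
  -- accumulating at `0`. The identity theorem carries the agreement to the imaginary axis, where
  -- they are the characteristic functions.
  have hsub : ∀ ν : Measure ℝ, (∀ t < 1, ∫⁻ s, ENNReal.ofReal (Real.exp (t * s)) ∂ν ≠ ∞) →
      AnalyticOnNhd ℂ (complexMGF id ν) {z : ℂ | z.re < 1} := by
    intro ν hν
    refine analyticOnNhd_complexMGF.mono fun z hz => ?_
    have h1 : Iio (1 : ℝ) ⊆ integrableExpSet id ν := fun t ht =>
      integrable_exp_mul_of_lintegral (hν t ht)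
    exact interior_maximal h1 isOpen_Iio hz
  have h1 := hsub ν₁ hfin
  have h2 := hsub ν₂ fun t ht => heq t ht ▸ hfin t ht
  have hpre : IsPreconnected {z : ℂ | z.re < 1} := (convex_halfSpace_re_lt 1).isPreconnected
  have hreal : ∀ t : ℝ, t < 1 → complexMGF id ν₁ (t : ℂ) = complexMGF id ν₂ (t : ℂ) := by
    intro t ht
    rw [complexMGF_ofReal, complexMGF_ofReal, mgf, mgf]
    simp only [id]
    rw [integral_eq_lintegral_of_nonneg_ae (ae_of_all _ fun s => Real.exp_nonneg _) (by fun_prop),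
      integral_eq_lintegral_of_nonneg_ae (ae_of_all _ fun s => Real.exp_nonneg _) (by fun_prop),
      heq t ht]
  have hfreq : ∃ᶠ z in 𝓝[≠] (0 : ℂ), complexMGF id ν₁ z = complexMGF id ν₂ z := by
    have htend : Tendsto (fun k : ℕ => ((-(1 / ((k : ℝ) + 1)) : ℝ) : ℂ)) atTop (𝓝[≠] 0) := by
      rw [tendsto_nhdsWithin_iff]
      refine ⟨?_, Eventually.of_forall fun k => ?_⟩
      · have := (tendsto_one_div_add_atTop_nhds_zero_nat (𝕜 := ℝ)).neg
        rw [neg_zero] at this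
        exact_mod_cast (Complex.continuous_ofReal.tendsto 0).comp this
      · simp only [mem_compl_iff, mem_singleton_iff, Complex.ofReal_eq_zero]
        have : 0 < 1 / ((k : ℝ) + 1) := by positivity
        linarith
    refine htend.frequently (Frequently.of_forall fun k => hreal _ ?_)
    have : 0 < 1 / ((k : ℝ) + 1) := by positivity
    linarith
  have hEq := h1.eqOn_of_preconnected_of_frequently_eq h2 hpre (z₀ := 0) (by simp) hfreq
  refine Measure.ext_of_charFun ?_
  funext t
  rw [← complexMGF_id_mul_I, ← complexMGF_id_mul_I]
  exact hEq (by simp)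

end Uniqueness

/-! ### Relativistic laws and the size-bias identity -/

section SizeBias

/-- The laws on `[0, ∞)` with Laplace transform `exp (m - (l + c) ^ β)`. -/
structure IsRelativisticLaw (β c m : ℝ) (μ : Measure ℝ) : Prop where
  prob : IsProbabilityMeasure μ
  nonneg : ∀ᵐ s ∂μ, 0 ≤ s
  laplace : ∀ l : ℝ, 0 ≤ l → ∫ s, Real.exp (-l * s) ∂μ = Real.exp (-((l + c) ^ β - m))

/-- The density of the Lévy measure, multiplied by the size of the jump. -/
noncomputable def jumpDensity (β c u : ℝ) : ℝ :=
  β * (1 / Real.Gamma (1 - β)) * (u ^ (-β) * Real.exp (-c * u))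

variable {β c m : ℝ} {μ : Measure ℝ}

lemma measurable_jumpDensity : Measurable (jumpDensity β c) :=
  ((measurable_id.pow_const _).mul (Real.measurable_exp.comp (measurable_id.const_mul _))).const_mul _

lemma jumpDensity_nonneg (hβ : 0 < β) (hβ1 : β < 1) {u : ℝ} (hu : 0 < u) :
    0 ≤ jumpDensity β c u := by
  have := Real.Gamma_pos_of_pos (show 0 < 1 - β by linarith)
  unfold jumpDensity
  positivity

/-- A Gamma integral of order `1 - β`. The right side is the derivative of the exponent `(l + c)^β -
m`, which identifies `jumpDensity` as the jump size times the Lévy density. -/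
lemma lintegral_jumpDensity (hβ : 0 < β) (hβ1 : β < 1) {l : ℝ} (hl : 0 < l + c) :
    ∫⁻ u in Ioi (0 : ℝ), ENNReal.ofReal (jumpDensity β c u * Real.exp (-l * u)) =
      ENNReal.ofReal (β * (l + c) ^ (β - 1)) := by
  have hG := Real.Gamma_pos_of_pos (show 0 < 1 - β by linarith)
  have h := ofReal_rpow_neg_eq_lintegral (a := 1 - β) (s := l + c) (by linarith) hl
  rw [show -(1 - β) = β - 1 by ring, show 1 - β - 1 = -β by ring] at h
  rw [ENNReal.ofReal_mul hβ.le, h, ← mul_assoc, ← ENNReal.ofReal_mul hβ.le,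
    ← lintegral_const_mul' _ _ ENNReal.ofReal_ne_top]
  refine setLIntegral_congr_fun measurableSet_Ioi fun u hu => ?_
  rw [← ENNReal.ofReal_mul (by positivity), jumpDensity, mul_assoc _ (_ * _), mul_assoc (u ^ _),
    ← Real.exp_add]
  congr 4
  ring

namespace IsRelativisticLaw

/-- Differentiating the Laplace transform `exp (-Φ)` in two ways gives the identity. Integrability
follows because the derivative is nonzero, whereas the integral of a non-integrable function is zero
by convention. -/
lemma lintegral_mul_exp (hμ : IsRelativisticLaw β c m μ) (hβ : 0 < β) (hc : 0 ≤ c) {l : ℝ}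
    (hl : 0 < l) :
    ∫⁻ s, ENNReal.ofReal (s * Real.exp (-l * s)) ∂μ =
      ENNReal.ofReal (β * (l + c) ^ (β - 1)) * ENNReal.ofReal (∫ s, Real.exp (-l * s) ∂μ) := by
  have := hμ.prob
  have hlc : 0 < l + c := by linarith
  have h1 : Iio (0 : ℝ) ⊆ integrableExpSet id μ := by
    intro t ht
    have h := (integral_exp_neg_mem hμ.nonneg (l := -t) (by have : t < 0 := ht; linarith)).1
    simp only [neg_neg] at h
    exact h
  have h2 : -l ∈ interior (integrableExpSet id μ) :=
    interior_maximal h1 isOpen_Iio (show -l < 0 by linarith)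
  have h3 := hasDerivAt_mgf h2
  have h4 : HasDerivAt (fun t : ℝ => Real.exp (-((-t + c) ^ β - m)))
      (β * (l + c) ^ (β - 1) * Real.exp (-((l + c) ^ β - m))) (-l) := by
    have h5 : HasDerivAt (fun t : ℝ => -t + c) (-1) (-l) := (hasDerivAt_neg _).add_const c
    have h6 := ((h5.rpow_const (p := β) (Or.inl (by simp; linarith))).sub_const m).fun_neg.exp
    refine h6.congr_deriv ?_
    simp only [neg_neg]
    ring
  have h5 : mgf id μ =ᶠ[𝓝 (-l)] fun t : ℝ => Real.exp (-((-t + c) ^ β - m)) := by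
    filter_upwards [Iio_mem_nhds (show -l < 0 by linarith)] with t ht
    have : t < 0 := ht
    rw [← hμ.laplace (-t) (by linarith), mgf]
    simp
  have h6 := h3.unique (h4.congr_of_eventuallyEq h5)
  rw [← hμ.laplace l hl.le] at h6
  simp only [id] at h6
  have hLpos := (integral_exp_neg_mem hμ.nonneg hl.le).2.1
  have hint : Integrable (fun s => s * Real.exp (-l * s)) μ := by
    by_contra hcon
    rw [integral_undef hcon] at h6
    have : 0 < β * (l + c) ^ (β - 1) * ∫ s, Real.exp (-l * s) ∂μ := by positivity
    exact this.ne h6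
  rw [← ENNReal.ofReal_mul (by positivity), ← h6, ofReal_integral_eq_lintegral_ofReal hint]
  filter_upwards [hμ.nonneg] with s hs
  exact mul_nonneg hs (Real.exp_nonneg _)

lemma ofReal_laplace (hμ : IsRelativisticLaw β c m μ) {l : ℝ} (hl : 0 ≤ l) :
    ∫⁻ s, ENNReal.ofReal (Real.exp (-l * s)) ∂μ = ENNReal.ofReal (∫ s, Real.exp (-l * s) ∂μ) := by
  have := hμ.prob
  rw [ofReal_integral_eq_lintegral_ofReal (integral_exp_neg_mem hμ.nonneg hl).1]
  exact ae_of_all _ fun s => Real.exp_nonneg _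

/-- Size biasing a relativistic stable law amounts to convolving it with the jump density. -/
lemma lintegral_ofReal_mul (hμ : IsRelativisticLaw β c m μ) (hβ : 0 < β) (hβ1 : β < 1)
    (hc : 0 ≤ c) {f : ℝ → ℝ≥0∞} (hf : Measurable f) :
    ∫⁻ s, ENNReal.ofReal s * f s ∂μ =
      ∫⁻ u in Ioi (0 : ℝ), ENNReal.ofReal (jumpDensity β c u) * ∫⁻ v, f (u + v) ∂μ := by
  have := hμ.prob
  have hm1 : Measurable fun s : ℝ => ENNReal.ofReal (s * Real.exp (-s)) := by fun_prop
  have hm2 : Measurable fun s : ℝ => ENNReal.ofReal (Real.exp (-s)) := by fun_prop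
  have hm3 : Measurable fun u : ℝ => ENNReal.ofReal (jumpDensity β c u * Real.exp (-u)) :=
    (measurable_jumpDensity.mul (Real.measurable_exp.comp measurable_neg)).ennreal_ofReal
  -- Tilting by `exp (-s)` makes all three measures finite, with exponential moments of every order
  -- `t < 1`. Their transforms are then the Laplace integrals at `l = 1 - t > 0`.
  set ν₁ := μ.withDensity fun s => ENNReal.ofReal (s * Real.exp (-s)) with hν₁
  set κ := (volume.restrict (Ioi (0 : ℝ))).withDensity
    fun u => ENNReal.ofReal (jumpDensity β c u * Real.exp (-u)) with hκ
  set ρ := μ.withDensity fun s => ENNReal.ofReal (Real.exp (-s)) with hρ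
  have e1 : ∀ t < 1, ∫⁻ s, ENNReal.ofReal (Real.exp (t * s)) ∂ν₁ =
      ENNReal.ofReal (β * (1 - t + c) ^ (β - 1)) *
        ENNReal.ofReal (∫ s, Real.exp (-(1 - t) * s) ∂μ) := by
    intro t ht
    rw [hν₁, lintegral_withDensity_eq_lintegral_mul _ hm1 (by fun_prop),
      ← hμ.lintegral_mul_exp hβ hc (by linarith)]
    refine lintegral_congr fun s => ?_
    rw [Pi.mul_apply, ← ENNReal.ofReal_mul' (Real.exp_nonneg _), mul_assoc, ← Real.exp_add]
    congr 3
    ring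
  have e2 : ∀ t < 1, ∫⁻ s, ENNReal.ofReal (Real.exp (t * s)) ∂κ =
      ENNReal.ofReal (β * (1 - t + c) ^ (β - 1)) := by
    intro t ht
    rw [hκ, lintegral_withDensity_eq_lintegral_mul _ hm3 (by fun_prop),
      ← lintegral_jumpDensity hβ hβ1 (by linarith)]
    refine lintegral_congr fun u => ?_
    rw [Pi.mul_apply, ← ENNReal.ofReal_mul' (Real.exp_nonneg _), mul_assoc, ← Real.exp_add]
    congr 3
    ring
  have e3 : ∀ t < 1, ∫⁻ s, ENNReal.ofReal (Real.exp (t * s)) ∂ρ =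
      ENNReal.ofReal (∫ s, Real.exp (-(1 - t) * s) ∂μ) := by
    intro t ht
    rw [hρ, lintegral_withDensity_eq_lintegral_mul _ hm2 (by fun_prop),
      ← hμ.ofReal_laplace (by linarith)]
    refine lintegral_congr fun u => ?_
    rw [Pi.mul_apply, ← ENNReal.ofReal_mul' (Real.exp_nonneg _), ← Real.exp_add]
    congr 2
    ring
  have hfinite : ∀ ν : Measure ℝ, ∫⁻ s, ENNReal.ofReal (Real.exp (0 * s)) ∂ν ≠ ∞ →
      IsFiniteMeasure ν := by
    intro ν hν
    simp only [zero_mul, Real.exp_zero, ENNReal.ofReal_one, lintegral_one] at hν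
    exact ⟨hν.lt_top⟩
  have f1 : IsFiniteMeasure ν₁ := hfinite _ (by
    rw [e1 0 one_pos]
    exact ENNReal.mul_ne_top ENNReal.ofReal_ne_top ENNReal.ofReal_ne_top)
  have f2 : IsFiniteMeasure κ := hfinite _ (by
    rw [e2 0 one_pos]
    exact ENNReal.ofReal_ne_top)
  have f3 : IsFiniteMeasure ρ := hfinite _ (by
    rw [e3 0 one_pos]
    exact ENNReal.ofReal_ne_top)
  have hconv : ν₁ = κ.conv ρ := by
    refine ext_of_lintegral_exp_eq (fun t ht => ?_) fun t ht => ?_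
    · rw [e1 t ht]
      exact ENNReal.mul_ne_top ENNReal.ofReal_ne_top ENNReal.ofReal_ne_top
    · rw [Measure.lintegral_conv (by fun_prop), e1 t ht]
      have h1 : ∀ u v : ℝ, ENNReal.ofReal (Real.exp (t * (u + v))) =
          ENNReal.ofReal (Real.exp (t * u)) * ENNReal.ofReal (Real.exp (t * v)) := by
        intro u v
        rw [← ENNReal.ofReal_mul (Real.exp_nonneg _), ← Real.exp_add, mul_add]
      simp only [h1]
      simp only [lintegral_const_mul' _ _ ENNReal.ofReal_ne_top, e3 t ht,
        lintegral_mul_const' _ _ ENNReal.ofReal_ne_top, e2 t ht]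
  have hexp : ∀ s : ℝ, ENNReal.ofReal (Real.exp (-s)) * ENNReal.ofReal (Real.exp s) = 1 := by
    intro s
    rw [← ENNReal.ofReal_mul (Real.exp_nonneg _), ← Real.exp_add, neg_add_cancel, Real.exp_zero,
      ENNReal.ofReal_one]
  have hgm : Measurable fun s : ℝ => ENNReal.ofReal (Real.exp s) * f s :=
    Measurable.mul (by fun_prop) hf
  -- A factor `exp s` in the test function undoes the tilt. On the convolution side it splits as
  -- `exp u * exp v`.
  have hL : ∫⁻ s, ENNReal.ofReal (Real.exp s) * f s ∂ν₁ = ∫⁻ s, ENNReal.ofReal s * f s ∂μ := by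
    rw [hν₁, lintegral_withDensity_eq_lintegral_mul _ hm1 hgm]
    refine lintegral_congr fun s => ?_
    rw [Pi.mul_apply, ENNReal.ofReal_mul' (Real.exp_nonneg _), mul_assoc, ← mul_assoc
      (ENNReal.ofReal (Real.exp (-s))), hexp, one_mul]
  rw [← hL, hconv, Measure.lintegral_conv hgm, hκ, lintegral_withDensity_eq_lintegral_mul _ hm3]
  · refine setLIntegral_congr_fun measurableSet_Ioi fun u hu => ?_
    simp only [Pi.mul_apply]
    have hmu : Measurable fun v : ℝ => ENNReal.ofReal (Real.exp (u + v)) * f (u + v) :=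
      hgm.comp (measurable_const_add u)
    rw [hρ, lintegral_withDensity_eq_lintegral_mul _ hm2 hmu,
      ENNReal.ofReal_mul (jumpDensity_nonneg hβ hβ1 hu), mul_assoc,
      ← lintegral_const_mul' _ _ ENNReal.ofReal_ne_top]
    congr 1
    refine lintegral_congr fun v => ?_
    rw [Pi.mul_apply]
    calc ENNReal.ofReal (Real.exp (-u)) * (ENNReal.ofReal (Real.exp (-v)) *
          (ENNReal.ofReal (Real.exp (u + v)) * f (u + v)))
        = ENNReal.ofReal (Real.exp (-u)) * ENNReal.ofReal (Real.exp (-v)) *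
          ENNReal.ofReal (Real.exp (u + v)) * f (u + v) := by ring
      _ = f (u + v) := by
          rw [← ENNReal.ofReal_mul (Real.exp_nonneg _), ← Real.exp_add,
            show -u + -v = -(u + v) by ring, hexp, one_mul]
  · exact (hgm.comp (measurable_fst.add measurable_snd)).lintegral_prod_right'

end IsRelativisticLaw

end SizeBias

/-! ### The density of a relativistic stable law -/

section RieszPotential

lemma lintegral_rpow_Ioo {a w : ℝ} (ha : -1 < a) (hw : 0 < w) :
    ∫⁻ u in Ioo 0 w, ENNReal.ofReal (u ^ a) = ENNReal.ofReal (w ^ (a + 1) / (a + 1)) := by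
  have hi : IntegrableOn (fun u : ℝ => u ^ a) (Ioc 0 w) :=
    (intervalIntegral.intervalIntegrable_rpow' (a := 0) (b := w) ha).1
  have h := integral_rpow (a := 0) (b := w) (r := a) (Or.inl ha)
  rw [intervalIntegral.integral_of_le hw.le, Real.zero_rpow (by linarith), sub_zero] at h
  rw [← h, ofReal_integral_eq_lintegral_ofReal hi, restrict_Ioo_eq_restrict_Ioc]
  filter_upwards [ae_restrict_mem measurableSet_Ioc] with u hu
  exact Real.rpow_nonneg hu.1.le _

lemma lintegral_sub_rpow_Ioo {a w : ℝ} (ha : -1 < a) (hw : 0 < w) :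
    ∫⁻ u in Ioo 0 w, ENNReal.ofReal ((w - u) ^ a) = ENNReal.ofReal (w ^ (a + 1) / (a + 1)) := by
  rw [← lintegral_rpow_Ioo ha hw]
  have h := (Measure.measurePreserving_sub_left (volume : Measure ℝ) w).setLIntegral_comp_preimage
    (measurableSet_Ioo (a := 0) (b := w))
    (f := fun u => ENNReal.ofReal (u ^ a)) ((measurable_id.pow_const a).ennreal_ofReal)
  have hpre : (fun x : ℝ => w - x) ⁻¹' Ioo 0 w = Ioo 0 w := by
    ext x
    simp only [mem_preimage, mem_Ioo]
    constructor <;> rintro ⟨h1, h2⟩ <;> constructor <;> linarith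
  rw [hpre] at h
  exact h

/-- One of `u` and `w - u` is at least `w/2`, so one of the two negative powers is at most its value
at `w/2`, and the other one integrates explicitly. -/
lemma lintegral_beta_le {a b w : ℝ} (ha : -1 < a) (ha0 : a < 0) (hb : -1 < b) (hb0 : b < 0)
    (hw : 0 < w) :
    ∫⁻ u in Ioo 0 w, ENNReal.ofReal (u ^ b * (w - u) ^ a) ≤
      ENNReal.ofReal ((2 ^ (-a) / (b + 1) + 2 ^ (-b) / (a + 1)) * w ^ (a + 1 + b)) := by
  have ha1 : 0 < a + 1 := by linarith
  have hb1 : 0 < b + 1 := by linarith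
  have hhalf : ∀ c : ℝ, (w / 2) ^ c = 2 ^ (-c) * w ^ c := by
    intro c
    rw [Real.div_rpow hw.le two_pos.le, Real.rpow_neg two_pos.le]
    ring
  calc ∫⁻ u in Ioo 0 w, ENNReal.ofReal (u ^ b * (w - u) ^ a)
      ≤ ∫⁻ u in Ioo 0 w, (ENNReal.ofReal ((w / 2) ^ a) * ENNReal.ofReal (u ^ b) +
          ENNReal.ofReal ((w / 2) ^ b) * ENNReal.ofReal ((w - u) ^ a)) := by
        refine setLIntegral_mono' measurableSet_Ioo fun u hu => ?_
        have h1 : 0 < u := hu.1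
        have h2 : 0 < w - u := by linarith [hu.2]
        rw [← ENNReal.ofReal_mul (by positivity), ← ENNReal.ofReal_mul (by positivity),
          ← ENNReal.ofReal_add (by positivity) (by positivity)]
        refine ENNReal.ofReal_le_ofReal ?_
        rcases le_total u (w / 2) with h | h
        · have : (w - u) ^ a ≤ (w / 2) ^ a :=
            Real.rpow_le_rpow_of_nonpos (by positivity) (by linarith) ha0.le
          have h3 : 0 ≤ (w / 2) ^ b * (w - u) ^ a := by positivity
          nlinarith [mul_le_mul_of_nonneg_left this (Real.rpow_nonneg h1.le b)]
        · have : u ^ b ≤ (w / 2) ^ b :=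
            Real.rpow_le_rpow_of_nonpos (by positivity) h hb0.le
          have h3 : 0 ≤ (w / 2) ^ a * u ^ b := by positivity
          nlinarith [mul_le_mul_of_nonneg_right this (Real.rpow_nonneg h2.le a)]
    _ = ENNReal.ofReal ((w / 2) ^ a) * ENNReal.ofReal (w ^ (b + 1) / (b + 1)) +
          ENNReal.ofReal ((w / 2) ^ b) * ENNReal.ofReal (w ^ (a + 1) / (a + 1)) := by
        have hmb : Measurable fun u : ℝ => ENNReal.ofReal ((w / 2) ^ a) * ENNReal.ofReal (u ^ b) :=
          ((measurable_id.pow_const b).ennreal_ofReal).const_mul _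
        rw [lintegral_add_left hmb,
          lintegral_const_mul' _ _ ENNReal.ofReal_ne_top,
          lintegral_const_mul' _ _ ENNReal.ofReal_ne_top, lintegral_rpow_Ioo hb hw,
          lintegral_sub_rpow_Ioo ha hw]
    _ = _ := by
        rw [← ENNReal.ofReal_mul (by positivity), ← ENNReal.ofReal_mul (by positivity),
          ← ENNReal.ofReal_add (by positivity) (by positivity)]
        congr 1
        have h1 : w ^ (a + 1 + b) = w ^ a * w ^ (b + 1) := by
          rw [← Real.rpow_add hw]
          ring_nf
        have h2 : w ^ (a + 1 + b) = w ^ b * w ^ (a + 1) := by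
          rw [← Real.rpow_add hw]
          ring_nf
        rw [hhalf, hhalf, add_mul]
        calc _ = 2 ^ (-a) / (b + 1) * (w ^ a * w ^ (b + 1)) +
              2 ^ (-b) / (a + 1) * (w ^ b * w ^ (a + 1)) := by ring
          _ = _ := by rw [← h1, ← h2]

/-- The fractional integral of a measure on the half-line. -/
noncomputable def rieszPotential (μ : Measure ℝ) (a s : ℝ) : ℝ≥0∞ :=
  ∫⁻ r in Iio s, ENNReal.ofReal ((s - r) ^ a) ∂μ

variable {β c m : ℝ} {μ : Measure ℝ}

lemma measurable_sub_rpow (a s : ℝ) : Measurable fun r : ℝ => ENNReal.ofReal ((s - r) ^ a) :=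
  ((measurable_const.sub measurable_id).pow_const a).ennreal_ofReal

lemma jumpDensity_le (hβ : 0 < β) (hβ1 : β < 1) (hc : 0 ≤ c) {u : ℝ} (hu : 0 < u) :
    jumpDensity β c u ≤ β * (1 / Real.Gamma (1 - β)) * u ^ (-β) := by
  have hG := Real.Gamma_pos_of_pos (show 0 < 1 - β by linarith)
  unfold jumpDensity
  have : Real.exp (-c * u) ≤ 1 := Real.exp_le_one_iff.2 (by nlinarith)
  gcongr
  exact mul_le_of_le_one_right (by positivity) this

namespace IsRelativisticLaw

lemma rieszPotential_le (hμ : IsRelativisticLaw β c m μ) {a s : ℝ} (ha : 0 ≤ a) :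
    rieszPotential μ a s ≤ ENNReal.ofReal (s ^ a) * μ (Iio s) := by
  calc rieszPotential μ a s ≤ ∫⁻ _ in Iio s, ENNReal.ofReal (s ^ a) ∂μ := by
        refine lintegral_mono_ae ?_
        filter_upwards [ae_restrict_mem measurableSet_Iio, ae_restrict_of_ae hμ.nonneg] with r h1 h2
        have : r < s := h1
        refine ENNReal.ofReal_le_ofReal (Real.rpow_le_rpow (by linarith) (by linarith) ha)
    _ = _ := by rw [setLIntegral_const]

/-- Write `s = (s - r) + r`. The first term raises the exponent to `a + 1`. For the second, size
biasing convolves `(s - r)^a` with a density bounded by a multiple of `u^(-β)`, and the beta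
integral yields exponent `a + 1 - β`. -/
lemma mul_rieszPotential_le (hμ : IsRelativisticLaw β c m μ) (hβ : 0 < β) (hβ1 : β < 1)
    (hc : 0 ≤ c) {a : ℝ} (ha : -1 < a) (ha0 : a < 0) :
    ∃ K, 0 ≤ K ∧ ∀ s, 0 < s → ENNReal.ofReal s * rieszPotential μ a s ≤
      rieszPotential μ (a + 1) s + ENNReal.ofReal K * rieszPotential μ (a + 1 - β) s := by
  have := hμ.prob
  have hG := Real.Gamma_pos_of_pos (show 0 < 1 - β by linarith)
  have ha1 : 0 < a + 1 := by linarith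
  have hb1 : 0 < -β + 1 := by linarith
  set κ₀ := β * (1 / Real.Gamma (1 - β)) with hκ₀
  have hκ₀0 : 0 ≤ κ₀ := by positivity
  set D := 2 ^ (-a) / (-β + 1) + 2 ^ (-(-β)) / (a + 1) with hD
  have hD0 : 0 ≤ D := by positivity
  refine ⟨κ₀ * D, by positivity, fun s hs => ?_⟩
  set f : ℝ → ℝ≥0∞ := (Iio s).indicator fun r => ENNReal.ofReal ((s - r) ^ a) with hf
  have hfm : Measurable f := (measurable_sub_rpow a s).indicator measurableSet_Iio
  have h1 : ENNReal.ofReal s * rieszPotential μ a s =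
      rieszPotential μ (a + 1) s + ∫⁻ r, ENNReal.ofReal r * f r ∂μ := by
    have e : ∫⁻ r, ENNReal.ofReal r * f r ∂μ =
        ∫⁻ r in Iio s, ENNReal.ofReal r * ENNReal.ofReal ((s - r) ^ a) ∂μ := by
      rw [← lintegral_indicator measurableSet_Iio]
      refine lintegral_congr fun r => ?_
      by_cases hr : r ∈ Iio s <;> simp [hf, hr]
    rw [e, rieszPotential, rieszPotential, ← lintegral_const_mul' _ _ ENNReal.ofReal_ne_top,
      ← lintegral_add_left (measurable_sub_rpow (a + 1) s)]
    refine lintegral_congr_ae ?_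
    filter_upwards [ae_restrict_mem measurableSet_Iio, ae_restrict_of_ae hμ.nonneg] with r h1 h2
    have h3 : 0 < s - r := sub_pos.2 h1
    rw [← ENNReal.ofReal_mul hs.le, ← ENNReal.ofReal_mul h2,
      ← ENNReal.ofReal_add (by positivity) (by positivity), Real.rpow_add_one h3.ne']
    congr 1
    ring
  have h2 : ∫⁻ r, ENNReal.ofReal r * f r ∂μ =
      ∫⁻ v, (∫⁻ u in Ioi (0 : ℝ), ENNReal.ofReal (jumpDensity β c u) * f (u + v)) ∂μ := by
    rw [hμ.lintegral_ofReal_mul hβ hβ1 hc hfm, lintegral_lintegral_swap (by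
      refine Measurable.aemeasurable ?_
      exact ((measurable_jumpDensity.ennreal_ofReal).comp measurable_snd).mul
        (hfm.comp (measurable_snd.add measurable_fst)))]
    refine lintegral_congr fun u => ?_
    rw [lintegral_const_mul' _ _ ENNReal.ofReal_ne_top]
  rw [h1, h2]
  gcongr
  rw [rieszPotential, ← lintegral_const_mul' _ _ ENNReal.ofReal_ne_top,
    ← lintegral_indicator measurableSet_Iio]
  refine lintegral_mono fun v => ?_
  by_cases hv : v < s
  · have hw : 0 < s - v := sub_pos.2 hv
    rw [indicator_of_mem (show v ∈ Iio s from hv)]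
    calc ∫⁻ u in Ioi (0 : ℝ), ENNReal.ofReal (jumpDensity β c u) * f (u + v)
        ≤ ∫⁻ u in Ioi (0 : ℝ), (Ioo 0 (s - v)).indicator
            (fun u => ENNReal.ofReal κ₀ * ENNReal.ofReal (u ^ (-β) * (s - v - u) ^ a)) u := by
          refine setLIntegral_mono' measurableSet_Ioi fun u hu => ?_
          have hu : 0 < u := hu
          by_cases h : u + v < s
          · rw [indicator_of_mem (show u ∈ Ioo 0 (s - v) from ⟨hu, by linarith⟩), hf,
              indicator_of_mem (show u + v ∈ Iio s from h)]
            have h4 : 0 < s - v - u := by linarith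
            rw [← ENNReal.ofReal_mul (jumpDensity_nonneg hβ hβ1 hu), ← ENNReal.ofReal_mul hκ₀0,
              show s - (u + v) = s - v - u by ring, ← mul_assoc]
            refine ENNReal.ofReal_le_ofReal ?_
            gcongr
            exact jumpDensity_le hβ hβ1 hc hu
          · rw [hf, indicator_of_notMem (show u + v ∉ Iio s from h), mul_zero]
            exact zero_le
      _ ≤ ENNReal.ofReal κ₀ * ∫⁻ u in Ioo 0 (s - v),
            ENNReal.ofReal (u ^ (-β) * (s - v - u) ^ a) := by
          rw [← lintegral_const_mul' _ _ ENNReal.ofReal_ne_top,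
            ← lintegral_indicator measurableSet_Ioo]
          exact setLIntegral_le_lintegral _ _
      _ ≤ ENNReal.ofReal κ₀ * ENNReal.ofReal (D * (s - v) ^ (a + 1 + -β)) := by
          gcongr
          exact lintegral_beta_le ha ha0 (by linarith) (by linarith) hw
      _ = _ := by
          rw [ENNReal.ofReal_mul hκ₀0, ENNReal.ofReal_mul hD0, mul_assoc, ← sub_eq_add_neg]
  · rw [indicator_of_notMem (show v ∉ Iio s from hv)]
    refine le_of_eq ?_
    rw [← lintegral_zero (μ := volume.restrict (Ioi (0 : ℝ)))]
    refine setLIntegral_congr_fun measurableSet_Ioi fun u hu => ?_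
    have hu : 0 < u := hu
    have hv' : ¬ u + v < s := by linarith
    rw [hf, indicator_of_notMem (show u + v ∉ Iio s from hv'), mul_zero]

/-- Each use of `mul_rieszPotential_le` improves the exponent by at least `1 - β` at the price of a
factor `s`, until it is nonnegative and the potential is trivially at most `s^a μ (Iio s)`. The
number `j` counts the steps that suffice. -/
lemma pow_mul_rieszPotential_le (hμ : IsRelativisticLaw β c m μ) (hβ : 0 < β) (hβ1 : β < 1)
    (hc : 0 ≤ c) (j : ℕ) : ∀ a : ℝ, -1 < a → 0 ≤ a + j * (1 - β) →
    ∃ (N : ℕ) (C : ℝ), 0 ≤ C ∧ ∀ s, 0 < s → ENNReal.ofReal (s ^ (N + 1)) * rieszPotential μ a s ≤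
      ENNReal.ofReal (C * (1 + s) ^ ((N : ℝ) + 1 + a)) * μ (Iio s) := by
  have base : ∀ a : ℝ, 0 ≤ a → ∃ (N : ℕ) (C : ℝ), 0 ≤ C ∧ ∀ s, 0 < s →
      ENNReal.ofReal (s ^ (N + 1)) * rieszPotential μ a s ≤
      ENNReal.ofReal (C * (1 + s) ^ ((N : ℝ) + 1 + a)) * μ (Iio s) := by
    intro a ha
    refine ⟨0, 1, zero_le_one, fun s hs => ?_⟩
    calc ENNReal.ofReal (s ^ (0 + 1)) * rieszPotential μ a s
        ≤ ENNReal.ofReal (s ^ (0 + 1)) * (ENNReal.ofReal (s ^ a) * μ (Iio s)) := by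
          gcongr
          exact hμ.rieszPotential_le ha
      _ = ENNReal.ofReal (s ^ (1 + a)) * μ (Iio s) := by
          rw [← mul_assoc, ← ENNReal.ofReal_mul (by positivity), zero_add, pow_one,
            Real.rpow_add hs, Real.rpow_one]
      _ ≤ _ := by
          gcongr
          rw [one_mul, Nat.cast_zero, zero_add]
          gcongr
          linarith
  induction j with
  | zero =>
    intro a _ h
    exact base a (by simpa using h)
  | succ j ih =>
    intro a ha h
    rcases le_or_gt 0 a with ha0 | ha0
    · exact base a ha0
    obtain ⟨K, hK, hstep⟩ := hμ.mul_rieszPotential_le hβ hβ1 hc ha ha0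
    obtain ⟨N, C, hC, hb⟩ := ih (a + 1 - β) (by linarith) (by push_cast at h; linarith)
    refine ⟨N + 1, 1 + K * C, by positivity, fun s hs => ?_⟩
    have hs1 : 1 ≤ 1 + s := by linarith
    calc ENNReal.ofReal (s ^ (N + 1 + 1)) * rieszPotential μ a s
        = ENNReal.ofReal (s ^ (N + 1)) * (ENNReal.ofReal s * rieszPotential μ a s) := by
          rw [pow_succ, ENNReal.ofReal_mul (by positivity), mul_assoc]
      _ ≤ ENNReal.ofReal (s ^ (N + 1)) * (rieszPotential μ (a + 1) s +
            ENNReal.ofReal K * rieszPotential μ (a + 1 - β) s) := by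
          gcongr
          exact hstep s hs
      _ = ENNReal.ofReal (s ^ (N + 1)) * rieszPotential μ (a + 1) s + ENNReal.ofReal K *
            (ENNReal.ofReal (s ^ (N + 1)) * rieszPotential μ (a + 1 - β) s) := by ring
      _ ≤ ENNReal.ofReal (s ^ (N + 1)) * (ENNReal.ofReal (s ^ (a + 1)) * μ (Iio s)) +
            ENNReal.ofReal K * (ENNReal.ofReal (C * (1 + s) ^ ((N : ℝ) + 1 + (a + 1 - β))) *
              μ (Iio s)) := by
          refine add_le_add (mul_le_mul_right (hμ.rieszPotential_le (by linarith)) _)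
            (mul_le_mul_right (hb s hs) _)
      _ = ENNReal.ofReal (s ^ (N + 1) * s ^ (a + 1) +
            K * (C * (1 + s) ^ ((N : ℝ) + 1 + (a + 1 - β)))) * μ (Iio s) := by
          rw [ENNReal.ofReal_add (by positivity) (by positivity),
            ENNReal.ofReal_mul (p := s ^ (N + 1)) (by positivity), ENNReal.ofReal_mul (p := K) hK]
          ring
      _ ≤ _ := by
          gcongr
          have e1 : s ^ (N + 1) * s ^ (a + 1) ≤ (1 + s) ^ (((N + 1 : ℕ) : ℝ) + 1 + a) := by
            rw [show ((N + 1 : ℕ) : ℝ) + 1 + a = ((N + 1 : ℕ) : ℝ) + (a + 1) by ring,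
              Real.rpow_add (show 0 < 1 + s by linarith), Real.rpow_natCast]
            have hle : s ≤ 1 + s := by linarith
            have : 0 ≤ a + 1 := by linarith
            gcongr
          have e2 : (1 + s) ^ ((N : ℝ) + 1 + (a + 1 - β)) ≤
              (1 + s) ^ (((N + 1 : ℕ) : ℝ) + 1 + a) := by
            refine Real.rpow_le_rpow_of_exponent_le hs1 ?_
            push_cast
            linarith
          rw [add_mul, one_mul, mul_assoc]
          gcongr

/-- Chernoff's bound at `l = 1/s`: on `Iio s` the function `exp (1 - r/s)` is at least `1`, and the
Laplace transform at `1/s` is smaller than any power of `s`. -/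
lemma measure_Iio_le (hμ : IsRelativisticLaw β c m μ) (hβ : 0 < β) (hc : 0 ≤ c) {N : ℝ}
    (hN : 0 < N) : ∃ C, 0 ≤ C ∧ ∀ s, 0 < s → μ (Iio s) ≤ ENNReal.ofReal (C * s ^ N) := by
  have := hμ.prob
  obtain ⟨C, hC, h⟩ := exists_exp_neg_rpow_le one_pos hβ hN
  refine ⟨Real.exp 1 * (Real.exp m * C), by positivity, fun s hs => ?_⟩
  calc μ (Iio s) = ∫⁻ _ in Iio s, 1 ∂μ := by simp
    _ ≤ ∫⁻ r in Iio s, ENNReal.ofReal (Real.exp 1) * ENNReal.ofReal (Real.exp (-s⁻¹ * r)) ∂μ := by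
        refine setLIntegral_mono' measurableSet_Iio fun r hr => ?_
        rw [← ENNReal.ofReal_mul (Real.exp_nonneg _), ← Real.exp_add, ← ENNReal.ofReal_one]
        refine ENNReal.ofReal_le_ofReal (Real.one_le_exp ?_)
        have hr : r < s := hr
        have : s⁻¹ * r ≤ 1 := by
          rw [inv_mul_le_iff₀ hs]
          linarith
        linarith
    _ ≤ ENNReal.ofReal (Real.exp 1) * ∫⁻ r, ENNReal.ofReal (Real.exp (-s⁻¹ * r)) ∂μ := by
        rw [← lintegral_const_mul' _ _ ENNReal.ofReal_ne_top]
        exact setLIntegral_le_lintegral _ _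
    _ = ENNReal.ofReal (Real.exp 1) * ENNReal.ofReal (Real.exp (-((s⁻¹ + c) ^ β - m))) := by
        rw [hμ.ofReal_laplace (by positivity), hμ.laplace _ (by positivity)]
    _ ≤ _ := by
        rw [← ENNReal.ofReal_mul (Real.exp_nonneg _)]
        refine ENNReal.ofReal_le_ofReal ?_
        rw [mul_assoc]
        gcongr
        have h1 : (s⁻¹) ^ β ≤ (s⁻¹ + c) ^ β := by
          gcongr
          linarith
        calc Real.exp (-((s⁻¹ + c) ^ β - m)) ≤ Real.exp (m + -(1 * (s⁻¹) ^ β)) :=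
              Real.exp_le_exp.2 (by linarith)
          _ = Real.exp m * Real.exp (-(1 * (s⁻¹) ^ β)) := Real.exp_add _ _
          _ ≤ Real.exp m * (C * (s⁻¹) ^ (-N)) := by
              gcongr
              exact h _ (by positivity)
          _ = Real.exp m * C * s ^ N := by
              rw [Real.inv_rpow hs.le, Real.rpow_neg hs.le, inv_inv]
              ring

/-- The iteration costs a factor `s^(N+1)`. For `s ≥ 1` the powers balance to `s^(-β)`. For `s ≤ 1`
the mass `μ (Iio s)` is itself of order `s^(N+1)`, and `s^(-β) ≥ 1`. -/
lemma exists_rieszPotential_le (hμ : IsRelativisticLaw β c m μ) (hβ : 0 < β) (hβ1 : β < 1)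
    (hc : 0 ≤ c) :
    ∃ D, 0 ≤ D ∧ ∀ s, 0 < s → rieszPotential μ (-β) s ≤ ENNReal.ofReal (D * s ^ (-β)) := by
  have := hμ.prob
  obtain ⟨j, hj⟩ := exists_nat_ge (β / (1 - β))
  rw [div_le_iff₀ (by linarith)] at hj
  obtain ⟨N, C, hC, h⟩ := hμ.pow_mul_rieszPotential_le hβ hβ1 hc j (-β) (by linarith) (by linarith)
  obtain ⟨C', hC', h'⟩ := hμ.measure_Iio_le hβ hc (N := (N : ℝ) + 1) (by positivity)
  set x : ℝ := (N : ℝ) + 1 + -β with hx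
  have hx0 : 0 < x := by
    have : (0 : ℝ) ≤ N := by positivity
    linarith
  refine ⟨C * 2 ^ x * (1 + C'), by positivity, fun s hs => ?_⟩
  have hinv : ∀ A : ℝ, 0 ≤ A →
      ENNReal.ofReal (s ^ (N + 1)) * rieszPotential μ (-β) s ≤ ENNReal.ofReal (A * s ^ (N + 1)) →
      rieszPotential μ (-β) s ≤ ENNReal.ofReal A := by
    intro A hA hle
    rw [mul_comm A, ENNReal.ofReal_mul (by positivity)] at hle
    exact (ENNReal.mul_le_mul_iff_right (ENNReal.ofReal_pos.2 (by positivity)).ne'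
      ENNReal.ofReal_ne_top).1 hle
  refine hinv _ (by positivity) ((h s hs).trans ?_)
  rcases le_total 1 s with h1 | h1
  · calc ENNReal.ofReal (C * (1 + s) ^ x) * μ (Iio s) ≤ ENNReal.ofReal (C * (2 * s) ^ x) * 1 := by
          gcongr
          · linarith
          · exact prob_le_one
      _ ≤ _ := by
          rw [mul_one]
          refine ENNReal.ofReal_le_ofReal ?_
          rw [Real.mul_rpow two_pos.le hs.le, hx, Real.rpow_add hs ((N : ℝ) + 1), ← hx]
          rw [show (N : ℝ) + 1 = ((N + 1 : ℕ) : ℝ) by push_cast; ring, Real.rpow_natCast]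
          calc _ = C * 2 ^ x * 1 * s ^ (-β) * s ^ (N + 1) := by ring
            _ ≤ _ := by
              gcongr
              linarith
  · calc ENNReal.ofReal (C * (1 + s) ^ x) * μ (Iio s)
        ≤ ENNReal.ofReal (C * 2 ^ x) * ENNReal.ofReal (C' * s ^ ((N : ℝ) + 1)) := by
          gcongr
          · linarith
          · exact h' s hs
      _ ≤ _ := by
          rw [← ENNReal.ofReal_mul (by positivity)]
          refine ENNReal.ofReal_le_ofReal ?_
          rw [show (N : ℝ) + 1 = ((N + 1 : ℕ) : ℝ) by push_cast; ring, Real.rpow_natCast]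
          have h2 : 1 ≤ s ^ (-β) := Real.one_le_rpow_of_pos_of_le_one_of_nonpos hs h1 (by linarith)
          calc _ = C * 2 ^ x * C' * 1 * s ^ (N + 1) := by ring
            _ ≤ _ := by
              gcongr
              linarith

end IsRelativisticLaw

end RieszPotential

/-! ### From the fractional integral to the density of a relativistic law -/

section RelativisticDensity

variable {β c m : ℝ} {μ : Measure ℝ}

/-- The convolution of a measure with the jump density. -/
noncomputable def jumpConvolution (β c : ℝ) (μ : Measure ℝ) (s : ℝ) : ℝ≥0∞ :=
  ∫⁻ v, (Iio s).indicator (fun v => ENNReal.ofReal (jumpDensity β c (s - v))) v ∂μ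

lemma measurable_jumpConvolution_integrand :
    Measurable fun p : ℝ × ℝ =>
      (Iio p.1).indicator (fun v => ENNReal.ofReal (jumpDensity β c (p.1 - v))) p.2 := by
  have h1 : Measurable fun p : ℝ × ℝ => ENNReal.ofReal (jumpDensity β c (p.1 - p.2)) :=
    (measurable_jumpDensity.comp (measurable_fst.sub measurable_snd)).ennreal_ofReal
  have h2 : MeasurableSet {p : ℝ × ℝ | p.2 < p.1} := measurableSet_lt measurable_snd measurable_fst
  convert h1.indicator h2 using 1
  funext p
  by_cases h : p.2 < p.1 <;> simp [h]

lemma measurable_jumpConvolution [SFinite μ] : Measurable (jumpConvolution β c μ) :=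
  measurable_jumpConvolution_integrand.lintegral_prod_right'

namespace IsRelativisticLaw

lemma jumpConvolution_le (hμ : IsRelativisticLaw β c m μ) (hβ : 0 < β) (hβ1 : β < 1)
    (hc : 0 ≤ c) :
    ∃ D, 0 ≤ D ∧ ∀ s, 0 < s → jumpConvolution β c μ s ≤ ENNReal.ofReal (D * s ^ (-β)) := by
  obtain ⟨D, hD, h⟩ := hμ.exists_rieszPotential_le hβ hβ1 hc
  have hG := Real.Gamma_pos_of_pos (show 0 < 1 - β by linarith)
  refine ⟨β * (1 / Real.Gamma (1 - β)) * D, by positivity, fun s hs => ?_⟩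
  calc jumpConvolution β c μ s
      = ∫⁻ v in Iio s, ENNReal.ofReal (jumpDensity β c (s - v)) ∂μ :=
        lintegral_indicator measurableSet_Iio _
    _ ≤ ∫⁻ v in Iio s, ENNReal.ofReal (β * (1 / Real.Gamma (1 - β))) *
          ENNReal.ofReal ((s - v) ^ (-β)) ∂μ := by
        refine setLIntegral_mono' measurableSet_Iio fun v hv => ?_
        rw [← ENNReal.ofReal_mul (by positivity)]
        exact ENNReal.ofReal_le_ofReal (jumpDensity_le hβ hβ1 hc (sub_pos.2 hv))
    _ = ENNReal.ofReal (β * (1 / Real.Gamma (1 - β))) * rieszPotential μ (-β) s :=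
        lintegral_const_mul' _ _ ENNReal.ofReal_ne_top
    _ ≤ _ := by
        rw [mul_assoc, ENNReal.ofReal_mul (p := β * (1 / Real.Gamma (1 - β))) (by positivity)]
        gcongr
        exact h s hs

/-- The substitution `s = u + v` in the size-bias identity shows that `s μ(ds)` is absolutely
continuous with density `jumpConvolution β c μ`, without assuming a density for `μ`. -/
lemma lintegral_ofReal_mul_eq_jumpConvolution (hμ : IsRelativisticLaw β c m μ) (hβ : 0 < β)
    (hβ1 : β < 1) (hc : 0 ≤ c) {f : ℝ → ℝ≥0∞} (hf : Measurable f) :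
    ∫⁻ s, ENNReal.ofReal s * f s ∂μ = ∫⁻ s, f s * jumpConvolution β c μ s := by
  have := hμ.prob
  have hmI := measurable_jumpConvolution_integrand (β := β) (c := c)
  have h1 : ∀ v : ℝ, ∫⁻ u in Ioi (0 : ℝ), ENNReal.ofReal (jumpDensity β c u) * f (u + v) =
      ∫⁻ s, f s * (Iio s).indicator (fun v => ENNReal.ofReal (jumpDensity β c (s - v))) v := by
    intro v
    rw [← lintegral_indicator measurableSet_Ioi, ← lintegral_add_right_eq_self
      (fun s => f s * (Iio s).indicator (fun v => ENNReal.ofReal (jumpDensity β c (s - v))) v) v]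
    refine lintegral_congr fun u => ?_
    by_cases hu : 0 < u
    · rw [indicator_of_mem (show u ∈ Ioi 0 from hu),
        indicator_of_mem (show v ∈ Iio (u + v) from by simpa using hu), add_sub_cancel_right,
        mul_comm]
    · rw [indicator_of_notMem (show u ∉ Ioi 0 from hu),
        indicator_of_notMem (show v ∉ Iio (u + v) from by simpa using hu), mul_zero]
  calc ∫⁻ s, ENNReal.ofReal s * f s ∂μ
      = ∫⁻ u in Ioi (0 : ℝ), ∫⁻ v, ENNReal.ofReal (jumpDensity β c u) * f (u + v) ∂μ := by
        rw [hμ.lintegral_ofReal_mul hβ hβ1 hc hf]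
        refine lintegral_congr fun u => ?_
        rw [lintegral_const_mul' _ _ ENNReal.ofReal_ne_top]
    _ = ∫⁻ v, (∫⁻ u in Ioi (0 : ℝ), ENNReal.ofReal (jumpDensity β c u) * f (u + v)) ∂μ := by
        refine lintegral_lintegral_swap (Measurable.aemeasurable ?_)
        exact ((measurable_jumpDensity.ennreal_ofReal).comp measurable_fst).mul
          (hf.comp (measurable_fst.add measurable_snd))
    _ = ∫⁻ v, (∫⁻ s, f s *
          (Iio s).indicator (fun v => ENNReal.ofReal (jumpDensity β c (s - v))) v) ∂μ :=
        lintegral_congr h1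
    _ = ∫⁻ s, ∫⁻ v, f s *
          (Iio s).indicator (fun v => ENNReal.ofReal (jumpDensity β c (s - v))) v ∂μ := by
        refine lintegral_lintegral_swap (Measurable.aemeasurable ?_)
        exact (hf.comp measurable_snd).mul (hmI.comp measurable_swap)
    _ = _ := by
        refine lintegral_congr fun s => ?_
        have hms : Measurable fun v =>
            (Iio s).indicator (fun v => ENNReal.ofReal (jumpDensity β c (s - v))) v :=
          hmI.comp measurable_prodMk_left
        rw [lintegral_const_mul _ hms, jumpConvolution]

/-- The mass of `Iic 0` is at most that of `Iio s`, which is of order `s` as `s` decreases to zero.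
An atom at zero would be invisible to the size-biased measure. -/
lemma ae_pos (hμ : IsRelativisticLaw β c m μ) (hβ : 0 < β) (hc : 0 ≤ c) : ∀ᵐ s ∂μ, 0 < s := by
  obtain ⟨C, hC, h⟩ := hμ.measure_Iio_le hβ hc one_pos
  have hz : μ (Iic 0) = 0 := by
    refine le_antisymm ?_ zero_le
    have ht : Tendsto (fun s : ℝ => ENNReal.ofReal (C * s)) (𝓝[>] 0) (𝓝 0) := by
      have : Continuous fun s : ℝ => ENNReal.ofReal (C * s) :=
        ENNReal.continuous_ofReal.comp (continuous_const.mul continuous_id)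
      have h2 := this.tendsto 0
      rw [mul_zero, ENNReal.ofReal_zero] at h2
      exact h2.mono_left nhdsWithin_le_nhds
    refine ge_of_tendsto ht ?_
    filter_upwards [self_mem_nhdsWithin] with s hs
    have hs : 0 < s := hs
    have h3 := h s hs
    rw [Real.rpow_one] at h3
    exact (measure_mono fun r (hr : r ≤ 0) => lt_of_le_of_lt hr hs).trans h3
  rw [ae_iff]
  refine measure_mono_null (fun s hs => ?_) hz
  exact not_lt.1 hs

/-- A relativistic stable law has a density which decays like a power. -/
theorem exists_density (hμ : IsRelativisticLaw β c m μ) (hβ : 0 < β) (hβ1 : β < 1) (hc : 0 ≤ c) :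
    ∃ (C : ℝ) (η : ℝ → ℝ), Measurable η ∧
      μ = (volume.restrict (Ioi 0)).withDensity (fun s => ENNReal.ofReal (η s)) ∧
      ∀ s : ℝ, 0 < s → 0 ≤ η s ∧ η s ≤ C * s ^ (-1 - β) := by
  have := hμ.prob
  obtain ⟨D, hD, h⟩ := hμ.jumpConvolution_le hβ hβ1 hc
  -- Dividing the density of `s μ(ds)` by `s`; the bound `s^(-β)` for the former becomes `s^(-1-β)`.
  set η : ℝ → ℝ := fun s => s⁻¹ * (jumpConvolution β c μ s).toReal with hη
  have hηm : Measurable η := measurable_inv.mul measurable_jumpConvolution.ennreal_toReal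
  refine ⟨D, η, hηm, ?_, fun s hs => ⟨by positivity, ?_⟩⟩
  · ext A hA
    have hfm : Measurable (A.indicator fun s : ℝ => ENNReal.ofReal s⁻¹) :=
      (measurable_inv.ennreal_ofReal).indicator hA
    have h1 := hμ.lintegral_ofReal_mul_eq_jumpConvolution hβ hβ1 hc hfm
    have h2 : ∫⁻ s, ENNReal.ofReal s * A.indicator (fun s : ℝ => ENNReal.ofReal s⁻¹) s ∂μ = μ A := by
      rw [← lintegral_indicator_one hA]
      refine lintegral_congr_ae ?_
      filter_upwards [hμ.ae_pos hβ hc] with s hs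
      by_cases hsA : s ∈ A
      · rw [indicator_of_mem hsA, indicator_of_mem hsA, ← ENNReal.ofReal_mul hs.le,
          mul_inv_cancel₀ hs.ne', ENNReal.ofReal_one, Pi.one_apply]
      · rw [indicator_of_notMem hsA, indicator_of_notMem hsA, mul_zero]
    rw [← h2, h1, withDensity_apply _ hA, ← lintegral_indicator hA,
      ← lintegral_indicator measurableSet_Ioi]
    refine lintegral_congr fun s => ?_
    by_cases hs : 0 < s
    · rw [indicator_of_mem (show s ∈ Ioi 0 from hs)]
      by_cases hsA : s ∈ A
      · have hfin : jumpConvolution β c μ s ≠ ∞ := ne_top_of_le_ne_top ENNReal.ofReal_ne_top (h s hs)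
        rw [indicator_of_mem hsA, indicator_of_mem hsA, hη,
          ENNReal.ofReal_mul (inv_nonneg.2 hs.le), ENNReal.ofReal_toReal hfin]
      · rw [indicator_of_notMem hsA, indicator_of_notMem hsA, zero_mul]
    · rw [indicator_of_notMem (show s ∉ Ioi 0 from hs)]
      have : ENNReal.ofReal s⁻¹ = 0 := ENNReal.ofReal_of_nonpos (inv_nonpos.2 (not_lt.1 hs))
      by_cases hsA : s ∈ A
      · rw [indicator_of_mem hsA, this, zero_mul]
      · rw [indicator_of_notMem hsA, zero_mul]
  · have h1 : (jumpConvolution β c μ s).toReal ≤ D * s ^ (-β) :=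
      ENNReal.toReal_le_of_le_ofReal (by positivity) (h s hs)
    calc s⁻¹ * (jumpConvolution β c μ s).toReal ≤ s⁻¹ * (D * s ^ (-β)) := by gcongr
      _ = D * s ^ (-1 - β) := by
          rw [sub_eq_add_neg, Real.rpow_add hs, Real.rpow_neg_one]
          ring

end IsRelativisticLaw

lemma densityTailBound_of_relativistic {Ω : Type*} [MeasurableSpace Ω] {P : Measure Ω}
    [IsProbabilityMeasure P] {T : ℝ≥0 → Ω → ℝ} (hT : IsSubordinator T P) {α m : ℝ} (hα : 0 < α)
    (hα2 : α < 2) (hm : 0 ≤ m) (hΦ : ∀ l : ℝ, 0 ≤ l →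
      laplaceExponent T P l = (l + m ^ (2 / α)) ^ (α / 2) - m) : DensityTailBound T P := by
  have hlaw : IsRelativisticLaw (α / 2) (m ^ (2 / α)) m (P.map (T 1)) :=
    ⟨hT.isProbabilityMeasure_map 1, hT.ae_nonneg_map 1, fun l hl => by
      rw [hT.laplace_map, hT.laplace_eq_exp hl, hΦ l hl]⟩
  obtain ⟨C, η, h1, h2, h3⟩ := hlaw.exists_density (by positivity) (by linarith) (by positivity)
  -- Here `β = α/2`, so the tail exponent `-1 - β` is `-1 - γ/2` with `γ = α`.
  exact ⟨C, α, η, hα, h1, h2, h3⟩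

end RelativisticDensity

/-! ### The main theorem and the relativistic example -/

theorem corollary4p2 (𝕜 : Type*) [RCLike 𝕜] (n : ℕ) (hn : 1 ≤ n)
    {Ω : Type*} [MeasurableSpace Ω] (P : Measure Ω) [IsProbabilityMeasure P]
    (B : ℝ≥0 → Ω → E n) (T : ℝ≥0 → Ω → ℝ)
    (hB : IsDoubleSpeedBrownianMotion B P) (hT : IsSubordinator T P)
    (hBT : IndepFun (fun ω t => B t ω) (fun ω t => T t ω) P) :
    -- the main assertion
    (LaplaceExponentGrowth T P → DensityTailBound T P →
      ∃ φ : E n → ℝ, IsSmoothDensity φ (subordinate B T 1) P ∧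
        ∀ A : E n → ℝ → Matrix (Fin (n + 1)) (Fin (n + 1)) 𝕜, IsAdmissible A →
          GeneratesCZ φ A) ∧
    -- relativistic `α`-stable processes with mass `m` are an example
    (∀ α m : ℝ, 0 < α → α < 2 → 0 ≤ m →
      (∀ l : ℝ, 0 ≤ l →
        laplaceExponent T P l = (l + m ^ (2 / α)) ^ (α / 2) - m) →
      (∀ (t : ℝ≥0) (ξ : E n), charFun (P.map (subordinate B T t)) ξ =
        Complex.exp (-((t : ℝ) * ((‖ξ‖ ^ 2 + m ^ (2 / α)) ^ (α / 2) - m) : ℝ))) ∧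
      LaplaceExponentGrowth T P ∧ DensityTailBound T P ∧
      ∃ φ : E n → ℝ, IsSmoothDensity φ (subordinate B T 1) P ∧
        ∀ A : E n → ℝ → Matrix (Fin (n + 1)) (Fin (n + 1)) 𝕜, IsAdmissible A →
          GeneratesCZ φ A) := by
  refine ⟨exists_smoothDensity_generatesCZ 𝕜 hn hB hT hBT, fun α m hα hα2 hm hΦ => ?_⟩
  have hg : LaplaceExponentGrowth T P := laplaceExponentGrowth_of_relativistic hα hm hΦ
  have hd : DensityTailBound T P := densityTailBound_of_relativistic hT hα hα2 hm hΦ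
  exact ⟨charFun_subordinate_relativistic hB hT hBT hΦ, hg, hd,
    exists_smoothDensity_generatesCZ 𝕜 hn hB hT hBT hg hd⟩
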